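/- Let $d\ge 0$ and let $n$ be the size parameter; put $N=(d+2)n$ and identify $\{0,\dots,2^n-1\}$ with a subset of $\mathbb Z_2^{N}$ by binary expansion. A *Simon function* is an $f:\mathbb Z_2^n\to\mathbb Z_2^n$ for which there is $s\neq 0$ with $f(x)=f(y)\iff y\in\{x,x\oplus s\}$. A *uniform $(d,f)$-shuffling* of $f$ is $(f_0,\dots,f_d)$, where $f_0,\dots,f_{d-1}$ are independent uniformly random permutations of $\mathbb Z_2^{N}$, $f_d(f_{d-1}\circ\cdots\circ f_0(x))=f(x)$ for $x\in\{0,\dots,2^n-1\}$, and $f_d=\bot$ at all other points. In the *$d$-shuffling Simon's problem* $d$-SSP, $f$ is, with probability $1/2$ each, a uniformly random Simon function or a uniformly random one-to-one function $\mathbb Z_2^n\to\mathbb Z_2^n$; given access to the oracle $\mathcal O:(i,x)\mapsto f_i(x)$ of a uniform $(d,f)$-shuffling, one has to decide which of the two is the case. A *$D$-QC scheme* with oracle $\mathcal O$ is a classical probabilistic algorithm with classical query access to $\mathcal O$ (a random access machine with unit-cost addition and subtraction) that controls a quantum register, initially $|0\cdots0\rangle$. It runs at most $D$ layers, each consisting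 of one- and two-qubit gates on disjoint qubits, then parallel oracle gates $|z,y\rangle\mapsto|z,y\oplus\mathcal O(z)\rangle$ on disjoint qubits, then a standard-basis measurement of a subset of the qubits; these are followed by at most one layer of gates and measurement without oracle gates. Before, between and after the layers the algorithm computes classically, and it chooses each layer from everything it has observed so far. A scheme is *polynomial* if for some polynomial $p$ it uses at most $p(n)$ qubits and $p(n)$ classical steps at size $n$. Then for every $d\in\mathbb N$: 1. There is a polynomial $(2d+1)$-QC scheme, given by one program for all $n$, which for every $n\ge 1$ decides $d$-SSP of size $n$ correctly with probability at least $1-2^{-(n+1)}$. 2. No $d$-QC scheme solves $d$-SSP: for every polynomial family of $d$-QC schemes, even non-uniform (an arbitrary program for each $n$), there is a polynomial $q$ such that for every $n$ the family decides $d$-SSP of size $n$ correctly with probability at most $\frac12+\sqrt{q(n)/2^n}$. The probabilities are over $f$, the shuffling, the coins of the algorithm and the measurement outcomes. -/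

import Mathlib

noncomputable section

namespace QCS

/-- The average of `g` over the finite set `S`, i.e. its expectation under the uniform
distribution on `S`. -/
def avg {α : Type} (S : Finset α) (g : α → ℝ) : ℝ := (∑ x ∈ S, g x) / (S.card : ℝ)

/-! ### Bit strings, Simon functions, shufflings -/

/-- Bit strings of length `m`; the addition of `ℤ₂^m` is `xorBits`. -/
abbrev Bits (m : ℕ) : Type := Fin m → Bool

def xorBits {m : ℕ} (x y : Bits m) : Bits m := fun i => xor (x i) (y i)

/-- `f` is two-to-one with a (nonzero) hidden shift `s`. -/
def IsSimon {n : ℕ} (f : Bits n → Bits n) : Prop :=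
  ∃ s : Bits n, s ≠ (fun _ => false) ∧ ∀ x y, f x = f y ↔ y = x ∨ y = xorBits x s

open Classical in
def simonFns (n : ℕ) : Finset (Bits n → Bits n) := Finset.univ.filter IsSimon

open Classical in
def oneToOneFns (n : ℕ) : Finset (Bits n → Bits n) :=
  Finset.univ.filter Function.Injective

/-- Length of the strings on which the shuffling functions act. -/
abbrev bigLen (d n : ℕ) : ℕ := (d + 2) * n

/-- The inclusion of `{0, …, 2^n - 1}` into `{0, …, 2^N - 1}` in binary (index `0` is the least
significant bit). -/
def embed {n : ℕ} (N : ℕ) (x : Bits n) : Bits N :=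
  fun i => if h : i.val < n then x ⟨i.val, h⟩ else false

/-- The composition `π_{d-1} ∘ ⋯ ∘ π_0`. -/
def chain {X : Type} {d : ℕ} (π : Fin d → Equiv.Perm X) : Equiv.Perm X :=
  (List.ofFn π).foldl (fun acc p => acc.trans p) (Equiv.refl X)

open Classical in
/-- The last function `f_d` of the shuffling of `f` determined by the permutations
`π = (f_0, …, f_{d-1})`: it sends `f_{d-1} ∘ ⋯ ∘ f_0 (x)` to `f x` for `x < 2^n`, and all
other points to `⊥` (here `none`). -/
def lastFn {d n : ℕ} (f : Bits n → Bits n) (π : Fin d → Equiv.Perm (Bits (bigLen d n)))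
    (y : Bits (bigLen d n)) : Option (Bits n) :=
  if h : ∃ x : Bits n, chain π (embed (bigLen d n) x) = y then some (f h.choose) else none

/-- The value `f_i(x)` of the shuffling `(f_0, …, f_d)`, as a string or `⊥`. -/
def shuffleVal {d n : ℕ} (f : Bits n → Bits n) (π : Fin d → Equiv.Perm (Bits (bigLen d n)))
    (i : Fin (d + 1)) (x : Bits (bigLen d n)) : Option (Bits (bigLen d n)) :=
  if h : i.val < d then some (π ⟨i.val, h⟩ x)
  else (lastFn f π x).map (embed (bigLen d n))

/-- Encoding of a string or `⊥` by one more bit: the last bit is set exactly for `⊥`. -/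
def encodeAnswer {N : ℕ} : Option (Bits N) → Bits (N + 1)
  | some y => fun i => if h : i.val < N then y ⟨i.val, h⟩ else false
  | none => fun i => decide (i.val = N)

/-- Bits of a query (`d + 1` bits for the index `i` in binary, then the argument `x`). -/
abbrev inLen (d n : ℕ) : ℕ := (d + 1) + bigLen d n

/-- Bits of an answer. -/
abbrev outLen (d n : ℕ) : ℕ := bigLen d n + 1

/-- The shuffling oracle as one Boolean function `(i, x) ↦ f_i(x)`. A query with index `> d`
is answered by the zero string. -/
def shuffleOracle {d n : ℕ} (f : Bits n → Bits n)
    (π : Fin d → Equiv.Perm (Bits (bigLen d n))) (z : Bits (inLen d n)) : Bits (outLen d n) :=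
  let i : ℕ := Nat.ofBits (fun j : Fin (d + 1) => z (Fin.castAdd (bigLen d n) j))
  if h : i < d + 1 then
    encodeAnswer (shuffleVal f π ⟨i, h⟩ (fun j => z (Fin.natAdd (d + 1) j)))
  else fun _ => false

/-! ### Quantum registers -/

/-- Vectors in the state space of `w` qubits, not necessarily normalised. -/
abbrev State (w : ℕ) : Type := Bits w → ℂ

def normSqr {w : ℕ} (ψ : State w) : ℝ := ∑ b, ‖ψ b‖ ^ 2

/-- The state `|0^w⟩`. -/
def zeroState (w : ℕ) : State w := fun b => if b = (fun _ => false) then 1 else 0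

def getBit {w : ℕ} (b : Bits w) (q : ℕ) : Bool := if h : q < w then b ⟨q, h⟩ else false

def setBit {w : ℕ} (b : Bits w) (q : ℕ) (v : Bool) : Bits w :=
  fun i => if i.val = q then v else b i

/-- A one- or two-qubit gate placed on named qubits. -/
inductive Gate : Type
  | one (U : Matrix.unitaryGroup Bool ℂ) (q : ℕ)
  | two (U : Matrix.unitaryGroup (Bool × Bool) ℂ) (p q : ℕ)

def Gate.wires : Gate → List ℕ
  | .one _ q => [q]
  | .two _ p q => [p, q]

def Gate.apply {w : ℕ} : Gate → State w → State w
  | .one U q, ψ => fun b => ∑ c : Bool, U.1 (getBit b q) c * ψ (setBit b q c)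
  | .two U p q, ψ => fun b => ∑ c : Bool × Bool,
      U.1 (getBit b p, getBit b q) c * ψ (setBit (setBit b p c.1) q c.2)

/-- One oracle gate: the qubits that hold the query and the qubits that receive the answer. -/
structure OracleGate (a b : ℕ) : Type where
  qin : Fin a → ℕ
  qout : Fin b → ℕ

def OracleGate.wires {a b : ℕ} (g : OracleGate a b) : List ℕ :=
  List.ofFn g.qin ++ List.ofFn g.qout

open Classical in
/-- `|x⟩|y⟩ ↦ |x⟩|y ⊕ O(x)⟩` on basis labels. -/
def OracleGate.flipLabel {a b w : ℕ} (O : Bits a → Bits b) (g : OracleGate a b) (l : Bits w) :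
    Bits w :=
  fun i => xor (l i)
    (decide (∃ j : Fin b, g.qout j = i.val ∧ O (fun k => getBit l (g.qin k)) j = true))

/-- The oracle gate as an operator; `flipLabel` is an involution on disjoint qubits, so it is
its own inverse. -/
def OracleGate.apply {a b w : ℕ} (O : Bits a → Bits b) (g : OracleGate a b) (ψ : State w) :
    State w :=
  fun l => ψ (g.flipLabel O l)

/-- A layer: gates applied in parallel, then oracle gates applied in parallel, then a
standard-basis measurement of a subset of the qubits. -/
structure Layer (a b : ℕ) : Type where
  gates : List Gate
  queries : List (OracleGate a b)
  measured : List ℕ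

def Layer.empty (a b : ℕ) : Layer a b := ⟨[], [], []⟩

/-- The gates act on disjoint qubits, so do the oracle gates, and all qubits exist. -/
def Layer.Valid {a b : ℕ} (w : ℕ) (L : Layer a b) : Prop :=
  (L.gates.flatMap Gate.wires).Nodup ∧ (∀ q ∈ L.gates.flatMap Gate.wires, q < w) ∧
  (L.queries.flatMap OracleGate.wires).Nodup ∧
  (∀ q ∈ L.queries.flatMap OracleGate.wires, q < w) ∧ (∀ q ∈ L.measured, q < w)

/-- The unitary part of a layer: first the gates, then the oracle gates. -/
def Layer.apply {a b w : ℕ} (O : Bits a → Bits b) (L : Layer a b) (ψ : State w) : State w :=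
  L.queries.foldl (fun φ g => g.apply O φ) (L.gates.foldl (fun φ g => g.apply φ) ψ)

open Classical in
/-- Unnormalised state after the qubits in `M` have been measured with outcome `z`. -/
def project {w : ℕ} (M : List ℕ) (z : Bits w) (ψ : State w) : State w :=
  fun l => if ∀ i : Fin w, i.val ∈ M → l i = z i then ψ l else 0

/-! ### Classical algorithms that control a quantum register

The classical part is a probabilistic random access machine with oracle, memory `ℕ → ℕ`, and
unit-cost addition and truncated subtraction. It describes the gates, oracle gates and measured
qubits of the next layer one by one; `fire` runs the layer. -/

/-- Programs. Arguments `x y z` are addresses of memory cells. -/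
inductive Cmd : Type
  | skip
  | const (x k : ℕ)
  | add (x y z : ℕ)
  | sub (x y z : ℕ)
  | load (x y : ℕ)
  | store (x y : ℕ)
  | flip (x : ℕ)
  | ask (x y : ℕ)
  | gate1 (U : Matrix.unitaryGroup Bool ℂ) (x : ℕ)
  | gate2 (U : Matrix.unitaryGroup (Bool × Bool) ℂ) (x y : ℕ)
  | query (x : ℕ)
  | measure (x : ℕ)
  | fire
  | read (x y : ℕ)
  | seq (c₁ c₂ : Cmd)
  | branch (x : ℕ) (c₁ c₂ : Cmd)
  | loop (x : ℕ) (c : Cmd)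

/-- A classical configuration: the commands still to be run, the memory, the description of the
layer under construction, the number of layers run so far, and the outcomes of the last
measurement. -/
structure Config (a b : ℕ) : Type where
  code : List Cmd
  mem : ℕ → ℕ
  layer : Layer a b
  fired : ℕ
  out : ℕ → Bool

/-- `v` is written into the `b` cells from address `s` on. -/
def writeBits {b : ℕ} (mem : ℕ → ℕ) (s : ℕ) (v : Bits b) : ℕ → ℕ :=
  fun y => if h : s ≤ y ∧ y - s < b then (v ⟨y - s, h.2⟩).toNat else mem y

open Classical in
/-- `run O D w v t c ψ` is the (unnormalised) probability that the machine, in configuration `c`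
with the `w` qubits in state `ψ`, halts within `t - 1` further steps with output `v`. The output
is read from cell `0` (nonzero means `true`). Coin flips branch with weight `1/2`; measurements
branch over their outcomes `z`, the weights being carried by the norm of the state. At most `D`
layers with oracle gates are run, followed by at most one layer without; a machine that attempts
anything else, or an invalid layer, is aborted without output. -/
def run {a b : ℕ} (O : Bits a → Bits b) (D w : ℕ) (v : Bool) :
    ℕ → Config a b → State w → ℝ
  | 0, _, _ => 0
  | t + 1, c, ψ =>
    match c.code with
    | [] => if decide (c.mem 0 ≠ 0) = v then normSqr ψ else 0
    | .skip :: k => run O D w v t { c with code := k } ψ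
    | .const x m :: k =>
        run O D w v t { c with code := k, mem := Function.update c.mem x m } ψ
    | .add x y z :: k =>
        run O D w v t { c with code := k, mem := Function.update c.mem x (c.mem y + c.mem z) } ψ
    | .sub x y z :: k =>
        run O D w v t { c with code := k, mem := Function.update c.mem x (c.mem y - c.mem z) } ψ
    | .load x y :: k =>
        run O D w v t { c with code := k, mem := Function.update c.mem x (c.mem (c.mem y)) } ψ
    | .store x y :: k =>
        run O D w v t { c with code := k, mem := Function.update c.mem (c.mem x) (c.mem y) } ψ
    | .flip x :: k =>
        (run O D w v t { c with code := k, mem := Function.update c.mem x 0 } ψ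
          + run O D w v t { c with code := k, mem := Function.update c.mem x 1 } ψ) / 2
    | .ask x y :: k =>
        run O D w v t { c with
          code := k
          mem := writeBits c.mem (c.mem y)
            (O (fun j => decide (c.mem (c.mem x + j.val) ≠ 0))) } ψ
    | .gate1 U x :: k =>
        run O D w v t { c with
          code := k
          layer := { c.layer with gates := Gate.one U (c.mem x) :: c.layer.gates } } ψ
    | .gate2 U x y :: k =>
        run O D w v t { c with
          code := k
          layer := { c.layer with gates := Gate.two U (c.mem x) (c.mem y) :: c.layer.gates } } ψ
    | .query x :: k =>
        run O D w v t { c with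
          code := k
          layer := { c.layer with
            queries := ⟨fun j => c.mem (c.mem x + j.val), fun j => c.mem (c.mem x + a + j.val)⟩
              :: c.layer.queries } } ψ
    | .measure x :: k =>
        run O D w v t { c with
          code := k
          layer := { c.layer with measured := c.mem x :: c.layer.measured } } ψ
    | .fire :: k =>
        if c.layer.Valid w ∧ (c.fired < D ∨ (c.fired = D ∧ c.layer.queries = [])) then
          ∑ z : Bits w, if ∀ i : Fin w, i.val ∉ c.layer.measured → z i = false then
            run O D w v t { c with
              code := k
              layer := Layer.empty a b
              fired := c.fired + 1
              out := getBit z } (project c.layer.measured z (c.layer.apply O ψ))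
          else 0
        else 0
    | .read x y :: k =>
        run O D w v t { c with
          code := k, mem := Function.update c.mem x (c.out (c.mem y)).toNat } ψ
    | .seq c₁ c₂ :: k => run O D w v t { c with code := c₁ :: c₂ :: k } ψ
    | .branch x c₁ c₂ :: k =>
        run O D w v t { c with code := (if c.mem x ≠ 0 then c₁ else c₂) :: k } ψ
    | .loop x c' :: k =>
        run O D w v t { c with code := if c.mem x ≠ 0 then c' :: .loop x c' :: k else k } ψ

/-- At the start cell `0` holds the input `n` and all other cells hold `0`. -/
def start (a b : ℕ) (P : Cmd) (n : ℕ) : Config a b :=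
  ⟨[P], fun x => if x = 0 then n else 0, Layer.empty a b, 0, fun _ => false⟩

/-- Probability that the program `P`, run on input `n` as a scheme of quantum depth `D` with `B`
qubits (initially `|0^B⟩`) and for fewer than `B` steps, halts with output `v`, given the
oracle `O`. -/
def outProb {a b : ℕ} (O : Bits a → Bits b) (D B : ℕ) (P : Cmd) (n : ℕ) (v : Bool) : ℝ :=
  run O D B v B (start a b P n) (zeroState B)

/-- Probability that `P`, as a scheme of quantum depth `D` with resource bound `B`, decides the
`d`-shuffling Simon's problem of size `n` correctly: `f` is, with probability `1/2` each, a
uniformly random Simon function (correct output `true`) or a uniformly random one-to-one function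
(correct output `false`), and the oracle is a uniformly random shuffling of `f`. -/
def successProb (d n D B : ℕ) (P : Cmd) : ℝ :=
  (1 / 2) * avg (simonFns n) (fun f =>
      avg (Finset.univ : Finset (Fin d → Equiv.Perm (Bits (bigLen d n)))) (fun π =>
        outProb (shuffleOracle f π) D B P n true))
    + (1 / 2) * avg (oneToOneFns n) (fun f =>
      avg (Finset.univ : Finset (Fin d → Equiv.Perm (Bits (bigLen d n)))) (fun π =>
        outProb (shuffleOracle f π) D B P n false))

end QCS

end

/-!
Upper bound. `simonProgram` runs Simon's algorithm on `2 n` copies in parallel. In each copy the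
layers evaluate `f_0, …, f_d` one after the other into separate registers and then undo
`f_{d-1}, …, f_0` (`schedule`, `foldl_schedule`); these are `2 d + 1` oracle layers, after which
only the argument `x` and `f x` are left (`computedState_ne_zero`). The last layer applies Hadamard
gates to the arguments and measures them. If `f` has the shift `s`, the state is invariant under
shifting an argument by `s`, so all samples are orthogonal to `s` (`spread_computedState_eq_zero`).
If `f` is one-to-one, the values `f x` determine the arguments, so no outcome is more probable than
under the uniform distribution (`normSqr_project_computedState_le`), and `2 n` uniform samples fail
to span with probability at most `2^{-n}` (`card_deficient_le`). Gaussian elimination on the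
classical machine tells the cases apart (`exec_evaluateCmd`). The rules for `Exec` reduce
statements about `run` to statements about a small structured language.

Lower bound. In terms of the compositions `π_{i-1} ∘ ⋯ ∘ π_0` (`compOracle`), a query of `f_i` at
`y` concerns the base point `x` with `y = (π_{i-1} ∘ ⋯ ∘ π_0)(x)`. `hiddenSet d n l` is a decreasing
chain of sets of base points, each a fraction `2^{-n}` of the preceding one, and all of them contain
the arguments of `f`. The `l`-th layer may use the oracle that is blank over the `l`-th hidden set
(`hidingOracle`): the layers before it have revealed nothing about which images of points of the
preceding set lie over the smaller one, since interchanging two such images does not change what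
they saw (`SwapInvariant`). So on average the `B` queries of a layer hit the hidden set with weight
of order `B / 2^n`, and a hybrid argument bounds the total error (`Tree.sum_eval_le`). With the
hiding oracles only the classical queries reveal values of `f`. These do not distinguish the two
kinds of functions unless two of the arguments queried differ by the shift (`Tree.sum_hyb_congr`),
which happens with probability of order `B^2 / 2^n`; `successProb_le` collects the errors.
-/

noncomputable section

namespace QCS

/-! ### Gates, oracle layers and measurements -/

theorem normSqr_nonneg {w : ℕ} (ψ : State w) : 0 ≤ normSqr ψ :=
  Finset.sum_nonneg fun _ _ => by positivity

theorem getBit_of_lt {w : ℕ} (b : Bits w) {q : ℕ} (h : q < w) : getBit b q = b ⟨q, h⟩ := by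
  simp [getBit, h]

theorem getBit_val {w : ℕ} (b : Bits w) (i : Fin w) : getBit b i.val = b i := by
  simp [getBit]

theorem getBit_setBit_self {w : ℕ} (b : Bits w) {q : ℕ} (h : q < w) (v : Bool) :
    getBit (setBit b q v) q = v := by
  simp [getBit, setBit, h]

theorem getBit_setBit_of_ne {w : ℕ} (b : Bits w) {p q : ℕ} (h : p ≠ q) (v : Bool) :
    getBit (setBit b q v) p = getBit b p := by
  simp [getBit, setBit, h]

theorem setBit_getBit {w : ℕ} (b : Bits w) (q : ℕ) : setBit b q (getBit b q) = b := by
  funext i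
  simp only [setBit]
  split_ifs with h
  · subst h; rw [getBit_val]
  · rfl

theorem setBit_setBit {w : ℕ} (b : Bits w) (q : ℕ) (u v : Bool) :
    setBit (setBit b q u) q v = setBit b q v := by
  funext i
  simp only [setBit]
  split_ifs <;> rfl

theorem setBit_comm {w : ℕ} (b : Bits w) {p q : ℕ} (h : p ≠ q) (u v : Bool) :
    setBit (setBit b p u) q v = setBit (setBit b q v) p u := by
  funext i
  simp only [setBit]
  split_ifs with h1 h2 <;> first | rfl | omega

theorem unitary_norm {κ : Type} [Fintype κ] [DecidableEq κ] (U : Matrix.unitaryGroup κ ℂ)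
    (x : κ → ℂ) : ∑ v, ‖∑ c, U.1 v c * x c‖ ^ 2 = ∑ c, ‖x c‖ ^ 2 := by
  have key : ∀ y : κ → ℂ, ((∑ v, ‖y v‖ ^ 2 : ℝ) : ℂ) = star y ⬝ᵥ y := by
    intro y
    simp [dotProduct, Complex.conj_mul']
  have h : star (U.1.mulVec x) ⬝ᵥ (U.1.mulVec x) = star x ⬝ᵥ x := by
    rw [Matrix.star_mulVec, Matrix.dotProduct_mulVec, Matrix.vecMul_vecMul]
    have : U.1.conjTranspose * U.1 = 1 := Matrix.mem_unitaryGroup_iff'.1 U.2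
    rw [this, Matrix.vecMul_one]
  have h2 := (key (U.1.mulVec x)).trans (h.trans (key x).symm)
  exact_mod_cast h2

/-- A unitary that acts on one component `g b` of the labels `b` preserves the norm; `s b v` is
the label `b` with this component replaced by `v`. -/
theorem sum_norm_unitary {L κ : Type} [Fintype L] [Fintype κ] [DecidableEq κ]
    [Nonempty κ] (g : L → κ) (s : L → κ → L) (h1 : ∀ b, s b (g b) = b)
    (h2 : ∀ b v v', s (s b v) v' = s b v') (h3 : ∀ b v, g (s b v) = v)
    (U : Matrix.unitaryGroup κ ℂ) (ψ : L → ℂ) :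
    ∑ b, ‖∑ c, U.1 (g b) c * ψ (s b c)‖ ^ 2 = ∑ b, ‖ψ b‖ ^ 2 := by
  -- `(b, v) ↦ (s b v, g b)` is an involution
  have avg : ∀ F : L → ℝ, ∑ b, ∑ v, F (s b v) = (Fintype.card κ : ℝ) * ∑ b, F b := by
    intro F
    have e : Function.Involutive (fun p : L × κ => (s p.1 p.2, g p.1)) := by
      rintro ⟨b, v⟩
      simp [h1, h2, h3]
    calc ∑ b, ∑ v, F (s b v) = ∑ p : L × κ, F (s p.1 p.2) := by
          rw [Fintype.sum_prod_type]
      _ = ∑ p : L × κ, F p.1 :=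
          Fintype.sum_bijective _ e.bijective _ _ (fun p => rfl)
      _ = _ := by
          rw [Fintype.sum_prod_type, Finset.mul_sum]
          simp
  have hk : (Fintype.card κ : ℝ) ≠ 0 := by simp
  apply mul_left_cancel₀ hk
  rw [← avg, ← avg]
  refine Finset.sum_congr rfl fun b _ => ?_
  simp only [h2, h3]
  exact unitary_norm U (fun c => ψ (s b c))

theorem Gate.normSqr_apply {w : ℕ} (g : Gate) (hn : g.wires.Nodup) (hw : ∀ q ∈ g.wires, q < w)
    (ψ : State w) : normSqr (g.apply ψ) = normSqr ψ := by
  cases g with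
  | one U q =>
    have hq : q < w := hw q (by simp [Gate.wires])
    exact sum_norm_unitary (fun b : Bits w => getBit b q) (fun b v => setBit b q v)
      (fun b => setBit_getBit b q) (fun b v v' => setBit_setBit b q v v')
      (fun b v => getBit_setBit_self b hq v) U ψ
  | two U p q =>
    have hp : p < w := hw p (by simp [Gate.wires])
    have hq : q < w := hw q (by simp [Gate.wires])
    have hpq : p ≠ q := by simpa [Gate.wires] using hn
    refine sum_norm_unitary (fun b : Bits w => (getBit b p, getBit b q))
      (fun b v => setBit (setBit b p v.1) q v.2) (fun b => ?_) (fun b v v' => ?_)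
      (fun b v => ?_) U ψ
    · simp [setBit_getBit]
    · rw [setBit_comm _ hpq.symm, setBit_setBit, setBit_setBit]
    · simp [getBit_setBit_self, getBit_setBit_of_ne, hp, hq, hpq]

theorem Gate.apply_add {w : ℕ} (g : Gate) (ψ φ : State w) :
    g.apply (ψ + φ) = g.apply ψ + g.apply φ := by
  cases g <;> funext b <;>
    simp only [Gate.apply, Pi.add_apply, mul_add, Finset.sum_add_distrib]

/-- The gates of a layer, without its oracle gates. -/
def applyGates {w : ℕ} (gs : List Gate) (ψ : State w) : State w :=
  gs.foldl (fun φ g => g.apply φ) ψ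

theorem applyGates_add {w : ℕ} (gs : List Gate) (ψ φ : State w) :
    applyGates gs (ψ + φ) = applyGates gs ψ + applyGates gs φ := by
  induction gs generalizing ψ φ with
  | nil => rfl
  | cons g gs ih =>
    change applyGates gs (g.apply (ψ + φ)) = _
    rw [Gate.apply_add, ih]; rfl

theorem normSqr_applyGates {w : ℕ} (gs : List Gate) (hn : (gs.flatMap Gate.wires).Nodup)
    (hw : ∀ q ∈ gs.flatMap Gate.wires, q < w) (ψ : State w) :
    normSqr (applyGates gs ψ) = normSqr ψ := by
  induction gs generalizing ψ with
  | nil => rfl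
  | cons g gs ih =>
    simp only [List.flatMap_cons, List.nodup_append, List.mem_append] at hn hw
    change normSqr (applyGates gs (g.apply ψ)) = _
    rw [ih hn.2.1 (fun q hq => hw q (Or.inr hq)),
      Gate.normSqr_apply g hn.1 (fun q hq => hw q (Or.inl hq))]

open Classical in
/-- The joint action `|z⟩|y⟩ ↦ |z⟩|y ⊕ O(z)⟩` of parallel oracle gates on basis labels. -/
def flipAll {a b w : ℕ} (O : Bits a → Bits b) (Q : List (OracleGate a b)) (l : Bits w) : Bits w :=
  fun i => xor (l i) (decide (∃ g ∈ Q, ∃ j : Fin b, g.qout j = i.val ∧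
    O (fun k => getBit l (g.qin k)) j = true))

/-- No oracle gate of the list writes into a qubit from which one of them reads. -/
def Separated {a b : ℕ} (Q : List (OracleGate a b)) : Prop :=
  ∀ g ∈ Q, ∀ g' ∈ Q, ∀ k j, g.qin k ≠ g'.qout j

theorem separated_of_nodup {a b : ℕ} {Q : List (OracleGate a b)}
    (h : (Q.flatMap OracleGate.wires).Nodup) : Separated Q := by
  rw [List.nodup_flatMap] at h
  intro g hg g' hg' k j e
  have hm : g.qin k ∈ g.wires := by simp [OracleGate.wires, List.mem_ofFn]
  have hm' : g'.qout j ∈ g'.wires := by simp [OracleGate.wires, List.mem_ofFn]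
  by_cases hgg : g = g'
  · subst hgg
    have := h.1 g hg
    rw [OracleGate.wires, List.nodup_append] at this
    exact this.2.2 (g.qin k) (by simp [List.mem_ofFn]) _ (by simp [List.mem_ofFn]) e
  · have : Std.Symm (Function.onFun List.Disjoint (OracleGate.wires (a := a) (b := b))) :=
      ⟨fun _ _ h => List.Disjoint.symm h⟩
    exact h.2.forall hg hg' hgg hm (e ▸ hm')

theorem getBit_flipAll {a b w : ℕ} (O : Bits a → Bits b) {Q : List (OracleGate a b)}
    (l : Bits w) (q : ℕ) (h : ∀ g ∈ Q, ∀ j, g.qout j ≠ q) :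
    getBit (flipAll O Q l) q = getBit l q := by
  unfold getBit
  split_ifs with hq
  · simp only [flipAll]
    rw [decide_eq_false]
    · simp
    · rintro ⟨g, hg, j, hj, -⟩
      exact h g hg j hj
  · rfl

theorem input_flipAll {a b w : ℕ} (O : Bits a → Bits b) {Q : List (OracleGate a b)}
    (hQ : Separated Q) (l : Bits w) (g : OracleGate a b) (hg : g ∈ Q) :
    (fun k => getBit (flipAll O Q l) (g.qin k)) = fun k => getBit l (g.qin k) := by
  funext k
  exact getBit_flipAll O l _ fun g' hg' j h => hQ g hg g' hg' k j h.symm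

theorem flipAll_flipAll {a b w : ℕ} (O : Bits a → Bits b) {Q : List (OracleGate a b)}
    (hQ : Separated Q) (l : Bits w) : flipAll O Q (flipAll O Q l) = l := by
  funext i
  have : ∀ g ∈ Q, ∀ j, (g.qout j = i.val ∧ O (fun k => getBit (flipAll O Q l) (g.qin k)) j = true)
      ↔ (g.qout j = i.val ∧ O (fun k => getBit l (g.qin k)) j = true) := by
    intro g hg j
    rw [input_flipAll O hQ l g hg]
  have e : (∃ g ∈ Q, ∃ j, g.qout j = i.val ∧
        O (fun k => getBit (flipAll O Q l) (g.qin k)) j = true)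
      ↔ (∃ g ∈ Q, ∃ j, g.qout j = i.val ∧ O (fun k => getBit l (g.qin k)) j = true) := by
    constructor
    · rintro ⟨g, hg, j, h⟩; exact ⟨g, hg, j, (this g hg j).1 h⟩
    · rintro ⟨g, hg, j, h⟩; exact ⟨g, hg, j, (this g hg j).2 h⟩
  conv_lhs => rw [flipAll]
  simp only [e]
  simp [flipAll]

theorem foldl_oracle {a b w : ℕ} (O : Bits a → Bits b) (Q : List (OracleGate a b))
    (hQ : (Q.flatMap OracleGate.wires).Nodup) (ψ : State w) (l : Bits w) :
    Q.foldl (fun φ g => g.apply O φ) ψ l = ψ (flipAll O Q l) := by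
  induction Q generalizing ψ with
  | nil => simp only [List.foldl_nil]; congr 1; funext i; simp [flipAll]
  | cons g Q ih =>
    have hs := separated_of_nodup hQ
    simp only [List.flatMap_cons, List.nodup_append] at hQ
    rw [List.foldl_cons, ih hQ.2.1]
    simp only [OracleGate.apply]
    congr 1
    funext i
    have hin : (fun k => getBit (flipAll O Q l) (g.qin k)) = fun k => getBit l (g.qin k) := by
      funext k
      exact getBit_flipAll O l _ fun g' hg' j h =>
        hs g (by simp) g' (by simp [hg']) k j h.symm
    simp only [OracleGate.flipLabel, hin]
    have hex : ¬ ((∃ j, g.qout j = i.val ∧ O (fun k => getBit l (g.qin k)) j = true) ∧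
        (∃ g ∈ Q, ∃ j, g.qout j = i.val ∧ O (fun k => getBit l (g.qin k)) j = true)) := by
      rintro ⟨⟨j, hj, -⟩, g', hg', j', hj', -⟩
      refine hQ.2.2 (g.qout j) (by simp [OracleGate.wires, List.mem_ofFn]) (g'.qout j') ?_
        (hj.trans hj'.symm)
      exact List.mem_flatMap.2 ⟨g', hg', by simp [OracleGate.wires, List.mem_ofFn]⟩
    simp only [flipAll, List.mem_cons, exists_eq_or_imp]
    by_cases h1 : (∃ j, g.qout j = i.val ∧ O (fun k => getBit l (g.qin k)) j = true) <;>
    by_cases h2 : (∃ g ∈ Q, ∃ j, g.qout j = i.val ∧ O (fun k => getBit l (g.qin k)) j = true)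
    · exact absurd ⟨h1, h2⟩ hex
    all_goals simp [h1, h2]

theorem Layer.apply_eq {a b w : ℕ} (O : Bits a → Bits b) (L : Layer a b)
    (hQ : (L.queries.flatMap OracleGate.wires).Nodup) (ψ : State w) :
    L.apply O ψ = fun l => applyGates L.gates ψ (flipAll O L.queries l) := by
  funext l
  exact foldl_oracle O L.queries hQ _ l

theorem Layer.apply_add {a b w : ℕ} (O : Bits a → Bits b) (L : Layer a b)
    (hQ : (L.queries.flatMap OracleGate.wires).Nodup) (ψ φ : State w) :
    L.apply O (ψ + φ) = L.apply O ψ + L.apply O φ := by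
  simp only [Layer.apply_eq O L hQ, applyGates_add]
  rfl

theorem flipAll_bijective {a b w : ℕ} (O : Bits a → Bits b) {Q : List (OracleGate a b)}
    (hQ : Separated Q) : Function.Bijective (flipAll O Q : Bits w → Bits w) :=
  Function.Involutive.bijective (flipAll_flipAll O hQ)

theorem Layer.normSqr_apply {a b w : ℕ} (O : Bits a → Bits b) (L : Layer a b) (hL : L.Valid w)
    (ψ : State w) : normSqr (L.apply O ψ) = normSqr ψ := by
  rw [Layer.apply_eq O L hL.2.2.1, ← normSqr_applyGates L.gates hL.1 hL.2.1 ψ]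
  exact Fintype.sum_bijective _ (flipAll_bijective O (separated_of_nodup hL.2.2.1)) _ _
    (fun _ => rfl)

theorem project_add {w : ℕ} (M : List ℕ) (z : Bits w) (ψ φ : State w) :
    project M z (ψ + φ) = project M z ψ + project M z φ := by
  funext l
  simp only [project, Pi.add_apply]
  split_ifs <;> simp

open Classical in
/-- The possible outcomes of a measurement partition the labels. -/
theorem sum_normSqr_project {w : ℕ} (M : List ℕ) (φ : State w) :
    (∑ z : Bits w, if ∀ i : Fin w, i.val ∉ M → z i = false then normSqr (project M z φ) else 0)
      = normSqr φ := by
  have : ∀ z l : Bits w, ((∀ i : Fin w, i.val ∉ M → z i = false) ∧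
      ∀ i : Fin w, i.val ∈ M → l i = z i) ↔ z = fun i => if i.val ∈ M then l i else false := by
    intro z l
    constructor
    · rintro ⟨h1, h2⟩
      funext i
      split_ifs with h
      · exact (h2 i h).symm
      · exact h1 i h
    · rintro rfl
      constructor <;> intro i hi <;> simp [hi]
  calc _ = ∑ z : Bits w, ∑ l : Bits w,
        if z = (fun i => if i.val ∈ M then l i else false) then ‖φ l‖ ^ 2 else 0 := by
        refine Finset.sum_congr rfl fun z _ => ?_
        simp only [← this, normSqr, project]
        split_ifs with h
        · refine Finset.sum_congr rfl fun l _ => ?_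
          split_ifs with h1 h2 h2 <;> simp_all
        · simp [h]
    _ = _ := by
        rw [Finset.sum_comm]
        simp [normSqr]

theorem normSqr_sub_le {w : ℕ} (lam : ℝ) (hl : 0 < lam) (ψ φ : State w) :
    normSqr (ψ + φ) ≤ (1 + lam) * normSqr ψ + (1 + 1 / lam) * normSqr φ := by
  simp only [normSqr, Finset.mul_sum]
  rw [← Finset.sum_add_distrib]
  refine Finset.sum_le_sum fun b _ => ?_
  have h := norm_add_le (ψ b) (φ b)
  set x := ‖ψ b‖
  set y := ‖φ b‖
  have h2 : ‖(ψ + φ) b‖ ^ 2 ≤ (x + y) ^ 2 := by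
    exact pow_le_pow_left₀ (norm_nonneg _) h 2
  have h3 : 2 * x * y ≤ lam * x ^ 2 + 1 / lam * y ^ 2 := by
    have h4 : 0 ≤ (lam * x - y) ^ 2 / lam := by positivity
    have h5 : (lam * x - y) ^ 2 / lam = lam * x ^ 2 - 2 * x * y + 1 / lam * y ^ 2 := by
      field_simp
      ring
    linarith
  nlinarith

theorem normSqr_zeroState (w : ℕ) : normSqr (zeroState w) = 1 := by
  simp only [normSqr, zeroState]
  rw [Finset.sum_eq_single (fun _ => false)] <;> simp +contextual

/-! ### Schemes as decision trees -/

/-- The interaction of a scheme with its oracle and its `w` qubits as a tree: `abort` gives no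
output, `leaf` an output, `coin` is a fair coin flip, `ask` a classical query that is continued
according to the answer, and `layer` a quantum layer that is continued according to the outcomes
of the measurement. -/
inductive Tree (a b w : ℕ) : Type
  | abort
  | leaf (u : Bool)
  | coin (l r : Tree a b w)
  | ask (z : Bits a) (k : Bits b → Tree a b w)
  | layer (L : Layer a b) (k : Bits w → Tree a b w)

open Classical in
/-- The unnormalised probability of the output `v`. -/
def Tree.eval {a b w : ℕ} (O : Bits a → Bits b) (v : Bool) : Tree a b w → State w → ℝ
  | .abort, _ => 0
  | .leaf u, ψ => if u = v then normSqr ψ else 0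
  | .coin l r, ψ => (l.eval O v ψ + r.eval O v ψ) / 2
  | .ask z k, ψ => (k (O z)).eval O v ψ
  | .layer L k, ψ => ∑ z : Bits w, if ∀ i : Fin w, i.val ∉ L.measured → z i = false then
      (k z).eval O v (project L.measured z (L.apply O ψ)) else 0

/-- In a tree with `l` layers above it, at most `t` classical queries are asked on a path, all
layers are valid with at most `B` oracle gates, and only the first `D` layers have oracle
gates. -/
def Tree.Ok {a b w : ℕ} (D B : ℕ) : Tree a b w → ℕ → ℕ → Prop
  | .abort, _, _ => True
  | .leaf _, _, _ => True
  | .coin T₁ T₂, l, t => T₁.Ok D B l t ∧ T₂.Ok D B l t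
  | .ask _ k, l, t => ∃ t', t' + 1 ≤ t ∧ ∀ o, (k o).Ok D B l t'
  | .layer L k, l, t => L.Valid w ∧ L.queries.length ≤ B ∧ (l < D ∨ L.queries = []) ∧
      ∀ z, (k z).Ok D B (l + 1) t

theorem Tree.Ok.mono {a b w D B : ℕ} {T : Tree a b w} {l t t' : ℕ} (h : T.Ok D B l t)
    (htt : t ≤ t') : T.Ok D B l t' := by
  induction T generalizing l t t' with
  | abort => trivial
  | leaf u => trivial
  | coin T₁ T₂ ih₁ ih₂ => exact ⟨ih₁ h.1 htt, ih₂ h.2 htt⟩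
  | ask z k ih =>
    obtain ⟨s, hs, hk⟩ := h
    exact ⟨s, hs.trans htt, hk⟩
  | layer L k ih => exact ⟨h.1, h.2.1, h.2.2.1, fun z => ih z (h.2.2.2 z) htt⟩

open Classical in
/-- The tree of a machine that runs for `t` steps from a configuration. -/
def toTree {a b : ℕ} (D w : ℕ) : ℕ → Config a b → Tree a b w
  | 0, _ => .abort
  | t + 1, c =>
    match c.code with
    | [] => .leaf (decide (c.mem 0 ≠ 0))
    | .skip :: k => toTree D w t { c with code := k }
    | .const x m :: k => toTree D w t { c with code := k, mem := Function.update c.mem x m }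
    | .add x y z :: k =>
        toTree D w t { c with code := k, mem := Function.update c.mem x (c.mem y + c.mem z) }
    | .sub x y z :: k =>
        toTree D w t { c with code := k, mem := Function.update c.mem x (c.mem y - c.mem z) }
    | .load x y :: k =>
        toTree D w t { c with code := k, mem := Function.update c.mem x (c.mem (c.mem y)) }
    | .store x y :: k =>
        toTree D w t { c with code := k, mem := Function.update c.mem (c.mem x) (c.mem y) }
    | .flip x :: k =>
        .coin (toTree D w t { c with code := k, mem := Function.update c.mem x 0 })
          (toTree D w t { c with code := k, mem := Function.update c.mem x 1 })
    | .ask x y :: k =>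
        .ask (fun j => decide (c.mem (c.mem x + j.val) ≠ 0)) fun o =>
          toTree D w t { c with code := k, mem := writeBits c.mem (c.mem y) o }
    | .gate1 U x :: k =>
        toTree D w t { c with
          code := k
          layer := { c.layer with gates := Gate.one U (c.mem x) :: c.layer.gates } }
    | .gate2 U x y :: k =>
        toTree D w t { c with
          code := k
          layer := { c.layer with gates := Gate.two U (c.mem x) (c.mem y) :: c.layer.gates } }
    | .query x :: k =>
        toTree D w t { c with
          code := k
          layer := { c.layer with
            queries := ⟨fun j => c.mem (c.mem x + j.val), fun j => c.mem (c.mem x + a + j.val)⟩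
              :: c.layer.queries } }
    | .measure x :: k =>
        toTree D w t { c with
          code := k
          layer := { c.layer with measured := c.mem x :: c.layer.measured } }
    | .fire :: k =>
        if c.layer.Valid w ∧ (c.fired < D ∨ (c.fired = D ∧ c.layer.queries = [])) then
          .layer c.layer fun z => toTree D w t { c with
            code := k
            layer := Layer.empty a b
            fired := c.fired + 1
            out := getBit z }
        else .abort
    | .read x y :: k =>
        toTree D w t { c with
          code := k, mem := Function.update c.mem x (c.out (c.mem y)).toNat }
    | .seq c₁ c₂ :: k => toTree D w t { c with code := c₁ :: c₂ :: k }
    | .branch x c₁ c₂ :: k => toTree D w t { c with code := (if c.mem x ≠ 0 then c₁ else c₂) :: k }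
    | .loop x c' :: k =>
        toTree D w t { c with code := if c.mem x ≠ 0 then c' :: .loop x c' :: k else k }

theorem run_eq_eval {a b : ℕ} (O : Bits a → Bits b) (D w : ℕ) (v : Bool) (t : ℕ)
    (c : Config a b) (ψ : State w) : run O D w v t c ψ = (toTree D w t c).eval O v ψ := by
  induction t generalizing c ψ with
  | zero => rfl
  | succ t ih =>
    obtain ⟨code, mem, layer, fired, out⟩ := c
    cases code with
    | nil => rfl
    | cons cmd k =>
      cases cmd <;> simp only [run, toTree, ih, Tree.eval]
      split_ifs
      · simp only [Tree.eval]
      · rfl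

theorem toTree_ok {a b : ℕ} (D w B : ℕ) (t : ℕ) (c : Config a b)
    (h : c.layer.queries.length + t ≤ B) : (toTree D w t c).Ok D B c.fired t := by
  induction t generalizing c with
  | zero => trivial
  | succ t ih =>
    obtain ⟨code, mem, layer, fired, out⟩ := c
    simp only at h
    cases code with
    | nil => trivial
    | cons cmd k =>
      cases cmd with
      | flip x =>
        exact ⟨(ih _ (by simp only; omega)).mono t.le_succ,
          (ih _ (by simp only; omega)).mono t.le_succ⟩
      | ask x y => exact ⟨t, le_rfl, fun o => ih _ (by simp only; omega)⟩
      | query x =>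
        exact (ih _ (by simp only [List.length_cons]; omega)).mono t.le_succ
      | fire =>
        simp only [toTree]
        split_ifs with hv
        · refine ⟨hv.1, by omega, hv.2.imp id And.right, fun z => ?_⟩
          exact (ih _ (by simp only [Layer.empty, List.length_nil]; omega)).mono t.le_succ
        · trivial
      | _ => exact (ih _ (by simp only; omega)).mono t.le_succ

theorem Tree.eval_nonneg {a b w : ℕ} (O : Bits a → Bits b) (v : Bool) (T : Tree a b w)
    (ψ : State w) : 0 ≤ T.eval O v ψ := by
  induction T generalizing ψ with
  | abort => exact le_rfl
  | leaf u => simp only [eval]; split_ifs; exacts [normSqr_nonneg ψ, le_rfl]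
  | coin l r ih₁ ih₂ => simp only [eval]; linarith [ih₁ ψ, ih₂ ψ]
  | ask z k ih => exact ih _ ψ
  | layer L k ih =>
    refine Finset.sum_nonneg fun z _ => ?_
    split_ifs
    exacts [ih z _, le_rfl]

theorem Tree.eval_le {a b w D B : ℕ} (O : Bits a → Bits b) (v : Bool) (T : Tree a b w)
    (l t : ℕ) (hT : T.Ok D B l t) (ψ : State w) : T.eval O v ψ ≤ normSqr ψ := by
  induction T generalizing ψ l t with
  | abort => exact normSqr_nonneg ψ
  | leaf u => simp only [eval]; split_ifs; exacts [le_rfl, normSqr_nonneg ψ]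
  | coin T₁ T₂ ih₁ ih₂ => simp only [eval]; linarith [ih₁ l t hT.1 ψ, ih₂ l t hT.2 ψ]
  | ask z k ih =>
    obtain ⟨s, -, hk⟩ := hT
    exact ih _ l s (hk _) ψ
  | layer L k ih =>
    rw [← Layer.normSqr_apply O L hT.1, ← sum_normSqr_project L.measured]
    refine Finset.sum_le_sum fun z _ => ?_
    split_ifs
    exacts [ih z _ _ (hT.2.2.2 z) _, le_rfl]

/-- The output probability is a sum of squared norms of linear images of the state. -/
theorem Tree.eval_add_le {a b w D B : ℕ} (O : Bits a → Bits b) (v : Bool) (T : Tree a b w)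
    (l t : ℕ) (hT : T.Ok D B l t) (lam : ℝ) (hl : 0 < lam) (ψ φ : State w) :
    T.eval O v (ψ + φ) ≤ (1 + lam) * T.eval O v ψ + (1 + 1 / lam) * T.eval O v φ := by
  induction T generalizing ψ φ l t with
  | abort => simp [eval]
  | leaf u =>
    simp only [eval]
    split_ifs
    · exact normSqr_sub_le lam hl ψ φ
    · simp
  | coin T₁ T₂ ih₁ ih₂ =>
    simp only [eval]; linarith [ih₁ l t hT.1 ψ φ, ih₂ l t hT.2 ψ φ]
  | ask z k ih =>
    obtain ⟨s, -, hk⟩ := hT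
    exact ih _ l s (hk _) ψ φ
  | layer L k ih =>
    simp only [eval]
    rw [Finset.mul_sum, Finset.mul_sum, ← Finset.sum_add_distrib]
    refine Finset.sum_le_sum fun z _ => ?_
    split_ifs
    · rw [Layer.apply_add O L hT.1.2.2.1, project_add]
      exact ih z _ _ (hT.2.2.2 z) _ _
    · simp

open Classical in
/-- Replacing the oracle changes the state after a layer only through the labels that make some
oracle gate query a point at which the two oracles differ. -/
theorem Layer.normSqr_apply_sub_le {a b w : ℕ} (O G : Bits a → Bits b) (L : Layer a b)
    (hL : L.Valid w) (ψ : State w) :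
    normSqr (L.apply O ψ - L.apply G ψ) ≤ 4 * ∑ l : Bits w,
      if ∃ g ∈ L.queries, O (fun k => getBit l (g.qin k)) ≠ G (fun k => getBit l (g.qin k))
      then ‖applyGates L.gates ψ l‖ ^ 2 else 0 := by
  have hs := separated_of_nodup hL.2.2.1
  set φ := applyGates L.gates ψ
  let bad : Bits w → Prop := fun l =>
    ∃ g ∈ L.queries, O (fun k => getBit l (g.qin k)) ≠ G (fun k => getBit l (g.qin k))
  have hbad : ∀ (R : Bits a → Bits b) l, bad (flipAll R L.queries l) ↔ bad l := by
    intro R l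
    refine exists_congr fun g => and_congr_right fun hg => ?_
    rw [input_flipAll R hs l g hg]
  have hgood : ∀ l, ¬ bad l → flipAll O L.queries l = flipAll G L.queries l := by
    intro l hl
    have : ∀ g ∈ L.queries,
        O (fun k => getBit l (g.qin k)) = G (fun k => getBit l (g.qin k)) := by
      intro g hg
      by_contra hne
      exact hl ⟨g, hg, hne⟩
    funext i
    simp only [flipAll]
    congr 1
    refine decide_eq_decide.2 (exists_congr fun g => and_congr_right fun hg => ?_)
    rw [this g hg]
  have hsum : ∀ R : Bits a → Bits b,
      (∑ l, if bad l then ‖φ (flipAll R L.queries l)‖ ^ 2 else 0) =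
        ∑ l, if bad l then ‖φ l‖ ^ 2 else 0 := by
    intro R
    refine Fintype.sum_bijective _ (flipAll_bijective R hs) _ _ fun l => ?_
    simp only [hbad]
  calc normSqr (L.apply O ψ - L.apply G ψ)
      ≤ ∑ l, (2 * (if bad l then ‖φ (flipAll O L.queries l)‖ ^ 2 else 0)
          + 2 * (if bad l then ‖φ (flipAll G L.queries l)‖ ^ 2 else 0)) := by
        rw [Layer.apply_eq O L hL.2.2.1, Layer.apply_eq G L hL.2.2.1]
        refine Finset.sum_le_sum fun l _ => ?_
        simp only [Pi.sub_apply]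
        split_ifs with h
        · have h1 := norm_sub_le (φ (flipAll O L.queries l)) (φ (flipAll G L.queries l))
          have h2 := pow_le_pow_left₀ (norm_nonneg _) h1 2
          refine h2.trans ?_
          nlinarith [sq_nonneg (‖φ (flipAll O L.queries l)‖ - ‖φ (flipAll G L.queries l)‖)]
        · change ‖φ _ - φ _‖ ^ 2 ≤ _
          rw [hgood l h]
          simp
    _ = _ := by
        rw [Finset.sum_add_distrib, ← Finset.mul_sum, ← Finset.mul_sum, hsum, hsum]
        ring

/-! ### The shuffling oracle in terms of compositions of the permutations -/

theorem embed_injective {n N : ℕ} (h : n ≤ N) : Function.Injective (embed N : Bits n → Bits N) := by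
  intro x y hxy
  funext i
  have := congrFun hxy ⟨i.val, i.2.trans_le h⟩
  simpa [embed] using this

theorem le_bigLen (d n : ℕ) : n ≤ bigLen d n := Nat.le_mul_of_pos_left n (by omega)

/-- The composition of the first `i` permutations, if the compositions of positive length are
given by the family `c`. -/
def level {d : ℕ} {X : Type} (c : Fin d → Equiv.Perm X) (i : ℕ) : Equiv.Perm X :=
  match i with
  | 0 => 1
  | i + 1 => if h : i < d then c ⟨i, h⟩ else 1

/-- The composition of the first `i` permutations of `π`. -/
def partialChain {d : ℕ} {X : Type} (π : Fin d → Equiv.Perm X) : ℕ → Equiv.Perm X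
  | 0 => 1
  | i + 1 => if h : i < d then π ⟨i, h⟩ * partialChain π i else 1

theorem chain_eq {d : ℕ} {X : Type} (π : Fin d → Equiv.Perm X) : chain π = partialChain π d := by
  have key : ∀ i, i ≤ d →
      ((List.ofFn π).take i).foldl (fun acc p => acc.trans p) (Equiv.refl X)
        = partialChain π i := by
    intro i
    induction i with
    | zero => intro _; rfl
    | succ i ih =>
      intro hi
      have hlt : i < (List.ofFn π).length := by simpa using hi
      rw [List.take_succ_eq_append_getElem hlt, List.foldl_append, ih (by omega)]
      simp only [List.foldl_cons, List.foldl_nil, List.getElem_ofFn, partialChain]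
      rw [dif_pos (by omega)]
      rfl
  have := key d le_rfl
  rwa [List.take_of_length_le (by simp)] at this

/-- The compositions `π_{i-1} ∘ ⋯ ∘ π_0`, for `i = 1, …, d`. -/
def compositions {d : ℕ} {X : Type} (π : Fin d → Equiv.Perm X) : Fin d → Equiv.Perm X :=
  fun i => partialChain π (i.val + 1)

theorem level_compositions {d : ℕ} {X : Type} (π : Fin d → Equiv.Perm X) (i : ℕ) (hi : i ≤ d) :
    level (compositions π) i = partialChain π i := by
  cases i with
  | zero => rfl
  | succ i => simp [level, compositions, Nat.lt_of_succ_le hi]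

theorem compositions_injective {d : ℕ} {X : Type} :
    Function.Injective (compositions : (Fin d → Equiv.Perm X) → Fin d → Equiv.Perm X) := by
  intro π π' h
  have hp : ∀ i ≤ d, partialChain π i = partialChain π' i := by
    intro i hi
    rw [← level_compositions π i hi, ← level_compositions π' i hi, h]
  funext i
  have h1 := hp (i.val + 1) i.2
  simp only [partialChain, i.2, dif_pos, hp i.val i.2.le] at h1
  exact mul_right_cancel h1

/-- Uniform independent permutations have uniform independent compositions. -/
theorem sum_compositions {d : ℕ} {X : Type} [Fintype X] [DecidableEq X]
    (F : (Fin d → Equiv.Perm X) → ℝ) :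
    ∑ π : Fin d → Equiv.Perm X, F (compositions π) = ∑ c : Fin d → Equiv.Perm X, F c :=
  Fintype.sum_bijective _ (Finite.injective_iff_bijective.1 compositions_injective) _ _
    (fun _ => rfl)

section Oracle

variable {d n : ℕ}

/-- The index of a query. -/
def idxOf (z : Bits (inLen d n)) : ℕ :=
  Nat.ofBits (fun j : Fin (d + 1) => z (Fin.castAdd (bigLen d n) j))

/-- The argument of a query. -/
def argOf (z : Bits (inLen d n)) : Bits (bigLen d n) := fun j => z (Fin.natAdd (d + 1) j)

open Classical in
/-- `f` on the first `2^n` strings, `⊥` elsewhere. -/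
def extend (f : Bits n → Bits n) (x : Bits (bigLen d n)) : Option (Bits n) :=
  if h : ∃ u : Bits n, embed (bigLen d n) u = x then some (f h.choose) else none

theorem extend_embed (f : Bits n → Bits n) (u : Bits n) :
    extend (d := d) f (embed (bigLen d n) u) = some (f u) := by
  have h : ∃ u' : Bits n, embed (bigLen d n) u' = embed (bigLen d n) u := ⟨u, rfl⟩
  rw [extend, dif_pos h, embed_injective (le_bigLen d n) h.choose_spec]

theorem extend_of_not (f : Bits n → Bits n) (x : Bits (bigLen d n))
    (h : ¬ ∃ u : Bits n, embed (bigLen d n) u = x) : extend (d := d) f x = none := by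
  rw [extend, dif_neg h]

/-- The answer to the query of `f_i` at the image of `x` under the first `i` permutations. -/
def answerAt (f : Bits n → Bits n) (c : Fin d → Equiv.Perm (Bits (bigLen d n))) (i : ℕ)
    (x : Bits (bigLen d n)) : Bits (outLen d n) :=
  if i < d then encodeAnswer (some (level c (i + 1) x))
  else if i = d then encodeAnswer ((extend f x).map (embed (bigLen d n)))
  else fun _ => false

/-- The point whose image under the first permutations is the argument of the query `z`. -/
def basePoint (c : Fin d → Equiv.Perm (Bits (bigLen d n))) (z : Bits (inLen d n)) :
    Bits (bigLen d n) := (level c (idxOf z)).symm (argOf z)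

/-- The shuffling oracle as a function of the compositions of the permutations. -/
def compOracle (f : Bits n → Bits n) (c : Fin d → Equiv.Perm (Bits (bigLen d n)))
    (z : Bits (inLen d n)) : Bits (outLen d n) := answerAt f c (idxOf z) (basePoint c z)

theorem shuffleOracle_eq (f : Bits n → Bits n) (π : Fin d → Equiv.Perm (Bits (bigLen d n))) :
    shuffleOracle f π = compOracle f (compositions π) := by
  funext z
  have hlast : ∀ y, lastFn f π y = extend f ((partialChain π d).symm y) := by
    intro y
    simp only [lastFn, extend, Equiv.eq_symm_apply, chain_eq]
  have hz : Nat.ofBits (fun j : Fin (d + 1) => z (Fin.castAdd (bigLen d n) j)) = idxOf z := rfl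
  have hy : (fun j => z (Fin.natAdd (d + 1) j)) = argOf z := rfl
  simp only [shuffleOracle, compOracle, hz]
  by_cases h : idxOf z < d + 1
  · rw [dif_pos h]
    simp only [shuffleVal, answerAt, basePoint]
    rw [level_compositions π (idxOf z) (Nat.lt_succ_iff.1 h), hy]
    by_cases h' : idxOf z < d
    · rw [dif_pos h', if_pos h', level_compositions π (idxOf z + 1) h']
      simp only [partialChain, h', dif_pos]
      simp
    · have he : idxOf z = d := by omega
      rw [dif_neg h', if_neg h', if_pos he, hlast, he]
  · rw [dif_neg h, answerAt, if_neg (by omega), if_neg (by omega)]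

/-! ### Hidden points -/

/-- The points `0, …, 2^((d+1-l)n) - 1`, over which the oracle of the `l`-th layer may be
changed. -/
def hiddenSet (d n l : ℕ) : Finset (Bits (bigLen d n)) :=
  Finset.univ.filter fun x => ∀ i, (d + 1 - l) * n ≤ i.val → x i = false

open Classical in
/-- The oracle that answers `0` to the queries of `f_i`, `i ≥ l`, that lie over a point of
`hiddenSet d n l` outside of the set `A` of known points. -/
def hidingOracle (f : Bits n → Bits n) (l : ℕ) (A : Finset (Bits (bigLen d n)))
    (c : Fin d → Equiv.Perm (Bits (bigLen d n))) (z : Bits (inLen d n)) : Bits (outLen d n) :=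
  if l ≤ idxOf z ∧ basePoint c z ∈ hiddenSet d n l \ A then fun _ => false else compOracle f c z

theorem hiddenSet_succ_subset (d n l : ℕ) : hiddenSet d n (l + 1) ⊆ hiddenSet d n l := by
  intro x hx
  simp only [hiddenSet, Finset.mem_filter, Finset.mem_univ, true_and] at hx ⊢
  intro i hi
  exact hx i (le_trans (Nat.mul_le_mul_right n (by omega)) hi)

theorem hiddenSet_eq_image (d n l : ℕ) :
    hiddenSet d n l = Finset.univ.image (embed (n := (d + 1 - l) * n) (bigLen d n)) := by
  ext x
  simp only [hiddenSet, Finset.mem_filter, Finset.mem_univ, true_and, Finset.mem_image]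
  have hle : (d + 1 - l) * n ≤ bigLen d n := Nat.mul_le_mul_right n (by omega)
  constructor
  · intro hx
    refine ⟨fun i => x ⟨i.val, i.2.trans_le hle⟩, ?_⟩
    funext i
    simp only [embed]
    split_ifs with h
    · rfl
    · exact (hx i (by omega)).symm
  · rintro ⟨u, rfl⟩ i hi
    simp [embed, Nat.not_lt.2 hi]

theorem card_hiddenSet (d n l : ℕ) : (hiddenSet d n l).card = 2 ^ ((d + 1 - l) * n) := by
  rw [hiddenSet_eq_image, Finset.card_image_of_injective]
  · simp
  · exact embed_injective (Nat.mul_le_mul_right n (by omega))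

theorem embed_mem_hiddenSet {l : ℕ} (hl : l ≤ d) (u : Bits n) :
    embed (bigLen d n) u ∈ hiddenSet d n l := by
  simp only [hiddenSet, Finset.mem_filter, Finset.mem_univ, true_and]
  intro i hi
  have : n ≤ (d + 1 - l) * n := Nat.le_mul_of_pos_left n (by omega)
  simp [embed, Nat.not_lt.2 (this.trans hi)]

/-! ### Interchanging hidden points -/

/-- The family in which the images of `x` and `x'` at level `j + 1` are interchanged. -/
def swapAt (c : Fin d → Equiv.Perm (Bits (bigLen d n))) (j : Fin d) (x x' : Bits (bigLen d n)) :
    Fin d → Equiv.Perm (Bits (bigLen d n)) :=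
  Function.update c j (c j * Equiv.swap x x')

theorem swapAt_swapAt (c : Fin d → Equiv.Perm (Bits (bigLen d n))) (j : Fin d)
    (x x' : Bits (bigLen d n)) : swapAt (swapAt c j x x') j x x' = c := by
  funext i
  by_cases h : i = j
  · subst h; simp [swapAt, mul_assoc]
  · simp [swapAt, Function.update_of_ne h]

theorem level_swapAt_self (c : Fin d → Equiv.Perm (Bits (bigLen d n))) (j : Fin d)
    (x x' : Bits (bigLen d n)) :
    level (swapAt c j x x') (j.val + 1) = level c (j.val + 1) * Equiv.swap x x' := by
  simp [level, swapAt]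

theorem level_swapAt_of_ne (c : Fin d → Equiv.Perm (Bits (bigLen d n))) (j : Fin d)
    (x x' : Bits (bigLen d n)) (i : ℕ) (h : i ≠ j.val + 1) :
    level (swapAt c j x x') i = level c i := by
  cases i with
  | zero => rfl
  | succ i =>
    simp only [level]
    split_ifs with hi
    · rw [swapAt, Function.update_of_ne]
      intro e
      apply h
      rw [← e]
    · rfl

theorem basePoint_swapAt_self (c : Fin d → Equiv.Perm (Bits (bigLen d n))) (j : Fin d)
    (x x' : Bits (bigLen d n)) (z : Bits (inLen d n)) (h : idxOf z = j.val + 1) :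
    basePoint (swapAt c j x x') z = Equiv.swap x x' (basePoint c z) := by
  simp only [basePoint, h, level_swapAt_self]
  rw [Equiv.symm_apply_eq]
  simp

theorem basePoint_swapAt_of_ne (c : Fin d → Equiv.Perm (Bits (bigLen d n))) (j : Fin d)
    (x x' : Bits (bigLen d n)) (z : Bits (inLen d n)) (h : idxOf z ≠ j.val + 1) :
    basePoint (swapAt c j x x') z = basePoint c z := by
  simp only [basePoint, level_swapAt_of_ne c j x x' _ h]

theorem answerAt_swapAt (f : Bits n → Bits n) (c : Fin d → Equiv.Perm (Bits (bigLen d n)))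
    (j : Fin d) (x x' : Bits (bigLen d n)) (i : ℕ) (y : Bits (bigLen d n))
    (h : i = j.val → y ≠ x ∧ y ≠ x') :
    answerAt f (swapAt c j x x') i y = answerAt f c i y := by
  simp only [answerAt]
  by_cases hij : i = j.val
  · subst hij
    rw [level_swapAt_self, Equiv.Perm.mul_apply, Equiv.swap_apply_of_ne_of_ne (h rfl).1 (h rfl).2]
  · rw [level_swapAt_of_ne c j x x' _ (by omega)]

theorem basePoint_swapAt (c : Fin d → Equiv.Perm (Bits (bigLen d n))) (j : Fin d)
    (x x' : Bits (bigLen d n)) (z : Bits (inLen d n)) (h : basePoint c z ≠ x)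
    (h' : basePoint c z ≠ x') : basePoint (swapAt c j x x') z = basePoint c z := by
  by_cases hj : idxOf z = j.val + 1
  · rw [basePoint_swapAt_self c j x x' z hj, Equiv.swap_apply_of_ne_of_ne h h']
  · exact basePoint_swapAt_of_ne c j x x' z hj

theorem compOracle_swapAt (f : Bits n → Bits n) (c : Fin d → Equiv.Perm (Bits (bigLen d n)))
    (j : Fin d) (x x' : Bits (bigLen d n)) (z : Bits (inLen d n)) (h : basePoint c z ≠ x)
    (h' : basePoint c z ≠ x') : compOracle f (swapAt c j x x') z = compOracle f c z := by
  simp only [compOracle, basePoint_swapAt c j x x' z h h']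
  exact answerAt_swapAt f c j x x' _ _ fun _ => ⟨h, h'⟩

/-- Two hidden points can be interchanged at a level beyond `l` without changing the oracle of
the `l`-th layer: this oracle reveals neither where they are mapped to, nor where their images
are mapped to. -/
theorem hidingOracle_swapAt (f : Bits n → Bits n) (l : ℕ) (A : Finset (Bits (bigLen d n)))
    (c : Fin d → Equiv.Perm (Bits (bigLen d n))) (j : Fin d) (hj : l ≤ j.val)
    (x x' : Bits (bigLen d n)) (hx : x ∈ hiddenSet d n l \ A) (hx' : x' ∈ hiddenSet d n l \ A) :
    hidingOracle f l A (swapAt c j x x') = hidingOracle f l A c := by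
  funext z
  simp only [hidingOracle]
  by_cases hz : idxOf z = j.val + 1
  · have hiff : basePoint (swapAt c j x x') z ∈ hiddenSet d n l \ A ↔
        basePoint c z ∈ hiddenSet d n l \ A := by
      rw [basePoint_swapAt_self c j x x' z hz]
      by_cases h1 : basePoint c z = x
      · rw [h1, Equiv.swap_apply_left]; exact iff_of_true hx' hx
      by_cases h2 : basePoint c z = x'
      · rw [h2, Equiv.swap_apply_right]; exact iff_of_true hx hx'
      rw [Equiv.swap_apply_of_ne_of_ne h1 h2]
    simp only [hiff]
    split_ifs with h
    · rfl
    · have hn : basePoint c z ∉ hiddenSet d n l \ A := fun hm => h ⟨by omega, hm⟩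
      exact compOracle_swapAt f c j x x' z (fun e => hn (e ▸ hx)) (fun e => hn (e ▸ hx'))
  · rw [basePoint_swapAt_of_ne c j x x' z hz]
    split_ifs with h
    · rfl
    · simp only [compOracle, basePoint_swapAt_of_ne c j x x' z hz]
      refine answerAt_swapAt f c j x x' _ _ fun hi => ?_
      have hn : basePoint c z ∉ hiddenSet d n l \ A := fun hm => h ⟨by omega, hm⟩
      exact ⟨fun e => hn (e ▸ hx), fun e => hn (e ▸ hx')⟩

/-- A function of the compositions that does not change when two points of `hiddenSet d n l`
outside of `A` are interchanged at a level beyond `l`. -/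
def SwapInvariant {α : Type} (l : ℕ) (A : Finset (Bits (bigLen d n)))
    (C : Finset (Fin d → Equiv.Perm (Bits (bigLen d n))))
    (F : (Fin d → Equiv.Perm (Bits (bigLen d n))) → α) : Prop :=
  ∀ j : Fin d, l ≤ j.val → ∀ x ∈ hiddenSet d n l \ A, ∀ x' ∈ hiddenSet d n l \ A, ∀ c ∈ C,
    swapAt c j x x' ∈ C ∧ F (swapAt c j x x') = F c

theorem SwapInvariant.sum_eq {l : ℕ} {A : Finset (Bits (bigLen d n))}
    {C : Finset (Fin d → Equiv.Perm (Bits (bigLen d n)))}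
    {F : (Fin d → Equiv.Perm (Bits (bigLen d n))) → ℝ} (h : SwapInvariant l A C F)
    (z : Bits (inLen d n)) (j : Fin d) (hj : l ≤ j.val) (hz : idxOf z = j.val + 1)
    (x x' : Bits (bigLen d n)) (hx : x ∈ hiddenSet d n l \ A) (hx' : x' ∈ hiddenSet d n l \ A) :
    ∑ c ∈ C with basePoint c z = x, F c = ∑ c ∈ C with basePoint c z = x', F c := by
  refine Finset.sum_bij' (fun c _ => swapAt c j x x') (fun c _ => swapAt c j x x') ?_ ?_ ?_ ?_ ?_
  · intro c hc
    rw [Finset.mem_filter] at hc ⊢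
    refine ⟨(h j hj x hx x' hx' c hc.1).1, ?_⟩
    rw [basePoint_swapAt_self c j x x' z hz, hc.2, Equiv.swap_apply_left]
  · intro c hc
    rw [Finset.mem_filter] at hc ⊢
    refine ⟨(h j hj x hx x' hx' c hc.1).1, ?_⟩
    rw [basePoint_swapAt_self c j x x' z hz, hc.2, Equiv.swap_apply_right]
  · intro c _; exact swapAt_swapAt c j x x'
  · intro c _; exact swapAt_swapAt c j x x'
  · intro c hc
    rw [Finset.mem_filter] at hc
    exact (h j hj x hx x' hx' c hc.1).2.symm

/-- By symmetry, a fixed query hits the smaller hidden set of the next layer with probability at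
most the ratio of the sizes of the hidden sets. -/
theorem SwapInvariant.sum_hit_le {l : ℕ} {A : Finset (Bits (bigLen d n))}
    {C : Finset (Fin d → Equiv.Perm (Bits (bigLen d n)))}
    {F : (Fin d → Equiv.Perm (Bits (bigLen d n))) → ℝ} (h : SwapInvariant l A C F)
    (hF : ∀ c, 0 ≤ F c) (hA : 2 * A.card ≤ 2 ^ n)
    (z : Bits (inLen d n)) (j : Fin d) (hj : l ≤ j.val) (hz : idxOf z = j.val + 1) :
    ∑ c ∈ C with basePoint c z ∈ hiddenSet d n (l + 1) \ A, F c ≤ 2 / 2 ^ n * ∑ c ∈ C, F c := by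
  classical
  set U := hiddenSet d n l \ A
  set V := hiddenSet d n (l + 1) \ A
  have hVU : V ⊆ U := Finset.sdiff_subset_sdiff (hiddenSet_succ_subset d n l) le_rfl
  have hsplit : ∀ W : Finset (Bits (bigLen d n)),
      ∑ c ∈ C with basePoint c z ∈ W, F c = ∑ x ∈ W, ∑ c ∈ C with basePoint c z = x, F c := by
    intro W
    rw [← Finset.sum_fiberwise_of_maps_to (s := C.filter fun c => basePoint c z ∈ W) (t := W)
      (g := fun c => basePoint c z) (fun c hc => (Finset.mem_filter.1 hc).2)]
    refine Finset.sum_congr rfl fun x hx => ?_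
    rw [Finset.filter_filter]
    refine Finset.sum_congr (Finset.filter_congr fun c _ => ?_) fun _ _ => rfl
    constructor
    · exact And.right
    · rintro rfl; exact ⟨hx, rfl⟩
  have hsum : 0 ≤ ∑ c ∈ C, F c := Finset.sum_nonneg fun c _ => hF c
  rcases V.eq_empty_or_nonempty with hV | ⟨x₀, hx₀⟩
  · rw [hV]; simp only [Finset.notMem_empty, Finset.filter_false, Finset.sum_empty]; positivity
  set N := ∑ c ∈ C with basePoint c z = x₀, F c
  have hN : ∀ x ∈ U, ∑ c ∈ C with basePoint c z = x, F c = N := fun x hx =>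
    h.sum_eq z j hj hz x x₀ hx (hVU hx₀)
  have hVs : ∑ c ∈ C with basePoint c z ∈ V, F c = V.card * N := by
    rw [hsplit, Finset.sum_congr rfl fun x hx => hN x (hVU hx)]
    simp
  have hUs : U.card * N ≤ ∑ c ∈ C, F c := by
    have : ∑ c ∈ C with basePoint c z ∈ U, F c = U.card * N := by
      rw [hsplit, Finset.sum_congr rfl hN]
      simp
    rw [← this]
    exact Finset.sum_le_sum_of_subset_of_nonneg (Finset.filter_subset _ _) fun c _ _ => hF c
  have hN0 : 0 ≤ N := Finset.sum_nonneg fun c _ => hF c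
  have hcard : 2 ^ n * V.card ≤ 2 * U.card := by
    have h1 : V.card ≤ 2 ^ ((d + 1 - (l + 1)) * n) := by
      rw [← card_hiddenSet]
      exact Finset.card_le_card Finset.sdiff_subset
    have h2 : 2 ^ ((d + 1 - l) * n) ≤ U.card + A.card := by
      rw [← card_hiddenSet]
      have : (hiddenSet d n l).card - A.card ≤ U.card := Finset.le_card_sdiff A (hiddenSet d n l)
      omega
    have h3 : (d + 1 - l) * n = n + (d + 1 - (l + 1)) * n := by
      have : d + 1 - l = 1 + (d + 1 - (l + 1)) := by have := j.2; omega
      rw [this, add_mul, one_mul]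
    rw [h3, pow_add] at h2
    have h4 : 1 ≤ 2 ^ ((d + 1 - (l + 1)) * n) := Nat.one_le_two_pow
    nlinarith [Nat.one_le_two_pow (n := n)]
  have hcard' : (2 : ℝ) ^ n * V.card ≤ 2 * U.card := by exact_mod_cast hcard
  rw [hVs, div_mul_eq_mul_div, le_div_iff₀ (by positivity)]
  nlinarith

end Oracle

/-! ### Comparison of the shuffling oracle with the hiding oracles -/

section Hybrid

variable {d n w : ℕ}

open Classical in
/-- The probability of the output `v` if the layers use the hiding oracles instead of the
shuffling oracle. The set `A` collects the base points of the classical queries, which are still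
answered honestly; an output is weighted by the value of `g` at the final set `A`. -/
def Tree.hyb (f : Bits n → Bits n) (c : Fin d → Equiv.Perm (Bits (bigLen d n))) (v : Bool)
    (g : Finset (Bits (bigLen d n)) → ℝ) : Tree (inLen d n) (outLen d n) w → ℕ →
      Finset (Bits (bigLen d n)) → State w → ℝ
  | .abort, _, _, _ => 0
  | .leaf u, _, A, ψ => if u = v then g A * normSqr ψ else 0
  | .coin T₁ T₂, l, A, ψ => (T₁.hyb f c v g l A ψ + T₂.hyb f c v g l A ψ) / 2
  | .ask z k, l, A, ψ => (k (compOracle f c z)).hyb f c v g l (insert (basePoint c z) A) ψ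
  | .layer L k, l, A, ψ => ∑ z : Bits w, if ∀ i : Fin w, i.val ∉ L.measured → z i = false then
      (k z).hyb f c v g (l + 1) A
        (project L.measured z (L.apply (hidingOracle f (l + 1) A c) ψ)) else 0

open Classical in
theorem sum_exists_le {ι κ : Type} (C : Finset ι) (Q : List κ) (P : κ → ι → Prop)
    (F : ι → ℝ) (hF : ∀ i, 0 ≤ F i)
    (e : ℝ) (h : ∀ q ∈ Q, ∑ i ∈ C, (if P q i then F i else 0) ≤ e) :
    ∑ i ∈ C, (if ∃ q ∈ Q, P q i then F i else 0) ≤ Q.length * e := by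
  induction Q with
  | nil => simp
  | cons q Q ih =>
    have h1 := h q (by simp)
    have h2 := ih fun q' hq' => h q' (by simp [hq'])
    calc _ ≤ ∑ i ∈ C, ((if P q i then F i else 0) + if ∃ q ∈ Q, P q i then F i else 0) := by
          refine Finset.sum_le_sum fun i _ => ?_
          have := hF i
          by_cases a : P q i <;> by_cases b : ∃ q ∈ Q, P q i
          all_goals simp only [List.mem_cons, exists_eq_or_imp, a, b, if_true, if_false, or_true,
            or_false]
          all_goals linarith
      _ ≤ _ := by
          rw [Finset.sum_add_distrib, List.length_cons]
          push_cast
          linarith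

theorem compOracle_ne {f : Bits n → Bits n} {l : ℕ} {A : Finset (Bits (bigLen d n))}
    {c : Fin d → Equiv.Perm (Bits (bigLen d n))} {z : Bits (inLen d n)}
    (h : compOracle f c z ≠ hidingOracle f l A c z) :
    l ≤ idxOf z ∧ idxOf z ≤ d ∧ basePoint c z ∈ hiddenSet d n l \ A := by
  simp only [hidingOracle] at h
  split_ifs at h with h1
  · refine ⟨h1.1, ?_, h1.2⟩
    by_contra hd
    apply h
    rw [compOracle, answerAt, if_neg (by omega), if_neg (by omega)]
  · exact absurd rfl h

theorem sum_differ_le (f : Bits n → Bits n) {l : ℕ} {A : Finset (Bits (bigLen d n))}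
    {C : Finset (Fin d → Equiv.Perm (Bits (bigLen d n)))}
    {F : (Fin d → Equiv.Perm (Bits (bigLen d n))) → ℝ} (h : SwapInvariant l A C F)
    (hF : ∀ c, 0 ≤ F c) (hA : 2 * A.card ≤ 2 ^ n) (z : Bits (inLen d n)) :
    ∑ c ∈ C, (if compOracle f c z ≠ hidingOracle f (l + 1) A c z then F c else 0)
      ≤ 2 / 2 ^ n * ∑ c ∈ C, F c := by
  by_cases hz : l + 1 ≤ idxOf z ∧ idxOf z ≤ d
  · refine le_trans ?_ (h.sum_hit_le hF hA z ⟨idxOf z - 1, by omega⟩ (by simp only; omega)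
      (by simp only; omega))
    rw [Finset.sum_filter]
    refine Finset.sum_le_sum fun c _ => ?_
    have := hF c
    split_ifs with h1 h2 h2
    · exact le_rfl
    · exact absurd (compOracle_ne h1).2.2 h2
    · exact this
    · exact le_rfl
  · rw [Finset.sum_eq_zero]
    · have : 0 ≤ ∑ c ∈ C, F c := Finset.sum_nonneg fun c _ => hF c
      positivity
    · intro c _
      rw [if_neg]
      intro hne
      have := compOracle_ne hne
      exact hz ⟨this.1, this.2.1⟩

/-- On average over the compositions, hiding changes the state after a layer by little. -/
theorem sum_normSqr_sub_le (f : Bits n → Bits n) {l : ℕ} {A : Finset (Bits (bigLen d n))}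
    {C : Finset (Fin d → Equiv.Perm (Bits (bigLen d n)))}
    {ψ : (Fin d → Equiv.Perm (Bits (bigLen d n))) → State w} (h : SwapInvariant l A C ψ)
    {B : ℕ} (hA : 2 * A.card ≤ 2 ^ n) (L : Layer (inLen d n) (outLen d n)) (hL : L.Valid w)
    (hB : L.queries.length ≤ B) :
    ∑ c ∈ C, normSqr (L.apply (compOracle f c) (ψ c) - L.apply (hidingOracle f (l + 1) A c) (ψ c))
      ≤ 8 * B / 2 ^ n * ∑ c ∈ C, normSqr (ψ c) := by
  classical
  set F : Bits w → (Fin d → Equiv.Perm (Bits (bigLen d n))) → ℝ :=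
    fun b c => ‖applyGates L.gates (ψ c) b‖ ^ 2
  have hF : ∀ b, SwapInvariant l A C (F b) := fun b j hj x hx x' hx' c hc =>
    ⟨(h j hj x hx x' hx' c hc).1, by simp only [F, (h j hj x hx x' hx' c hc).2]⟩
  have hF0 : ∀ b c, 0 ≤ F b c := fun b c => by positivity
  calc _ ≤ ∑ c ∈ C, 4 * ∑ b : Bits w, (if ∃ g ∈ L.queries,
          compOracle f c (fun k => getBit b (g.qin k)) ≠
            hidingOracle f (l + 1) A c (fun k => getBit b (g.qin k)) then F b c else 0) :=
        Finset.sum_le_sum fun c _ => Layer.normSqr_apply_sub_le _ _ L hL (ψ c)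
    _ = 4 * ∑ b : Bits w, ∑ c ∈ C, (if ∃ g ∈ L.queries,
          compOracle f c (fun k => getBit b (g.qin k)) ≠
            hidingOracle f (l + 1) A c (fun k => getBit b (g.qin k)) then F b c else 0) := by
        rw [← Finset.mul_sum, Finset.sum_comm]
    _ ≤ 4 * ∑ b : Bits w, (L.queries.length * (2 / 2 ^ n * ∑ c ∈ C, F b c)) := by
        gcongr with b
        refine (le_of_eq (Finset.sum_congr rfl fun c _ => ?_)).trans
          (sum_exists_le C L.queries (fun g c => compOracle f c (fun k => getBit b (g.qin k)) ≠
            hidingOracle f (l + 1) A c (fun k => getBit b (g.qin k))) (F b) (hF0 b)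
          (2 / 2 ^ n * ∑ c ∈ C, F b c) fun g _ => ?_)
        · congr
        · refine (le_of_eq (Finset.sum_congr rfl fun c _ => ?_)).trans
            (sum_differ_le f (hF b) (hF0 b) hA (fun k => getBit b (g.qin k)))
          congr
    _ = 8 * L.queries.length / 2 ^ n * ∑ c ∈ C, normSqr (ψ c) := by
        rw [← Finset.mul_sum, ← Finset.mul_sum, Finset.sum_comm]
        have : ∀ c, ∑ b, F b c = normSqr (ψ c) := fun c =>
          normSqr_applyGates L.gates hL.1 hL.2.1 (ψ c)
        simp only [this]
        ring
    _ ≤ _ := by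
        have : 0 ≤ ∑ c ∈ C, normSqr (ψ c) := Finset.sum_nonneg fun c _ => normSqr_nonneg _
        gcongr

open Classical in
theorem Tree.layer_eval_le {a b D B : ℕ} (O G : Bits a → Bits b) (v : Bool) (L : Layer a b)
    (k : Bits w → Tree a b w) (l t : ℕ) (hT : (Tree.layer L k).Ok D B l t) (lam : ℝ)
    (hl : 0 < lam) (ψ : State w) :
    (Tree.layer L k).eval O v ψ ≤
      (∑ z : Bits w, if ∀ i : Fin w, i.val ∉ L.measured → z i = false then
        (k z).eval O v (project L.measured z (L.apply G ψ)) else 0)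
      + (lam * normSqr ψ + (1 + 1 / lam) * normSqr (L.apply O ψ - L.apply G ψ)) := by
  set q : State w → ℝ := fun φ => ∑ z : Bits w,
    if ∀ i : Fin w, i.val ∉ L.measured → z i = false then
      (k z).eval O v (project L.measured z φ) else 0
  have hq : ∀ φ, q φ ≤ normSqr φ := by
    intro φ
    rw [← sum_normSqr_project L.measured]
    refine Finset.sum_le_sum fun z _ => ?_
    split_ifs
    exacts [(k z).eval_le O v _ _ (hT.2.2.2 z) _, le_rfl]
  have hadd : ∀ φ χ, q (φ + χ) ≤ (1 + lam) * q φ + (1 + 1 / lam) * q χ := by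
    intro φ χ
    simp only [q]
    rw [Finset.mul_sum, Finset.mul_sum, ← Finset.sum_add_distrib]
    refine Finset.sum_le_sum fun z _ => ?_
    split_ifs
    · rw [project_add]
      exact (k z).eval_add_le O v _ _ (hT.2.2.2 z) lam hl _ _
    · simp
  have h1 := hadd (L.apply G ψ) (L.apply O ψ - L.apply G ψ)
  rw [add_sub_cancel] at h1
  have h2 := hq (L.apply G ψ)
  rw [Layer.normSqr_apply G L hT.1] at h2
  have h3 := hq (L.apply O ψ - L.apply G ψ)
  have h4 : 0 < 1 + 1 / lam := by positivity
  change q (L.apply O ψ) ≤ q (L.apply G ψ) + _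
  nlinarith

/-- The hybrid argument: on average over the compositions, a scheme cannot tell the shuffling
oracle from the hiding oracles. The average is over a set `C` of compositions that is compatible
with what the scheme has learned from the layers above and from the classical queries; the
invariance under interchanges of hidden points expresses that it has learned nothing about
them. -/
theorem Tree.sum_eval_le (f : Bits n → Bits n) (v : Bool) {B : ℕ} (hB : 2 * B ≤ 2 ^ n)
    (lam : ℝ) (hl : 0 < lam) (T : Tree (inLen d n) (outLen d n) w) (l t : ℕ)
    (A : Finset (Bits (bigLen d n))) (C : Finset (Fin d → Equiv.Perm (Bits (bigLen d n))))
    (ψ : (Fin d → Equiv.Perm (Bits (bigLen d n))) → State w) (hT : T.Ok d B l t)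
    (hA : A.card + t ≤ B) (h : SwapInvariant l A C ψ) :
    ∑ c ∈ C, T.eval (compOracle f c) v (ψ c) ≤
      ∑ c ∈ C, T.hyb f c v (fun _ => 1) l A (ψ c)
      + ((d - l : ℕ) : ℝ) * (lam + (1 + 1 / lam) * (8 * B / 2 ^ n)) * ∑ c ∈ C, normSqr (ψ c) := by
  classical
  have hκ : 0 ≤ lam + (1 + 1 / lam) * (8 * B / 2 ^ n) := by positivity
  set κ := lam + (1 + 1 / lam) * (8 * B / 2 ^ n)
  have herr : ∀ (l : ℕ) (C : Finset (Fin d → Equiv.Perm (Bits (bigLen d n))))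
      (ψ : (Fin d → Equiv.Perm (Bits (bigLen d n))) → State w),
      0 ≤ ((d - l : ℕ) : ℝ) * κ * ∑ c ∈ C, normSqr (ψ c) := fun l C ψ =>
    mul_nonneg (by positivity) (Finset.sum_nonneg fun c _ => normSqr_nonneg _)
  induction T generalizing l t A C ψ with
  | abort => simpa [eval, hyb] using herr l C ψ
  | leaf u =>
    have := herr l C ψ
    simp only [eval, hyb, one_mul]
    linarith
  | coin T₁ T₂ ih₁ ih₂ =>
    have h1 := ih₁ l t A C ψ hT.1 hA h
    have h2 := ih₂ l t A C ψ hT.2 hA h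
    simp only [eval, hyb]
    rw [← Finset.sum_div, ← Finset.sum_div, Finset.sum_add_distrib, Finset.sum_add_distrib]
    linarith
  | ask z k ih =>
    obtain ⟨t', ht', hk⟩ := hT
    -- the known part of the compositions is the base point of the query and its answer
    set key : (Fin d → Equiv.Perm (Bits (bigLen d n))) →
      Bits (bigLen d n) × Bits (outLen d n) := fun c => (basePoint c z, compOracle f c z)
    rw [← Finset.sum_fiberwise C key, ← Finset.sum_fiberwise C key fun c =>
      (Tree.ask z k).hyb f c v (fun _ => 1) l A (ψ c),
      ← Finset.sum_fiberwise C key fun c => normSqr (ψ c), Finset.mul_sum,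
      ← Finset.sum_add_distrib]
    refine Finset.sum_le_sum fun ⟨x, o⟩ _ => ?_
    have hmem : ∀ c ∈ C.filter (fun c => key c = (x, o)),
        c ∈ C ∧ basePoint c z = x ∧ compOracle f c z = o := by
      intro c hc
      rw [Finset.mem_filter] at hc
      exact ⟨hc.1, congrArg Prod.fst hc.2, congrArg Prod.snd hc.2⟩
    have hinv : SwapInvariant l (insert x A) (C.filter fun c => key c = (x, o)) ψ := by
      intro j hj y hy y' hy' c hc
      obtain ⟨hcC, hx, ho⟩ := hmem c hc
      rw [Finset.mem_sdiff, Finset.mem_insert, not_or] at hy hy'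
      have hs := h j hj y (Finset.mem_sdiff.2 ⟨hy.1, hy.2.2⟩) y'
        (Finset.mem_sdiff.2 ⟨hy'.1, hy'.2.2⟩) c hcC
      have e1 : basePoint c z ≠ y := fun e => hy.2.1 (e ▸ hx)
      have e2 : basePoint c z ≠ y' := fun e => hy'.2.1 (e ▸ hx)
      refine ⟨Finset.mem_filter.2 ⟨hs.1, ?_⟩, hs.2⟩
      simp only [key, basePoint_swapAt c j y y' z e1 e2, compOracle_swapAt f c j y y' z e1 e2,
        hx, ho]
    have hcard : (insert x A).card + t' ≤ B := by
      have := Finset.card_insert_le x A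
      omega
    refine le_trans (le_of_eq ?_) ((ih o l t' (insert x A) _ ψ (hk o) hcard hinv).trans
      (le_of_eq ?_))
    · refine Finset.sum_congr rfl fun c hc => ?_
      simp only [eval, (hmem c hc).2.2]
    · congr 1
      refine Finset.sum_congr rfl fun c hc => ?_
      simp only [hyb, (hmem c hc).2.2, (hmem c hc).2.1]
  | layer L k ih =>
    have hS : ∑ c ∈ C, (∑ z : Bits w, if ∀ i : Fin w, i.val ∉ L.measured → z i = false then
        (k z).eval (compOracle f c) v
          (project L.measured z (L.apply (hidingOracle f (l + 1) A c) (ψ c))) else 0) ≤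
        ∑ c ∈ C, (Tree.layer L k).hyb f c v (fun _ => 1) l A (ψ c)
        + ((d - (l + 1) : ℕ) : ℝ) * κ * ∑ c ∈ C, normSqr (ψ c) := by
      have hn : ∑ c ∈ C, normSqr (ψ c) = ∑ c ∈ C, ∑ z : Bits w,
          if ∀ i : Fin w, i.val ∉ L.measured → z i = false then
          normSqr (project L.measured z (L.apply (hidingOracle f (l + 1) A c) (ψ c))) else 0 := by
        refine Finset.sum_congr rfl fun c _ => ?_
        rw [sum_normSqr_project, Layer.normSqr_apply _ L hT.1]
      rw [hn, Finset.sum_comm, Finset.sum_comm (s := C) (t := Finset.univ), Finset.mul_sum]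
      simp only [hyb]
      rw [Finset.sum_comm (s := C) (t := Finset.univ), ← Finset.sum_add_distrib]
      refine Finset.sum_le_sum fun z _ => ?_
      split_ifs
      · refine ih z (l + 1) t A C _ (hT.2.2.2 z) hA ?_
        intro j hj x hx x' hx' c hc
        have hsub : hiddenSet d n (l + 1) \ A ⊆ hiddenSet d n l \ A :=
          Finset.sdiff_subset_sdiff (hiddenSet_succ_subset d n l) le_rfl
        have hs := h j (by omega) x (hsub hx) x' (hsub hx') c hc
        exact ⟨hs.1, by
          simp only [hidingOracle_swapAt f (l + 1) A c j hj x x' hx hx', hs.2]⟩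
      · simp
    rcases hT.2.2.1 with hld | hQ
    · have h1 : ∑ c ∈ C, (Tree.layer L k).eval (compOracle f c) v (ψ c) ≤ _ :=
        Finset.sum_le_sum fun c _ => Tree.layer_eval_le (compOracle f c)
          (hidingOracle f (l + 1) A c) v L k l t hT lam hl (ψ c)
      rw [Finset.sum_add_distrib, Finset.sum_add_distrib, ← Finset.mul_sum, ← Finset.mul_sum]
        at h1
      have h2 := sum_normSqr_sub_le f h (B := B) (by omega) L hT.1 hT.2.1
      have h3 : ((d - l : ℕ) : ℝ) = ((d - (l + 1) : ℕ) : ℝ) + 1 := by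
        have : d - l = d - (l + 1) + 1 := by omega
        rw [this]; push_cast; ring
      have h4 := mul_le_mul_of_nonneg_left h2 (show 0 ≤ 1 + 1 / lam by positivity)
      have h5 : ((d - l : ℕ) : ℝ) * κ * ∑ c ∈ C, normSqr (ψ c) =
          ((d - (l + 1) : ℕ) : ℝ) * κ * ∑ c ∈ C, normSqr (ψ c) + (lam * ∑ c ∈ C, normSqr (ψ c)
            + (1 + 1 / lam) * (8 * B / 2 ^ n * ∑ c ∈ C, normSqr (ψ c))) := by
        rw [h3]; simp only [κ]; ring
      linarith
    · have h6 : ∀ c, L.apply (compOracle f c) (ψ c) =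
          L.apply (hidingOracle f (l + 1) A c) (ψ c) := by
        intro c; simp [Layer.apply, hQ]
      have h7 : ((d - (l + 1) : ℕ) : ℝ) ≤ ((d - l : ℕ) : ℝ) := by
        exact_mod_cast (by omega : d - (l + 1) ≤ d - l)
      have h8 := mul_le_mul_of_nonneg_right (mul_le_mul_of_nonneg_right h7 hκ)
        (Finset.sum_nonneg fun c (_ : c ∈ C) => normSqr_nonneg (ψ c))
      simp only [eval, h6]
      exact hS.trans (by linarith)

/-! ### The hiding oracles reveal the hidden function only through classical queries -/

theorem compOracle_congr {f f' : Bits n → Bits n} {c : Fin d → Equiv.Perm (Bits (bigLen d n))}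
    {z : Bits (inLen d n)}
    (h : idxOf z = d → ∀ u, embed (bigLen d n) u = basePoint c z → f u = f' u) :
    compOracle f c z = compOracle f' c z := by
  simp only [compOracle, answerAt]
  split_ifs with h1 h2
  · rfl
  · by_cases hu : ∃ u : Bits n, embed (bigLen d n) u = basePoint c z
    · obtain ⟨u, hu⟩ := hu
      rw [← hu, extend_embed, extend_embed, h h2 u hu]
    · rw [extend_of_not f _ hu, extend_of_not f' _ hu]
  · rfl

theorem hidingOracle_congr {f f' : Bits n → Bits n} {l : ℕ} (hl : l ≤ d)
    {A : Finset (Bits (bigLen d n))} (c : Fin d → Equiv.Perm (Bits (bigLen d n)))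
    (h : ∀ u, embed (bigLen d n) u ∈ A → f u = f' u) :
    hidingOracle f l A c = hidingOracle f' l A c := by
  funext z
  simp only [hidingOracle]
  split_ifs with h1
  · rfl
  · refine compOracle_congr fun hi u hu => h u ?_
    by_contra hn
    exact h1 ⟨by omega, Finset.mem_sdiff.2 ⟨hu ▸ embed_mem_hiddenSet hl u, hu ▸ hn⟩⟩

theorem Tree.hyb_nonneg (f : Bits n → Bits n) (c : Fin d → Equiv.Perm (Bits (bigLen d n)))
    (v : Bool) (g : Finset (Bits (bigLen d n)) → ℝ) (hg : ∀ A, 0 ≤ g A)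
    (T : Tree (inLen d n) (outLen d n) w) (l : ℕ) (A : Finset (Bits (bigLen d n)))
    (ψ : State w) : 0 ≤ T.hyb f c v g l A ψ := by
  induction T generalizing l A ψ with
  | abort => exact le_rfl
  | leaf u => simp only [hyb]; split_ifs; exacts [mul_nonneg (hg A) (normSqr_nonneg ψ), le_rfl]
  | coin T₁ T₂ ih₁ ih₂ => simp only [hyb]; linarith [ih₁ l A ψ, ih₂ l A ψ]
  | ask z k ih => exact ih _ _ _ _
  | layer L k ih =>
    refine Finset.sum_nonneg fun z _ => ?_
    split_ifs
    exacts [ih z _ _ _, le_rfl]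

theorem Tree.hyb_mono (f : Bits n → Bits n) (c : Fin d → Equiv.Perm (Bits (bigLen d n)))
    (v : Bool) {g g' : Finset (Bits (bigLen d n)) → ℝ} (hg : ∀ A, g A ≤ g' A)
    (T : Tree (inLen d n) (outLen d n) w) (l : ℕ) (A : Finset (Bits (bigLen d n)))
    (ψ : State w) : T.hyb f c v g l A ψ ≤ T.hyb f c v g' l A ψ := by
  induction T generalizing l A ψ with
  | abort => exact le_rfl
  | leaf u =>
    simp only [hyb]
    split_ifs
    exacts [mul_le_mul_of_nonneg_right (hg A) (normSqr_nonneg ψ), le_rfl]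
  | coin T₁ T₂ ih₁ ih₂ => simp only [hyb]; linarith [ih₁ l A ψ, ih₂ l A ψ]
  | ask z k ih => exact ih _ _ _ _
  | layer L k ih =>
    refine Finset.sum_le_sum fun z _ => ?_
    split_ifs
    exacts [ih z _ _ _, le_rfl]

theorem Tree.hyb_add_le {D B : ℕ} (f : Bits n → Bits n)
    (c : Fin d → Equiv.Perm (Bits (bigLen d n))) (T : Tree (inLen d n) (outLen d n) w)
    (l t : ℕ) (hT : T.Ok D B l t) (A : Finset (Bits (bigLen d n))) (ψ : State w) :
    T.hyb f c true (fun _ => 1) l A ψ + T.hyb f c false (fun _ => 1) l A ψ ≤ normSqr ψ := by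
  induction T generalizing l t A ψ with
  | abort => simpa [hyb] using normSqr_nonneg ψ
  | leaf u => cases u <;> simp [hyb]
  | coin T₁ T₂ ih₁ ih₂ =>
    simp only [hyb]; linarith [ih₁ l t hT.1 A ψ, ih₂ l t hT.2 A ψ]
  | ask z k ih =>
    obtain ⟨t', -, hk⟩ := hT
    exact ih _ l t' (hk _) _ _
  | layer L k ih =>
    simp only [hyb]
    rw [← Layer.normSqr_apply (hidingOracle f (l + 1) A c) L hT.1,
      ← sum_normSqr_project L.measured, ← Finset.sum_add_distrib]
    refine Finset.sum_le_sum fun z _ => ?_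
    split_ifs
    exacts [ih z _ _ (hT.2.2.2 z) _ _, by simp]

/-- If on average over `s` the weight of every set that a scheme can collect is at least `K`,
then so is the average weight of its outputs. -/
theorem Tree.mul_hyb_le_sum {D B : ℕ} {ι : Type} (S : Finset ι)
    (g : ι → Finset (Bits (bigLen d n)) → ℝ) (K : ℝ)
    (hK : ∀ A, A.card ≤ B → K ≤ ∑ s ∈ S, g s A) (f : Bits n → Bits n)
    (c : Fin d → Equiv.Perm (Bits (bigLen d n))) (v : Bool)
    (T : Tree (inLen d n) (outLen d n) w) (l t : ℕ) (hT : T.Ok D B l t)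
    (A : Finset (Bits (bigLen d n))) (hA : A.card + t ≤ B) (ψ : State w) :
    K * T.hyb f c v (fun _ => 1) l A ψ ≤ ∑ s ∈ S, T.hyb f c v (g s) l A ψ := by
  classical
  induction T generalizing l t A ψ with
  | abort => simp [hyb]
  | leaf u =>
    simp only [hyb]
    split_ifs
    · rw [← Finset.sum_mul, one_mul]
      exact mul_le_mul_of_nonneg_right (hK A (by omega)) (normSqr_nonneg ψ)
    · simp
  | coin T₁ T₂ ih₁ ih₂ =>
    have h1 := ih₁ l t hT.1 A hA ψ
    have h2 := ih₂ l t hT.2 A hA ψ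
    simp only [hyb]
    rw [← Finset.sum_div, Finset.sum_add_distrib]
    linarith
  | ask z k ih =>
    obtain ⟨t', ht', hk⟩ := hT
    refine ih _ l t' (hk _) _ ?_ ψ
    have := Finset.card_insert_le (basePoint c z) A
    omega
  | layer L k ih =>
    simp only [hyb]
    rw [Finset.mul_sum, Finset.sum_comm]
    refine Finset.sum_le_sum fun z _ => ?_
    split_ifs
    · exact ih z _ _ (hT.2.2.2 z) A hA _
    · simp

open Classical in
/-- The members of a family `F` of functions that agree with `e` on the known points. -/
def agreeing {R : Type} [Fintype R] (F : R → Bits n → Bits n) (A : Finset (Bits (bigLen d n)))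
    (e : Bits n → Bits n) : Finset R :=
  Finset.univ.filter fun r => ∀ u, embed (bigLen d n) u ∈ A → F r u = e u

/-- Two families of functions cannot be told apart if equally many members of each are
consistent with any values at the known points. -/
theorem Tree.sum_hyb_congr {R R' : Type} [Fintype R] [Fintype R'] (F : R → Bits n → Bits n)
    (F' : R' → Bits n → Bits n) (c : Fin d → Equiv.Perm (Bits (bigLen d n))) (v : Bool)
    (g : Finset (Bits (bigLen d n)) → ℝ)
    (hg : ∀ A, g A ≠ 0 → ∀ e, (agreeing F A e).card = (agreeing F' A e).card) {B : ℕ}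
    (T : Tree (inLen d n) (outLen d n) w) (l t : ℕ) (hT : T.Ok d B l t)
    (A : Finset (Bits (bigLen d n))) (e : Bits n → Bits n) (ψ : State w) :
    ∑ r ∈ agreeing F A e, T.hyb (F r) c v g l A ψ =
      ∑ r ∈ agreeing F' A e, T.hyb (F' r) c v g l A ψ := by
  classical
  induction T generalizing l t A e ψ with
  | abort => simp [hyb]
  | leaf u =>
    simp only [hyb, Finset.sum_const]
    by_cases hA : g A = 0
    · simp [hA]
    · rw [hg A hA e]
  | coin T₁ T₂ ih₁ ih₂ =>
    simp only [hyb]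
    rw [← Finset.sum_div, ← Finset.sum_div, Finset.sum_add_distrib, Finset.sum_add_distrib,
      ih₁ l t hT.1, ih₂ l t hT.2]
  | layer L k ih =>
    have key : ∀ {R₀ : Type} [Fintype R₀] (F₀ : R₀ → Bits n → Bits n),
        ∑ r ∈ agreeing F₀ A e, (Tree.layer L k).hyb (F₀ r) c v g l A ψ =
        ∑ z : Bits w, if ∀ i : Fin w, i.val ∉ L.measured → z i = false then
          ∑ r ∈ agreeing F₀ A e, (k z).hyb (F₀ r) c v g (l + 1) A
            (project L.measured z (L.apply (hidingOracle e (l + 1) A c) ψ)) else 0 := by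
      intro R₀ _ F₀
      have hap : ∀ r ∈ agreeing F₀ A e, L.apply (hidingOracle (F₀ r) (l + 1) A c) ψ =
          L.apply (hidingOracle e (l + 1) A c) ψ := by
        intro r hr
        rcases hT.2.2.1 with hl | hQ
        · rw [hidingOracle_congr hl c (Finset.mem_filter.1 hr).2]
        · simp [Layer.apply, hQ]
      simp only [hyb]
      rw [Finset.sum_comm]
      refine Finset.sum_congr rfl fun z _ => ?_
      split_ifs
      · exact Finset.sum_congr rfl fun r hr => by rw [hap r hr]
      · simp
    rw [key F, key F']
    refine Finset.sum_congr rfl fun z _ => ?_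
    rw [ih z (l + 1) t (hT.2.2.2 z)]
  | ask z k ih =>
    obtain ⟨t', -, hk⟩ := hT
    simp only [hyb]
    by_cases hx : ∃ u : Bits n, embed (bigLen d n) u = basePoint c z ∧ basePoint c z ∉ A
    · obtain ⟨u, hu, hxA⟩ := hx
      -- the query reveals the value at `u`
      have key : ∀ {R₀ : Type} [Fintype R₀] (F₀ : R₀ → Bits n → Bits n),
          ∑ r ∈ agreeing F₀ A e,
            (k (compOracle (F₀ r) c z)).hyb (F₀ r) c v g l (insert (basePoint c z) A) ψ =
          ∑ y, ∑ r ∈ agreeing F₀ (insert (basePoint c z) A) (Function.update e u y),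
            (k (compOracle (Function.update e u y) c z)).hyb (F₀ r) c v g l
              (insert (basePoint c z) A) ψ := by
        intro R₀ _ F₀
        rw [← Finset.sum_fiberwise (agreeing F₀ A e) fun r => F₀ r u]
        refine Finset.sum_congr rfl fun y _ => ?_
        refine Finset.sum_congr ?_ fun r hr => ?_
        · ext r
          simp only [agreeing, Finset.mem_filter, Finset.mem_univ, true_and, Finset.mem_insert]
          constructor
          · rintro ⟨h1, h2⟩ u' hu'
            by_cases hy : u' = u
            · subst hy; simpa using h2
            · rw [Function.update_of_ne hy]
              refine h1 u' (hu'.resolve_left fun e' => hy ?_)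
              exact embed_injective (le_bigLen d n) (e'.trans hu.symm)
          · intro h
            refine ⟨fun u' hu' => ?_, by simpa using h u (Or.inl hu)⟩
            have hy : u' ≠ u := by rintro rfl; exact hxA (hu ▸ hu')
            simpa [Function.update_of_ne hy] using h u' (Or.inr hu')
        · rw [compOracle_congr (f' := Function.update e u y)]
          rintro - u' hu'
          exact (Finset.mem_filter.1 hr).2 u' (by rw [hu']; exact Finset.mem_insert_self _ _)
      rw [key F, key F']
      exact Finset.sum_congr rfl fun y _ => ih _ l t' (hk _) _ _ _
    · have hx' : ∀ u : Bits n, embed (bigLen d n) u = basePoint c z → embed (bigLen d n) u ∈ A := by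
        intro u hu
        by_contra hn
        exact hx ⟨u, hu, hu ▸ hn⟩
      have key : ∀ {R₀ : Type} [Fintype R₀] (F₀ : R₀ → Bits n → Bits n),
          ∑ r ∈ agreeing F₀ A e,
            (k (compOracle (F₀ r) c z)).hyb (F₀ r) c v g l (insert (basePoint c z) A) ψ =
          ∑ r ∈ agreeing F₀ (insert (basePoint c z) A) e,
            (k (compOracle e c z)).hyb (F₀ r) c v g l (insert (basePoint c z) A) ψ := by
        intro R₀ _ F₀
        refine Finset.sum_congr ?_ fun r hr => ?_
        · ext r
          simp only [agreeing, Finset.mem_filter, Finset.mem_univ, true_and, Finset.mem_insert]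
          exact ⟨fun h u hu => h u (hu.elim (hx' u) id), fun h u hu => h u (Or.inr hu)⟩
        · rw [compOracle_congr (f' := e)]
          rintro - u' hu'
          exact (Finset.mem_filter.1 hr).2 u' (by rw [hu']; exact Finset.mem_insert_self _ _)
      rw [key F, key F']
      exact ih _ l t' (hk _) _ _ _

end Hybrid

/-! ### The hidden shift of a Simon function -/

section Shift

variable {n : ℕ}

theorem xorBits_self_cancel (x s : Bits n) : xorBits x (xorBits x s) = s := by
  funext i; simp [xorBits]

theorem xorBits_cancel_right (x s : Bits n) : xorBits (xorBits x s) s = x := by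
  funext i; simp [xorBits]

open Classical in
/-- The two-to-one functions with hidden shift `s`. -/
def shiftFns (s : Bits n) : Finset (Bits n → Bits n) :=
  Finset.univ.filter fun f => ∀ x y, f x = f y ↔ y = x ∨ y = xorBits x s

theorem mem_shiftFns {s : Bits n} {f : Bits n → Bits n} :
    f ∈ shiftFns s ↔ ∀ x y, f x = f y ↔ y = x ∨ y = xorBits x s := by
  simp [shiftFns]

open Classical in
theorem simonFns_eq : simonFns n =
    (Finset.univ.filter fun s : Bits n => s ≠ fun _ => false).biUnion shiftFns := by
  ext f
  simp [simonFns, IsSimon, mem_shiftFns]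

theorem shiftFns_disjoint {s s' : Bits n} (hs : s ≠ fun _ => false) (h : s ≠ s') :
    Disjoint (shiftFns s) (shiftFns s') := by
  rw [Finset.disjoint_left]
  intro f hf hf'
  have h1 := (mem_shiftFns.1 hf (fun _ => false) s).2 (Or.inr (by funext i; simp [xorBits]))
  rcases (mem_shiftFns.1 hf' _ _).1 h1 with h2 | h2
  · exact hs h2
  · exact h (h2.trans (by funext i; simp [xorBits]))

/-- Some linear functional does not vanish at two given nonzero vectors. -/
theorem exists_functional {s s' : Bits n} (hs : s ≠ fun _ => false) (hs' : s' ≠ fun _ => false) :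
    ∃ φ : Bits n → Bool, (∀ x y, φ (xorBits x y) = xor (φ x) (φ y)) ∧ φ s = true ∧
      φ s' = true := by
  obtain ⟨i, hi⟩ : ∃ i, s i = true := by
    by_contra hn
    exact hs (funext fun i => by simpa using not_exists.1 hn i)
  obtain ⟨j, hj⟩ : ∃ i, s' i = true := by
    by_contra hn
    exact hs' (funext fun i => by simpa using not_exists.1 hn i)
  by_cases hi' : s' i = true
  · exact ⟨fun x => x i, fun x y => rfl, hi, hi'⟩
  by_cases hj' : s j = true
  · exact ⟨fun x => x j, fun x y => rfl, hj', hj⟩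
  refine ⟨fun x => xor (x i) (x j), fun x y => ?_, ?_, ?_⟩
  · simp only [xorBits]
    cases x i <;> cases y i <;> cases x j <;> cases y j <;> rfl
  · simp_all
  · simp_all

/-- Some linear involution takes `s` to `s'`, a transvection. -/
theorem exists_involution {s s' : Bits n} (hs : s ≠ fun _ => false)
    (hs' : s' ≠ fun _ => false) :
    ∃ L : Bits n → Bits n, (∀ x, L (L x) = x) ∧ (∀ x y, L (xorBits x y) = xorBits (L x) (L y)) ∧
      L s = s' := by
  obtain ⟨φ, hadd, h1, h2⟩ := exists_functional hs hs'
  refine ⟨fun x => if φ x = true then xorBits x (xorBits s s') else x, fun x => ?_,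
    fun x y => ?_, ?_⟩
  · by_cases hx : φ x = true
    · have h3 : φ (xorBits x (xorBits s s')) = true := by simp [hadd, h1, h2, hx]
      simp only [hx, h3, if_true]
      exact xorBits_cancel_right _ _
    · simp [hx]
  · simp only [hadd]
    cases hx : φ x <;> cases hy : φ y <;> simp <;> funext i <;> simp only [xorBits] <;>
      cases x i <;> cases y i <;> cases s i <;> cases s' i <;> rfl
  · simp only [h1, if_true]
    exact xorBits_self_cancel s s'

theorem card_shiftFns_le {s s' : Bits n} (hs : s ≠ fun _ => false) (hs' : s' ≠ fun _ => false) :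
    (shiftFns s').card ≤ (shiftFns s).card := by
  obtain ⟨L, hL, hadd, hss⟩ := exists_involution hs hs'
  have hinj : Function.Injective L := Function.LeftInverse.injective (g := L) hL
  refine Finset.card_le_card_of_injOn (fun f => f ∘ L) ?_ ?_
  · intro f hf
    rw [Finset.mem_coe, mem_shiftFns] at hf ⊢
    intro x y
    simp only [Function.comp_apply]
    rw [hf, hinj.eq_iff, ← hss, ← hadd, hinj.eq_iff]
  · intro f _ f' _ h
    funext x
    have := congrFun h (L x)
    simpa [hL] using this

/-- All nonzero shifts are equally likely for a uniformly random Simon function. -/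
theorem card_shiftFns {s s' : Bits n} (hs : s ≠ fun _ => false) (hs' : s' ≠ fun _ => false) :
    (shiftFns s).card = (shiftFns s').card :=
  le_antisymm (card_shiftFns_le hs' hs) (card_shiftFns_le hs hs')

theorem sum_shiftFns_comp {s : Bits n} (ρ : Equiv.Perm (Bits n)) (F : (Bits n → Bits n) → ℝ) :
    ∑ f ∈ shiftFns s, F (ρ ∘ f) = ∑ f ∈ shiftFns s, F f := by
  refine Finset.sum_bij' (fun f _ => ρ ∘ f) (fun f _ => ρ.symm ∘ f) ?_ ?_ ?_ ?_ ?_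
  · intro f hf
    rw [mem_shiftFns] at hf ⊢
    intro x y
    simp [← hf]
  · intro f hf
    rw [mem_shiftFns] at hf ⊢
    intro x y
    simp [← hf]
  · intro f _; funext x; simp
  · intro f _; funext x; simp
  · intro f _; rfl

theorem sum_oneToOneFns (F : (Bits n → Bits n) → ℝ) :
    ∑ f ∈ oneToOneFns n, F f = ∑ ρ : Equiv.Perm (Bits n), F ρ := by
  symm
  refine Finset.sum_bij (fun ρ _ => ⇑ρ) ?_ ?_ ?_ ?_
  · intro ρ _; simp [oneToOneFns, ρ.injective]
  · intro ρ _ ρ' _ h; exact Equiv.coe_fn_injective h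
  · intro f hf
    simp only [oneToOneFns, Finset.mem_filter, Finset.mem_univ, true_and] at hf
    exact ⟨Equiv.ofBijective f (Finite.injective_iff_bijective.1 hf), Finset.mem_univ _, rfl⟩
  · intro ρ _; rfl

variable {d : ℕ}

open Classical in
/-- `1` if no two points of `A` differ by the shift `s`, otherwise `0`. -/
def noCollision (s : Bits n) (A : Finset (Bits (bigLen d n))) : ℝ :=
  if ∃ u : Bits n, embed (bigLen d n) u ∈ A ∧ embed (bigLen d n) (xorBits u s) ∈ A then 0 else 1

theorem noCollision_le_one (s : Bits n) (A : Finset (Bits (bigLen d n))) :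
    noCollision s A ≤ 1 := by
  unfold noCollision; split_ifs <;> norm_num

open Classical in
theorem le_sum_noCollision {B : ℕ} (A : Finset (Bits (bigLen d n))) (hA : A.card ≤ B) :
    (2 : ℝ) ^ n - 1 - (B : ℝ) ^ 2 ≤
      ∑ s : Bits n with s ≠ fun _ => false, noCollision (d := d) s A := by
  set Z := Finset.univ.filter fun s : Bits n => s ≠ fun _ => false
  set bad := Z.filter fun s => ∃ u : Bits n, embed (bigLen d n) u ∈ A ∧
    embed (bigLen d n) (xorBits u s) ∈ A
  have hZ : (Z.card : ℝ) = 2 ^ n - 1 := by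
    have h1 : Z = Finset.univ.erase (fun _ => false) := by
      ext s; simp [Z]
    rw [h1, Finset.card_erase_of_mem (Finset.mem_univ _)]
    have : 1 ≤ 2 ^ n := Nat.one_le_two_pow
    simp [Nat.cast_sub this]
  have hbad : bad.card ≤ B ^ 2 := by
    let φ : Bits (bigLen d n) × Bits (bigLen d n) → Bits n := fun p i =>
      xor (p.1 ⟨i.val, i.2.trans_le (le_bigLen d n)⟩) (p.2 ⟨i.val, i.2.trans_le (le_bigLen d n)⟩)
    have hsub : bad ⊆ (A ×ˢ A).image φ := by
      intro s hs
      obtain ⟨-, u, hu, hu'⟩ := Finset.mem_filter.1 hs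
      refine Finset.mem_image.2 ⟨(embed _ u, embed _ (xorBits u s)),
        Finset.mem_product.2 ⟨hu, hu'⟩, ?_⟩
      funext i
      simp [φ, embed, xorBits]
    calc bad.card ≤ ((A ×ˢ A).image φ).card := Finset.card_le_card hsub
      _ ≤ (A ×ˢ A).card := Finset.card_image_le
      _ = A.card * A.card := Finset.card_product _ _
      _ ≤ B ^ 2 := by rw [sq]; exact Nat.mul_le_mul hA hA
  have hsum : ∑ s ∈ Z, noCollision (d := d) s A = Z.card - bad.card := by
    have : ∀ s, noCollision (d := d) s A = 1 - if ∃ u : Bits n, embed (bigLen d n) u ∈ A ∧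
        embed (bigLen d n) (xorBits u s) ∈ A then 1 else 0 := by
      intro s; unfold noCollision; split_ifs <;> norm_num
    simp only [this, Finset.sum_sub_distrib]
    simp [bad]
  rw [hsum, hZ]
  have : (bad.card : ℝ) ≤ (B : ℝ) ^ 2 := by exact_mod_cast hbad
  linarith

/-- As long as no two known points differ by the shift, the values of a Simon function, randomised
by a permutation of the values, look like those of a permutation. -/
theorem card_agreeing {s : Bits n} {f : Bits n → Bits n} (hf : f ∈ shiftFns s)
    (A : Finset (Bits (bigLen d n))) (hA : noCollision s A ≠ 0) (e : Bits n → Bits n) :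
    (agreeing (fun ρ : Equiv.Perm (Bits n) => ρ ∘ f) A e).card =
      (agreeing (fun ρ : Equiv.Perm (Bits n) => ⇑ρ) A e).card := by
  classical
  have hno : ¬ ∃ u : Bits n, embed (bigLen d n) u ∈ A ∧
      embed (bigLen d n) (xorBits u s) ∈ A := by
    intro h; exact hA (if_pos h)
  let K : Set (Bits n) := {u | embed (bigLen d n) u ∈ A}
  have hinj : Set.InjOn f K := by
    intro u hu u' hu' h
    rcases (mem_shiftFns.1 hf u u').1 h with h1 | h1
    · exact h1.symm
    · exact absurd ⟨u, hu, h1 ▸ hu'⟩ hno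
  -- a permutation that extends the restriction of `f` to the known points
  let e₀ : {u // u ∈ K} ≃ {y // y ∈ f '' K} := Equiv.Set.imageOfInjOn f K hinj
  let σ : Equiv.Perm (Bits n) := e₀.extendSubtype
  have hσ : ∀ u ∈ K, σ u = f u := fun u hu => e₀.extendSubtype_apply_of_mem u hu
  refine Finset.card_equiv (Equiv.mulRight σ) fun ρ => ?_
  simp only [agreeing, Finset.mem_filter, Finset.mem_univ, true_and, Equiv.coe_mulRight]
  refine forall_congr' fun u => forall_congr' fun hu => ?_
  rw [Equiv.Perm.mul_apply, hσ u hu]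
  rfl

end Shift

/-! ### The lower bound -/

theorem sum_avg_shuffle {d n a : ℕ} (S : Finset (Bits n → Bits n)) (D B : ℕ) (P : Cmd) (v : Bool) :
    avg S (fun f => avg (Finset.univ : Finset (Fin d → Equiv.Perm (Bits (bigLen d n))))
      (fun π => outProb (shuffleOracle f π) D B P a v)) =
    (∑ f ∈ S, ∑ c : Fin d → Equiv.Perm (Bits (bigLen d n)),
      (toTree D B B (start (inLen d n) (outLen d n) P a)).eval (compOracle f c) v (zeroState B))
      / (S.card * (Fintype.card (Fin d → Equiv.Perm (Bits (bigLen d n))) : ℝ)) := by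
  have h : ∀ f : Bits n → Bits n,
      ∑ π : Fin d → Equiv.Perm (Bits (bigLen d n)), outProb (shuffleOracle f π) D B P a v =
      ∑ c : Fin d → Equiv.Perm (Bits (bigLen d n)),
      (toTree D B B (start (inLen d n) (outLen d n) P a)).eval (compOracle f c) v
        (zeroState B) := by
    intro f
    simp only [outProb, run_eq_eval, shuffleOracle_eq]
    exact sum_compositions fun c => (toTree D B B (start (inLen d n) (outLen d n) P a)).eval
      (compOracle f c) v (zeroState B)
  simp only [avg, h, Finset.card_univ]
  rw [← Finset.sum_div, div_div, mul_comm]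

theorem sum_avg_le_one {d n a : ℕ} (S : Finset (Bits n → Bits n)) (D B : ℕ) (P : Cmd) (v : Bool) :
    avg S (fun f => avg (Finset.univ : Finset (Fin d → Equiv.Perm (Bits (bigLen d n))))
      (fun π => outProb (shuffleOracle f π) D B P a v)) ≤ 1 := by
  rw [sum_avg_shuffle]
  refine div_le_one_of_le₀ ?_ (by positivity)
  calc _ ≤ ∑ f ∈ S, ∑ c : Fin d → Equiv.Perm (Bits (bigLen d n)), (1 : ℝ) := by
        refine Finset.sum_le_sum fun f _ => Finset.sum_le_sum fun c _ => ?_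
        rw [← normSqr_zeroState B]
        exact Tree.eval_le _ _ _ 0 B (toTree_ok D B B B _ (by simp [start, Layer.empty])) _
    _ = _ := by simp

theorem successProb_le_one (d n D B : ℕ) (P : Cmd) : successProb d n D B P ≤ 1 := by
  have h1 := sum_avg_le_one (d := d) (a := n) (simonFns n) D B P true
  have h2 := sum_avg_le_one (d := d) (a := n) (oneToOneFns n) D B P false
  rw [successProb]
  linarith

/-- For `f` with hidden shift, the probability of an output other than `false` is bounded by that
for random permutations, up to the probability that two classical queries differ by the shift. -/
theorem sum_hyb_false_ge {d n w D B : ℕ} (T : Tree (inLen d n) (outLen d n) w)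
    (hT : T.Ok d B 0 B) (hD : D = (shiftFns (n := n) (fun _ => true)).card) (hn : 1 ≤ n)
    (ψ : State w) :
    D * ((2 : ℝ) ^ n - 1 - (B : ℝ) ^ 2) * (∑ ρ : Equiv.Perm (Bits n),
        ∑ c : Fin d → Equiv.Perm (Bits (bigLen d n)), T.hyb ρ c false (fun _ => 1) 0 ∅ ψ)
      ≤ (Fintype.card (Equiv.Perm (Bits n)) : ℝ) * ∑ f ∈ simonFns n,
        ∑ c : Fin d → Equiv.Perm (Bits (bigLen d n)), T.hyb f c false (fun _ => 1) 0 ∅ ψ := by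
  classical
  set Z := Finset.univ.filter fun s : Bits n => s ≠ fun _ => false
  have h1 : ∀ s ∈ Z, (shiftFns s).card = D := by
    intro s hs
    rw [hD]
    refine card_shiftFns (Finset.mem_filter.1 hs).2 fun h => ?_
    simpa using congrFun h ⟨0, hn⟩
  have huniv : ∀ (R : Type) [Fintype R] (F : R → Bits n → Bits n) (e : Bits n → Bits n),
      agreeing (d := d) F ∅ e = Finset.univ := by
    intro R _ F e; simp [agreeing]
  have h2 : ∀ s ∈ Z, (Fintype.card (Equiv.Perm (Bits n)) : ℝ) * ∑ f ∈ shiftFns s,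
      ∑ c : Fin d → Equiv.Perm (Bits (bigLen d n)), T.hyb f c false (noCollision s) 0 ∅ ψ =
      D * ∑ ρ : Equiv.Perm (Bits n), ∑ c : Fin d → Equiv.Perm (Bits (bigLen d n)),
        T.hyb ρ c false (noCollision s) 0 ∅ ψ := by
    intro s hs
    calc _ = ∑ ρ : Equiv.Perm (Bits n), ∑ f ∈ shiftFns s,
          ∑ c : Fin d → Equiv.Perm (Bits (bigLen d n)),
            T.hyb (ρ ∘ f) c false (noCollision s) 0 ∅ ψ := by
          rw [Finset.sum_congr rfl fun ρ _ => sum_shiftFns_comp ρ fun f =>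
            ∑ c : Fin d → Equiv.Perm (Bits (bigLen d n)),
              T.hyb f c false (noCollision s) 0 ∅ ψ]
          simp
      _ = ∑ f ∈ shiftFns s, ∑ c : Fin d → Equiv.Perm (Bits (bigLen d n)),
            ∑ ρ : Equiv.Perm (Bits n), T.hyb ρ c false (noCollision s) 0 ∅ ψ := by
          rw [Finset.sum_comm]
          refine Finset.sum_congr rfl fun f hf => ?_
          rw [Finset.sum_comm]
          refine Finset.sum_congr rfl fun c _ => ?_
          have := Tree.sum_hyb_congr (fun ρ : Equiv.Perm (Bits n) => ρ ∘ f)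
            (fun ρ : Equiv.Perm (Bits n) => ⇑ρ) c false (noCollision s)
            (fun A hA e => card_agreeing hf A hA e) T 0 B hT ∅ f ψ
          rwa [huniv, huniv] at this
      _ = _ := by
          rw [Finset.sum_const, h1 s hs, nsmul_eq_mul]
          congr 1
          exact Finset.sum_comm
  have hdisj : (Z : Set (Bits n)).PairwiseDisjoint shiftFns := by
    intro s hs s' _ hss
    exact shiftFns_disjoint (Finset.mem_filter.1 hs).2 hss
  calc _ = (D : ℝ) * ∑ ρ : Equiv.Perm (Bits n), ∑ c : Fin d → Equiv.Perm (Bits (bigLen d n)),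
        ((2 : ℝ) ^ n - 1 - (B : ℝ) ^ 2) * T.hyb ρ c false (fun _ => 1) 0 ∅ ψ := by
        simp only [← Finset.mul_sum]; ring
    _ ≤ (D : ℝ) * ∑ ρ : Equiv.Perm (Bits n), ∑ c : Fin d → Equiv.Perm (Bits (bigLen d n)),
        ∑ s ∈ Z, T.hyb ρ c false (noCollision s) 0 ∅ ψ := by
        gcongr with ρ _ c _
        exact T.mul_hyb_le_sum Z noCollision _ (fun A hA => le_sum_noCollision A hA) ρ c false 0 B
          hT ∅ (by simp) ψ
    _ = ∑ s ∈ Z, (D : ℝ) * ∑ ρ : Equiv.Perm (Bits n), ∑ c : Fin d → Equiv.Perm (Bits (bigLen d n)),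
        T.hyb ρ c false (noCollision s) 0 ∅ ψ := by
        rw [← Finset.mul_sum]
        congr 1
        symm
        rw [Finset.sum_comm]
        refine Finset.sum_congr rfl fun ρ _ => ?_
        exact Finset.sum_comm
    _ = ∑ s ∈ Z, (Fintype.card (Equiv.Perm (Bits n)) : ℝ) * ∑ f ∈ shiftFns s,
        ∑ c : Fin d → Equiv.Perm (Bits (bigLen d n)),
          T.hyb f c false (noCollision s) 0 ∅ ψ :=
        Finset.sum_congr rfl fun s hs => (h2 s hs).symm
    _ ≤ ∑ s ∈ Z, (Fintype.card (Equiv.Perm (Bits n)) : ℝ) * ∑ f ∈ shiftFns s,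
        ∑ c : Fin d → Equiv.Perm (Bits (bigLen d n)), T.hyb f c false (fun _ => 1) 0 ∅ ψ := by
        gcongr with s _ f _ c _
        exact T.hyb_mono f c false (noCollision_le_one s) 0 ∅ ψ
    _ = _ := by
        rw [← Finset.mul_sum, simonFns_eq, Finset.sum_biUnion hdisj]

theorem successProb_le {d n B : ℕ} (hn : 1 ≤ n) (hB : 2 * B ≤ 2 ^ n) (P : Cmd) (lam : ℝ)
    (hl : 0 < lam) : successProb d n d B P ≤
      1 / 2 + d * (lam + (1 + 1 / lam) * (8 * B / 2 ^ n)) + (B : ℝ) ^ 2 / (2 * (2 ^ n - 1)) := by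
  classical
  set T := toTree d B B (start (inLen d n) (outLen d n) P n) with hTdef
  have hT : T.Ok d B 0 B := toTree_ok d B B B _ (by simp [start, Layer.empty])
  set ψ := zeroState B
  set κ := lam + (1 + 1 / lam) * (8 * B / 2 ^ n)
  have hκ : 0 ≤ κ := by positivity
  set m := (Fintype.card (Fin d → Equiv.Perm (Bits (bigLen d n))) : ℝ) with hm
  have hm0 : 0 < m := by positivity
  set E : (Bits n → Bits n) → Bool → ℝ := fun f v =>
    ∑ c : Fin d → Equiv.Perm (Bits (bigLen d n)), T.eval (compOracle f c) v ψ
  set H : (Bits n → Bits n) → Bool → ℝ := fun f v =>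
    ∑ c : Fin d → Equiv.Perm (Bits (bigLen d n)), T.hyb f c v (fun _ => 1) 0 ∅ ψ
  have hEH : ∀ f v, E f v ≤ H f v + d * κ * m := by
    intro f v
    have := T.sum_eval_le f v hB lam hl 0 B ∅ Finset.univ (fun _ => ψ) hT (by simp)
      (fun j _ x _ x' _ c _ => ⟨Finset.mem_univ _, rfl⟩)
    simpa [ψ, normSqr_zeroState, E, H, κ, m] using this
  have hH1 : ∀ f, H f true + H f false ≤ m := by
    intro f
    simp only [H]
    rw [← Finset.sum_add_distrib]
    calc _ ≤ ∑ c : Fin d → Equiv.Perm (Bits (bigLen d n)), (1 : ℝ) := by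
          refine Finset.sum_le_sum fun c _ => ?_
          exact (T.hyb_add_le f c 0 B hT ∅ ψ).trans_eq (normSqr_zeroState B)
      _ = m := by simp [m]
  set R := (Fintype.card (Equiv.Perm (Bits n)) : ℝ) with hR
  have hR0 : 0 < R := by positivity
  set G := ∑ ρ : Equiv.Perm (Bits n), H ρ false with hG
  have hG0 : 0 ≤ G := Finset.sum_nonneg fun ρ _ => Finset.sum_nonneg fun c _ =>
    T.hyb_nonneg _ c false _ (fun _ => zero_le_one) 0 ∅ ψ
  have hG1 : G ≤ R * m := by
    calc G ≤ ∑ ρ : Equiv.Perm (Bits n), m := by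
          refine Finset.sum_le_sum fun ρ _ => ?_
          have := hH1 ρ
          have : 0 ≤ H ρ true := Finset.sum_nonneg fun c _ =>
            T.hyb_nonneg _ c true _ (fun _ => zero_le_one) 0 ∅ ψ
          linarith [hH1 ρ]
      _ = R * m := by simp [R]
  have h2n : (1 : ℝ) ≤ 2 ^ n - 1 := by
    have : (2 : ℝ) ^ 1 ≤ 2 ^ n := pow_le_pow_right₀ (by norm_num) hn
    linarith
  -- the one-to-one functions
  have hI : (∑ f ∈ oneToOneFns n, E f false) / ((oneToOneFns n).card * m)
      ≤ G / (R * m) + d * κ := by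
    have hc : ((oneToOneFns n).card : ℝ) = R := by
      have := sum_oneToOneFns (n := n) fun _ => 1
      simpa [R] using this
    rw [hc, sum_oneToOneFns fun f => E f false, div_add' _ _ _ (by positivity)]
    gcongr
    calc _ ≤ ∑ ρ : Equiv.Perm (Bits n), (H ρ false + d * κ * m) :=
          Finset.sum_le_sum fun ρ _ => hEH ρ false
      _ = _ := by
          rw [Finset.sum_add_distrib]
          simp [G, R]
          ring
  -- the Simon functions
  have hS : (∑ f ∈ simonFns n, E f true) / ((simonFns n).card * m)
      ≤ 1 - G / (R * m) + d * κ + (B : ℝ) ^ 2 / (2 ^ n - 1) := by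
    have hGm : G / (R * m) ≤ 1 := div_le_one_of_le₀ hG1 (by positivity)
    set M := (shiftFns (n := n) (fun _ => true)).card with hM
    have hcard : ((simonFns n).card : ℝ) = M * (2 ^ n - 1) := by
      set Z := Finset.univ.filter fun s : Bits n => s ≠ fun _ => false with hZd
      have hZ : (Z.card : ℝ) = 2 ^ n - 1 := by
        have h1 : Z = Finset.univ.erase (fun _ => false) := by
          ext s; simp [Z]
        rw [h1, Finset.card_erase_of_mem (Finset.mem_univ _)]
        have : 1 ≤ 2 ^ n := Nat.one_le_two_pow
        simp [Nat.cast_sub this]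
      have h1 : ∀ s ∈ Z, (shiftFns s).card = M := by
        intro s hs
        refine card_shiftFns (Finset.mem_filter.1 hs).2 fun h => ?_
        simpa using congrFun h ⟨0, hn⟩
      rw [simonFns_eq, Finset.card_biUnion fun s hs s' _ hss =>
        shiftFns_disjoint (Finset.mem_filter.1 hs).2 hss, Finset.sum_congr rfl h1,
        Finset.sum_const, smul_eq_mul, Nat.cast_mul, ← hZ, mul_comm]
    rcases Nat.eq_zero_or_pos M with h0 | h0
    · have hz : ((simonFns n).card : ℝ) = 0 := by rw [hcard, h0]; simp
      rw [hz, zero_mul, div_zero]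
      have : 0 ≤ (B : ℝ) ^ 2 / (2 ^ n - 1) := by positivity
      have : 0 ≤ d * κ := by positivity
      linarith
    · have hge := sum_hyb_false_ge T hT hM hn ψ
      have hM0 : (0 : ℝ) < M := by exact_mod_cast h0
      have hcp : (0 : ℝ) < (simonFns n).card := by rw [hcard]; positivity
      have hle : ∑ f ∈ simonFns n, E f true ≤ (simonFns n).card * (m + d * κ * m)
          - ∑ f ∈ simonFns n, H f false := by
        calc _ ≤ ∑ f ∈ simonFns n, ((m + d * κ * m) - H f false) := by
              refine Finset.sum_le_sum fun f _ => ?_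
              linarith [hEH f true, hH1 f]
          _ = _ := by rw [Finset.sum_sub_distrib]; simp [mul_add]
      have hge' : M * (2 ^ n - 1 - (B : ℝ) ^ 2) * G / R ≤ ∑ f ∈ simonFns n, H f false := by
        rw [div_le_iff₀ hR0, mul_comm _ R]
        exact hge
      rw [div_le_iff₀ (by positivity)]
      refine hle.trans ?_
      have h5 : (1 - G / (R * m) + d * κ + (B : ℝ) ^ 2 / (2 ^ n - 1)) *
          ((simonFns n).card * m) = (simonFns n).card * (m + d * κ * m)
          - M * (2 ^ n - 1 - (B : ℝ) ^ 2) * G / R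
          + M * (B : ℝ) ^ 2 * m * (1 - G / (R * m)) := by
        rw [hcard]
        field_simp
        ring
      have h6 : 0 ≤ M * (B : ℝ) ^ 2 * m * (1 - G / (R * m)) := by
        have : 0 ≤ 1 - G / (R * m) := by linarith
        positivity
      linarith
  rw [successProb, sum_avg_shuffle, sum_avg_shuffle]
  change 1 / 2 * ((∑ f ∈ simonFns n, E f true) / ((simonFns n).card * m)) +
    1 / 2 * ((∑ f ∈ oneToOneFns n, E f false) / ((oneToOneFns n).card * m)) ≤ _
  have h7 : (B : ℝ) ^ 2 / (2 * (2 ^ n - 1)) = 1 / 2 * ((B : ℝ) ^ 2 / (2 ^ n - 1)) := by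
    rw [mul_comm 2, ← div_div]; ring
  rw [h7]
  linarith

theorem lower_bound (d : ℕ) (P : ℕ → Cmd) (p : Polynomial ℕ) : ∃ q : Polynomial ℕ, ∀ n : ℕ,
    successProb d n d (p.eval n) (P n) ≤ 1 / 2 + Real.sqrt (((q.eval n : ℕ) : ℝ) / 2 ^ n) := by
  refine ⟨(Polynomial.C (17 * d) + p) ^ 2 * (p + 1) + p, fun n => ?_⟩
  set B := p.eval n
  have hq : (((Polynomial.C (17 * d) + p) ^ 2 * (p + 1) + p).eval n : ℕ) =
      (17 * d + B) ^ 2 * (B + 1) + B := by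
    simp [B]
  rw [hq]
  rcases Nat.eq_zero_or_pos n with h0 | hn
  · subst h0
    have h1 : simonFns 0 = ∅ := by
      ext f
      simp only [simonFns, Finset.mem_filter, Finset.mem_univ, true_and, IsSimon,
        Finset.notMem_empty, iff_false]
      rintro ⟨s, hs, -⟩
      exact hs (funext fun i => i.elim0)
    have h2 := sum_avg_le_one (d := d) (a := 0) (oneToOneFns 0) d B (P 0) false
    have h3 := Real.sqrt_nonneg ((((17 * d + B) ^ 2 * (B + 1) + B : ℕ) : ℝ) / 2 ^ 0)
    rw [successProb, h1]
    simp only [avg, Finset.sum_empty, zero_div, mul_zero, zero_add]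
    simp only [avg] at h2
    linarith
  by_cases hB : 2 * B ≤ 2 ^ n
  · -- the optimal weight in the hybrid argument
    set lam := Real.sqrt ((B + 1 : ℝ) / 2 ^ n) with hlam
    have hl : 0 < lam := Real.sqrt_pos.2 (by positivity)
    have hl2 : lam ^ 2 = (B + 1 : ℝ) / 2 ^ n := Real.sq_sqrt (by positivity)
    have hBr : (2 * B : ℝ) ≤ 2 ^ n := by exact_mod_cast hB
    have h2n : (2 : ℝ) ≤ 2 ^ n := by
      have : (2 : ℝ) ^ 1 ≤ 2 ^ n := pow_le_pow_right₀ (by norm_num) hn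
      linarith
    have hl1 : lam ≤ 1 := by
      rw [hlam, Real.sqrt_le_one, div_le_one (by positivity)]
      linarith
    have hBl : (B : ℝ) / 2 ^ n ≤ lam ^ 2 := by
      rw [hl2]; gcongr; linarith
    have h1 : (1 + 1 / lam) * (8 * B / 2 ^ n) ≤ 16 * lam := by
      have e1 : 1 + 1 / lam ≤ 2 / lam := by
        rw [le_div_iff₀ hl, add_mul, one_div_mul_cancel hl.ne']
        linarith
      have e2 : 8 * B / 2 ^ n ≤ 8 * lam ^ 2 := by
        rw [mul_div_assoc]; linarith
      calc _ ≤ 2 / lam * (8 * lam ^ 2) := by gcongr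
        _ = 16 * lam := by field_simp; norm_num
    have h2 : (B : ℝ) ^ 2 / (2 * (2 ^ n - 1)) ≤ B * lam := by
      calc (B : ℝ) ^ 2 / (2 * (2 ^ n - 1)) ≤ (B : ℝ) ^ 2 / (2 : ℝ) ^ n := by
            gcongr; linarith
        _ = B * ((B : ℝ) / 2 ^ n) := by ring
        _ ≤ B * lam ^ 2 := by gcongr
        _ ≤ B * lam := by
            gcongr
            nlinarith
    have h3 := successProb_le (d := d) hn hB (P n) lam hl
    have h4 : (17 * d + B) * lam ≤
        Real.sqrt ((((17 * d + B) ^ 2 * (B + 1) + B : ℕ) : ℝ) / 2 ^ n) := by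
      refine Real.le_sqrt_of_sq_le ?_
      rw [mul_pow, hl2, ← mul_div_assoc]
      push_cast
      gcongr
      linarith [Nat.cast_nonneg (α := ℝ) B]
    have h5 : d * (lam + (1 + 1 / lam) * (8 * B / 2 ^ n)) ≤ 17 * d * lam := by
      calc _ ≤ d * (lam + 16 * lam) := by gcongr
        _ = _ := by ring
    linarith
  · have h1 := successProb_le_one d n d B (P n)
    have h2 : (1 / 2 : ℝ) ≤
        Real.sqrt ((((17 * d + B) ^ 2 * (B + 1) + B : ℕ) : ℝ) / 2 ^ n) := by
      refine Real.le_sqrt_of_sq_le ?_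
      rw [le_div_iff₀ (by positivity)]
      have h3 : (2 : ℝ) ^ n ≤ 2 * B := by exact_mod_cast (not_le.1 hB).le
      have h4 : (B : ℝ) ≤ ((17 * d + B) ^ 2 * (B + 1) + B : ℕ) := by
        exact_mod_cast Nat.le_add_left _ _
      nlinarith [Nat.cast_nonneg (α := ℝ) B]
    linarith

/-! ### A small structured language for the classical machine -/

section Machine

variable {a b : ℕ}

section RunLemmas

variable (O : Bits a → Bits b) (D w : ℕ) (v : Bool) (t : ℕ) (k : List Cmd) (m : ℕ → ℕ)
  (L : Layer a b) (f : ℕ) (out : ℕ → Bool) (ψ : State w)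

theorem run_const (x i : ℕ) : run O D w v (t + 1) ⟨.const x i :: k, m, L, f, out⟩ ψ =
    run O D w v t ⟨k, Function.update m x i, L, f, out⟩ ψ := rfl

theorem run_add (x y z : ℕ) : run O D w v (t + 1) ⟨.add x y z :: k, m, L, f, out⟩ ψ =
    run O D w v t ⟨k, Function.update m x (m y + m z), L, f, out⟩ ψ := rfl

theorem run_store (x y : ℕ) : run O D w v (t + 1) ⟨.store x y :: k, m, L, f, out⟩ ψ =
    run O D w v t ⟨k, Function.update m (m x) (m y), L, f, out⟩ ψ := rfl

theorem run_seq (c₁ c₂ : Cmd) : run O D w v (t + 1) ⟨.seq c₁ c₂ :: k, m, L, f, out⟩ ψ =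
    run O D w v t ⟨c₁ :: c₂ :: k, m, L, f, out⟩ ψ := rfl

theorem run_branch (x : ℕ) (c₁ c₂ : Cmd) :
    run O D w v (t + 1) ⟨.branch x c₁ c₂ :: k, m, L, f, out⟩ ψ =
    run O D w v t ⟨(if m x ≠ 0 then c₁ else c₂) :: k, m, L, f, out⟩ ψ := rfl

theorem run_loop (x : ℕ) (c : Cmd) : run O D w v (t + 1) ⟨.loop x c :: k, m, L, f, out⟩ ψ =
    run O D w v t ⟨if m x ≠ 0 then c :: .loop x c :: k else k, m, L, f, out⟩ ψ := rfl

theorem run_gate1 (U : Matrix.unitaryGroup Bool ℂ) (x : ℕ) :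
    run O D w v (t + 1) ⟨.gate1 U x :: k, m, L, f, out⟩ ψ =
    run O D w v t ⟨k, m, { L with gates := Gate.one U (m x) :: L.gates }, f, out⟩ ψ := rfl

theorem run_query (x : ℕ) : run O D w v (t + 1) ⟨.query x :: k, m, L, f, out⟩ ψ =
    run O D w v t ⟨k, m, { L with queries :=
      ⟨fun j => m (m x + j.val), fun j => m (m x + a + j.val)⟩ :: L.queries }, f, out⟩ ψ := rfl

theorem run_measure (x : ℕ) : run O D w v (t + 1) ⟨.measure x :: k, m, L, f, out⟩ ψ =
    run O D w v t ⟨k, m, { L with measured := m x :: L.measured }, f, out⟩ ψ := rfl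

open Classical in
theorem run_fire : run O D w v (t + 1) ⟨.fire :: k, m, L, f, out⟩ ψ =
    if L.Valid w ∧ (f < D ∨ (f = D ∧ L.queries = [])) then
      ∑ z : Bits w, if ∀ i : Fin w, i.val ∉ L.measured → z i = false then
        run O D w v t ⟨k, m, Layer.empty a b, f + 1, getBit z⟩
          (project L.measured z (L.apply O ψ))
      else 0
    else 0 := rfl

theorem run_nonneg (c : Config a b) : 0 ≤ run O D w v t c ψ := by
  rw [run_eq_eval]; exact Tree.eval_nonneg _ _ _ _

end RunLemmas

theorem run_le_succ (O : Bits a → Bits b) (D w : ℕ) (v : Bool) (t : ℕ) (c : Config a b)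
    (ψ : State w) : run O D w v t c ψ ≤ run O D w v (t + 1) c ψ := by
  induction t generalizing c ψ with
  | zero => exact run_nonneg O D w v 1 ψ c
  | succ t ih =>
    obtain ⟨code, m, L, f, out⟩ := c
    cases code with
    | nil => exact le_rfl
    | cons cmd k =>
      cases cmd with
      | flip x =>
        exact div_le_div_of_nonneg_right (add_le_add (ih _ ψ) (ih _ ψ)) (by norm_num)
      | fire =>
        rw [run_fire, run_fire]
        split_ifs
        · refine Finset.sum_le_sum fun z _ => ?_
          split_ifs
          exacts [ih _ _, le_rfl]
        · exact le_rfl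
      | _ => exact ih _ ψ

theorem run_mono (O : Bits a → Bits b) (D w : ℕ) (v : Bool) {t t' : ℕ} (h : t ≤ t')
    (c : Config a b) (ψ : State w) : run O D w v t c ψ ≤ run O D w v t' c ψ := by
  induction h with
  | refl => exact le_rfl
  | step _ ih => exact ih.trans (run_le_succ O D w v _ c ψ)

/-- The command `c`, started with memory and layer description `s`, reaches `s'` in at most `T`
steps. -/
def Steps (out : ℕ → Bool) (c : Cmd) (T : ℕ) (s s' : (ℕ → ℕ) × Layer a b) : Prop :=
  ∀ (O : Bits a → Bits b) (D w : ℕ) (v : Bool) (k : List Cmd) (t f : ℕ) (ψ : State w),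
    run O D w v t ⟨k, s'.1, s'.2, f, out⟩ ψ ≤ run O D w v (t + T) ⟨c :: k, s.1, s.2, f, out⟩ ψ

theorem Steps.seq {out : ℕ → Bool} {c₁ c₂ : Cmd} {T₁ T₂ : ℕ} {s s' s'' : (ℕ → ℕ) × Layer a b}
    (h₁ : Steps out c₁ T₁ s s') (h₂ : Steps out c₂ T₂ s' s'') :
    Steps out (.seq c₁ c₂) (T₁ + T₂ + 1) s s'' := by
  intro O D w v k t f ψ
  refine (h₂ O D w v k t f ψ).trans ((h₁ O D w v (c₂ :: k) (t + T₂) f ψ).trans ?_)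
  rw [show t + (T₁ + T₂ + 1) = t + T₂ + T₁ + 1 by ring, run_seq]

/-- Arithmetic expressions; `cell e` is the content of the array cell `e`. -/
inductive Expr : Type
  | const (k : ℕ)
  | var (x : ℕ)
  | add (e₁ e₂ : Expr)
  | sub (e₁ e₂ : Expr)
  | cell (e : Expr)

/-- Arrays start at address `64`. -/
def Expr.eval (σ : ℕ → ℕ) : Expr → ℕ
  | .const k => k
  | .var x => σ x
  | .add e₁ e₂ => e₁.eval σ + e₂.eval σ
  | .sub e₁ e₂ => e₁.eval σ - e₂.eval σ
  | .cell e => σ (64 + e.eval σ)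

/-- The code that writes the value of an expression to the auxiliary cell `t`. -/
def Expr.code : Expr → ℕ → Cmd
  | .const k, t => .const t k
  | .var x, t => .seq (.const t 0) (.add t x t)
  | .add e₁ e₂, t => .seq (e₁.code t) (.seq (e₂.code (t + 1)) (.add t t (t + 1)))
  | .sub e₁ e₂, t => .seq (e₁.code t) (.seq (e₂.code (t + 1)) (.sub t t (t + 1)))
  | .cell e, t => .seq (e.code t) (.seq (.const (t + 1) 64) (.seq (.add t t (t + 1)) (.load t t)))

/-- A bound for the running time of `Expr.code`. -/
def Expr.cost : Expr → ℕ
  | .const _ => 1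
  | .var _ => 3
  | .add e₁ e₂ => e₁.cost + e₂.cost + 3
  | .sub e₁ e₂ => e₁.cost + e₂.cost + 3
  | .cell e => e.cost + 6

/-- The expression uses variables below `32` and at most `r` auxiliary cells. -/
def Expr.Fits : Expr → ℕ → Prop
  | .const _, r => 1 ≤ r
  | .var x, r => x < 32 ∧ 1 ≤ r
  | .add e₁ e₂, r => e₁.Fits r ∧ e₂.Fits (r - 1)
  | .sub e₁ e₂, r => e₁.Fits r ∧ e₂.Fits (r - 1)
  | .cell e, r => e.Fits r ∧ 2 ≤ r

/-- Equality of memories outside of the auxiliary cells `32, …, 63`. -/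
def Agree (m σ : ℕ → ℕ) : Prop := ∀ x, x < 32 ∨ 64 ≤ x → m x = σ x

theorem Agree.update_aux {m σ : ℕ → ℕ} (h : Agree m σ) {x : ℕ} (hx : 32 ≤ x) (hx' : x < 64)
    (v : ℕ) : Agree (Function.update m x v) σ := by
  intro y hy
  rw [Function.update_of_ne (by omega)]
  exact h y hy

theorem Agree.update {m σ : ℕ → ℕ} (h : Agree m σ) (x v : ℕ) :
    Agree (Function.update m x v) (Function.update σ x v) := by
  intro y hy
  by_cases hxy : y = x
  · subst hxy; simp
  · rw [Function.update_of_ne hxy, Function.update_of_ne hxy]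
    exact h y hy

theorem Expr.Fits.pos {e : Expr} {r : ℕ} (h : e.Fits r) : 1 ≤ r := by
  induction e generalizing r with
  | const k => exact h
  | var x => exact h.2
  | add e₁ e₂ ih₁ ih₂ => exact ih₁ h.1
  | sub e₁ e₂ ih₁ ih₂ => exact ih₁ h.1
  | cell e ih => exact ih h.1

theorem Expr.code_correct (out : ℕ → Bool) (L : Layer a b) (e : Expr) (t : ℕ) (ht : 32 ≤ t)
    (ht' : t < 64) (he : e.Fits (64 - t)) (m σ : ℕ → ℕ) (hm : Agree m σ) :
    ∃ m', Agree m' σ ∧ (∀ x, x < t → m' x = m x) ∧ m' t = e.eval σ ∧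
      Steps out (e.code t) e.cost (m, L) (m', L) := by
  induction e generalizing t m with
  | const k =>
    refine ⟨Function.update m t k, hm.update_aux ht ht' k, fun x hx => ?_, by simp [eval], ?_⟩
    · rw [Function.update_of_ne (by omega)]
    · intro O D w v k t f ψ; exact le_rfl
  | var x =>
    have hx : x < 32 := he.1
    refine ⟨Function.update (Function.update m t 0) t (m x), ?_, fun y hy => ?_, ?_, ?_⟩
    · exact (hm.update_aux ht ht' 0).update_aux ht ht' _
    · rw [Function.update_of_ne (by omega), Function.update_of_ne (by omega)]
    · simp [eval, hm x (Or.inl hx)]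
    · intro O D w v k s f ψ
      change _ ≤ run O D w v (s + 2 + 1) _ ψ
      rw [Expr.code, run_seq, run_const, run_add]
      simp [Function.update_of_ne (show x ≠ t by omega)]
  | add e₁ e₂ ih₁ ih₂ =>
    have hp := he.2.pos
    obtain ⟨m₁, ha₁, hl₁, hv₁, hs₁⟩ := ih₁ t ht ht' he.1 m hm
    obtain ⟨m₂, ha₂, hl₂, hv₂, hs₂⟩ := ih₂ (t + 1) (by omega) (by omega)
      (by rw [show 64 - (t + 1) = 64 - t - 1 by omega]; exact he.2) m₁ ha₁
    refine ⟨Function.update m₂ t (m₂ t + m₂ (t + 1)), ha₂.update_aux ht ht' _, fun x hx => ?_,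
      ?_, ?_⟩
    · rw [Function.update_of_ne (by omega), hl₂ x (by omega), hl₁ x hx]
    · simp [eval, hl₂ t (by omega), hv₁, hv₂]
    · have h3 : Steps out (.add t t (t + 1)) 1 (m₂, L)
          (Function.update m₂ t (m₂ t + m₂ (t + 1)), L) := fun O D w v k s f ψ => le_rfl
      have := hs₁.seq (hs₂.seq h3)
      rw [show e₁.cost + (e₂.cost + 1 + 1) + 1 = (add e₁ e₂).cost by simp only [cost]; ring]
        at this
      exact this
  | sub e₁ e₂ ih₁ ih₂ =>
    have hp := he.2.pos
    obtain ⟨m₁, ha₁, hl₁, hv₁, hs₁⟩ := ih₁ t ht ht' he.1 m hm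
    obtain ⟨m₂, ha₂, hl₂, hv₂, hs₂⟩ := ih₂ (t + 1) (by omega) (by omega)
      (by rw [show 64 - (t + 1) = 64 - t - 1 by omega]; exact he.2) m₁ ha₁
    refine ⟨Function.update m₂ t (m₂ t - m₂ (t + 1)), ha₂.update_aux ht ht' _, fun x hx => ?_,
      ?_, ?_⟩
    · rw [Function.update_of_ne (by omega), hl₂ x (by omega), hl₁ x hx]
    · simp [eval, hl₂ t (by omega), hv₁, hv₂]
    · have h3 : Steps out (.sub t t (t + 1)) 1 (m₂, L)
          (Function.update m₂ t (m₂ t - m₂ (t + 1)), L) := fun O D w v k s f ψ => le_rfl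
      have := hs₁.seq (hs₂.seq h3)
      rw [show e₁.cost + (e₂.cost + 1 + 1) + 1 = (sub e₁ e₂).cost by simp only [cost]; ring]
        at this
      exact this
  | cell e ih =>
    have h2 := he.2
    obtain ⟨m₁, ha₁, hl₁, hv₁, hs₁⟩ := ih t ht ht' he.1 m hm
    set m₂ := Function.update m₁ (t + 1) 64
    set m₃ := Function.update m₂ t (m₂ t + m₂ (t + 1))
    have e3 : m₃ t = 64 + e.eval σ := by simp [m₃, m₂, hv₁, add_comm]
    have ha₂ : Agree m₂ σ := ha₁.update_aux (by omega) (by omega) _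
    have ha₃ : Agree m₃ σ := ha₂.update_aux ht ht' _
    refine ⟨Function.update m₃ t (m₃ (m₃ t)), ha₃.update_aux ht ht' _, fun x hx => ?_, ?_, ?_⟩
    · simp only [m₃, m₂]
      rw [Function.update_of_ne (by omega), Function.update_of_ne (by omega),
        Function.update_of_ne (by omega), hl₁ x hx]
    · rw [Function.update_self, e3, eval]
      exact ha₃ _ (Or.inr (by omega))
    · have h3 : Steps out (.const (t + 1) 64) 1 (m₁, L) (m₂, L) := fun O D w v k s f ψ => le_rfl
      have h4 : Steps out (.add t t (t + 1)) 1 (m₂, L) (m₃, L) := fun O D w v k s f ψ => le_rfl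
      have h5 : Steps out (.load t t) 1 (m₃, L) (Function.update m₃ t (m₃ (m₃ t)), L) :=
        fun O D w v k s f ψ => le_rfl
      have := hs₁.seq (h3.seq (h4.seq h5))
      rw [show e.cost + (1 + (1 + 1 + 1) + 1) + 1 = (cell e).cost by simp only [cost]] at this
      exact this

/-- As `Steps`, with the auxiliary cells left unspecified. The running times in the rules below are
sums of the costs of the parts; only their polynomial growth matters. -/
def Exec (out : ℕ → Bool) (c : Cmd) (T : ℕ) (s s' : (ℕ → ℕ) × Layer a b) : Prop :=
  ∀ m, Agree m s.1 → ∃ m', Agree m' s'.1 ∧ Steps out c T (m, s.2) (m', s'.2)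

theorem Exec.seq {out : ℕ → Bool} {c₁ c₂ : Cmd} {T₁ T₂ : ℕ} {s s' s'' : (ℕ → ℕ) × Layer a b}
    (h₁ : Exec out c₁ T₁ s s') (h₂ : Exec out c₂ T₂ s' s'') :
    Exec out (.seq c₁ c₂) (T₁ + T₂ + 1) s s'' := by
  intro m hm
  obtain ⟨m₁, ha₁, hs₁⟩ := h₁ m hm
  obtain ⟨m₂, ha₂, hs₂⟩ := h₂ m₁ ha₁
  exact ⟨m₂, ha₂, hs₁.seq hs₂⟩

theorem Exec.mono {out : ℕ → Bool} {c : Cmd} {T T' : ℕ} {s s' : (ℕ → ℕ) × Layer a b}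
    (h : Exec out c T s s') (hT : T ≤ T') : Exec out c T' s s' := by
  intro m hm
  obtain ⟨m', ha, hs⟩ := h m hm
  exact ⟨m', ha, fun O D w v k t f ψ => (hs O D w v k t f ψ).trans
    (run_mono O D w v (by omega) _ ψ)⟩

theorem Exec.skip (out : ℕ → Bool) (s : (ℕ → ℕ) × Layer a b) : Exec out .skip 1 s s :=
  fun m hm => ⟨m, hm, fun _ _ _ _ _ _ _ _ => le_rfl⟩

/-- `x := e` -/
def assign (x : ℕ) (e : Expr) : Cmd := .seq (e.code 32) (.seq (.const 33 0) (.add x 32 33))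

theorem Exec.assign (out : ℕ → Bool) (s : (ℕ → ℕ) × Layer a b) (x : ℕ) (e : Expr)
    (he : e.Fits 32) :
    Exec out (assign x e) (e.cost + 4) s (Function.update s.1 x (e.eval s.1), s.2) := by
  intro m hm
  obtain ⟨m₁, ha₁, -, hv₁, hs₁⟩ := e.code_correct out s.2 32 le_rfl (by omega) he m s.1 hm
  refine ⟨Function.update (Function.update m₁ 33 0) x (e.eval s.1),
    (ha₁.update_aux (by omega) (by omega) 0).update x _, ?_⟩
  have h2 : Steps out (.const 33 0) 1 (m₁, s.2) (Function.update m₁ 33 0, s.2) :=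
    fun O D w v k t f ψ => le_rfl
  have h3 : Steps out (.add x 32 33) 1 (Function.update m₁ 33 0, s.2)
      (Function.update (Function.update m₁ 33 0) x (e.eval s.1), s.2) := by
    intro O D w v k t f ψ
    rw [run_add]
    simp [hv₁]
  exact hs₁.seq (h2.seq h3)

/-- Writes the value of `e₂` to the array cell `e₁`. -/
def storeAt (e₁ e₂ : Expr) : Cmd :=
  .seq (e₁.code 32) (.seq (e₂.code 33) (.seq (.const 34 64) (.seq (.add 32 32 34) (.store 32 33))))

theorem Exec.storeAt (out : ℕ → Bool) (s : (ℕ → ℕ) × Layer a b) (e₁ e₂ : Expr)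
    (he₁ : e₁.Fits 32) (he₂ : e₂.Fits 31) :
    Exec out (storeAt e₁ e₂) (e₁.cost + e₂.cost + 7) s
      (Function.update s.1 (64 + e₁.eval s.1) (e₂.eval s.1), s.2) := by
  intro m hm
  obtain ⟨m₁, ha₁, -, hv₁, hs₁⟩ := e₁.code_correct out s.2 32 le_rfl (by omega) he₁ m s.1 hm
  obtain ⟨m₂, ha₂, hl₂, hv₂, hs₂⟩ := e₂.code_correct out s.2 33 (by omega) (by omega) he₂ m₁ s.1 ha₁
  have h3 : Steps out (.const 34 64) 1 (m₂, s.2) (Function.update m₂ 34 64, s.2) :=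
    fun O D w v k t f ψ => le_rfl
  set m₃ := Function.update m₂ 34 64
  have h4 : Steps out (.add 32 32 34) 1 (m₃, s.2)
      (Function.update m₃ 32 (m₃ 32 + m₃ 34), s.2) := fun O D w v k t f ψ => le_rfl
  set m₄ := Function.update m₃ 32 (m₃ 32 + m₃ 34)
  have e4 : m₄ 32 = 64 + e₁.eval s.1 := by
    simp [m₄, m₃, hl₂ 32 (by omega), hv₁, add_comm]
  have e5 : m₄ 33 = e₂.eval s.1 := by simp [m₄, m₃, hv₂]
  have ha₄ : Agree m₄ s.1 :=
    (ha₂.update_aux (by omega) (by omega) _).update_aux (by omega) (by omega) _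
  have h5 : Steps out (.store 32 33) 1 (m₄, s.2)
      (Function.update m₄ (64 + e₁.eval s.1) (e₂.eval s.1), s.2) := by
    intro O D w v k t f ψ
    simp only [run_store, e4, e5, le_refl]
  refine ⟨_, ha₄.update _ _, ?_⟩
  have := hs₁.seq (hs₂.seq (h3.seq (h4.seq h5)))
  rw [show e₁.cost + (e₂.cost + (1 + (1 + 1 + 1) + 1) + 1) + 1 = e₁.cost + e₂.cost + 7 by ring]
    at this
  exact this

/-- Writes the last outcome of the measurement of qubit `e₂` to the array cell `e₁`. -/
def readTo (e₁ e₂ : Expr) : Cmd :=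
  .seq (e₁.code 32) (.seq (e₂.code 33) (.seq (.read 33 33) (.seq (.const 34 64)
    (.seq (.add 32 32 34) (.store 32 33)))))

theorem Exec.readTo (out : ℕ → Bool) (s : (ℕ → ℕ) × Layer a b) (e₁ e₂ : Expr)
    (he₁ : e₁.Fits 32) (he₂ : e₂.Fits 31) :
    Exec out (readTo e₁ e₂) (e₁.cost + e₂.cost + 9) s
      (Function.update s.1 (64 + e₁.eval s.1) (out (e₂.eval s.1)).toNat, s.2) := by
  intro m hm
  obtain ⟨m₁, ha₁, -, hv₁, hs₁⟩ := e₁.code_correct out s.2 32 le_rfl (by omega) he₁ m s.1 hm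
  obtain ⟨m₂, ha₂, hl₂, hv₂, hs₂⟩ := e₂.code_correct out s.2 33 (by omega) (by omega) he₂ m₁ s.1 ha₁
  have h2 : Steps out (.read 33 33) 1 (m₂, s.2)
      (Function.update m₂ 33 (out (m₂ 33)).toNat, s.2) := fun O D w v k t f ψ => le_rfl
  set m₂' := Function.update m₂ 33 (out (m₂ 33)).toNat
  have h3 : Steps out (.const 34 64) 1 (m₂', s.2) (Function.update m₂' 34 64, s.2) :=
    fun O D w v k t f ψ => le_rfl
  set m₃ := Function.update m₂' 34 64
  have h4 : Steps out (.add 32 32 34) 1 (m₃, s.2)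
      (Function.update m₃ 32 (m₃ 32 + m₃ 34), s.2) := fun O D w v k t f ψ => le_rfl
  set m₄ := Function.update m₃ 32 (m₃ 32 + m₃ 34)
  have e4 : m₄ 32 = 64 + e₁.eval s.1 := by
    simp [m₄, m₃, m₂', hl₂ 32 (by omega), hv₁, add_comm]
  have e5 : m₄ 33 = (out (e₂.eval s.1)).toNat := by simp [m₄, m₃, m₂', hv₂]
  have ha₄ : Agree m₄ s.1 :=
    ((ha₂.update_aux (by omega) (by omega) _).update_aux (by omega) (by omega) _).update_aux
      (by omega) (by omega) _
  have h5 : Steps out (.store 32 33) 1 (m₄, s.2)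
      (Function.update m₄ (64 + e₁.eval s.1) (out (e₂.eval s.1)).toNat, s.2) := by
    intro O D w v k t f ψ
    simp only [run_store, e4, e5, le_refl]
  refine ⟨_, ha₄.update _ _, ?_⟩
  have := hs₁.seq (hs₂.seq (h2.seq (h3.seq (h4.seq h5))))
  rw [show e₁.cost + (e₂.cost + (1 + (1 + (1 + 1 + 1) + 1) + 1) + 1) + 1
    = e₁.cost + e₂.cost + 9 by ring] at this
  exact this

/-- Adds a one-qubit gate on the qubit `e` to the layer. -/
def gateOn (U : Matrix.unitaryGroup Bool ℂ) (e : Expr) : Cmd := .seq (e.code 32) (.gate1 U 32)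

theorem Exec.gateOn (out : ℕ → Bool) (s : (ℕ → ℕ) × Layer a b) (U : Matrix.unitaryGroup Bool ℂ)
    (e : Expr) (he : e.Fits 32) :
    Exec out (gateOn U e) (e.cost + 2) s
      (s.1, { s.2 with gates := Gate.one U (e.eval s.1) :: s.2.gates }) := by
  intro m hm
  obtain ⟨m₁, ha₁, -, hv₁, hs₁⟩ := e.code_correct out s.2 32 le_rfl (by omega) he m s.1 hm
  refine ⟨m₁, ha₁, hs₁.seq (T₂ := 1) ?_⟩
  intro O D w v k t f ψ
  simp only [run_gate1, hv₁, le_refl]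

/-- Adds the measurement of the qubit `e` to the layer. -/
def measureOn (e : Expr) : Cmd := .seq (e.code 32) (.measure 32)

theorem Exec.measureOn (out : ℕ → Bool) (s : (ℕ → ℕ) × Layer a b) (e : Expr) (he : e.Fits 32) :
    Exec out (measureOn e) (e.cost + 2) s
      (s.1, { s.2 with measured := e.eval s.1 :: s.2.measured }) := by
  intro m hm
  obtain ⟨m₁, ha₁, -, hv₁, hs₁⟩ := e.code_correct out s.2 32 le_rfl (by omega) he m s.1 hm
  refine ⟨m₁, ha₁, hs₁.seq (T₂ := 1) ?_⟩
  intro O D w v k t f ψ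
  simp only [run_measure, hv₁, le_refl]

/-- Adds an oracle gate to the layer, whose qubits are listed in the array from its start on. -/
def queryTable : Cmd := .seq (.const 32 64) (.query 32)

theorem Exec.queryTable (out : ℕ → Bool) (s : (ℕ → ℕ) × Layer a b) :
    Exec out queryTable 3 s (s.1, { s.2 with queries :=
      ⟨fun j => s.1 (64 + j.val), fun j => s.1 (64 + a + j.val)⟩ :: s.2.queries }) := by
  intro m hm
  refine ⟨Function.update m 32 64, hm.update_aux le_rfl (by omega) _, ?_⟩
  have h1 : Steps out (.const 32 64) 1 (m, s.2) (Function.update m 32 64, s.2) :=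
    fun O D w v k t f ψ => le_rfl
  refine h1.seq (T₂ := 1) ?_
  intro O D w v k t f ψ
  have h2 : ∀ y, 64 ≤ y → Function.update m 32 64 y = s.1 y := fun y hy => by
    rw [Function.update_of_ne (by omega)]
    exact hm y (Or.inr hy)
  have h3 : ∀ j, Function.update m 32 64 (64 + j) = s.1 (64 + j) := fun j => h2 _ (by omega)
  have h4 : ∀ j, Function.update m 32 64 (64 + a + j) = s.1 (64 + a + j) :=
    fun j => h2 _ (by omega)
  simp only [run_query, Function.update_self, h3, h4, le_refl]

/-- Branching on whether `e` is nonzero. -/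
def ifNonzero (e : Expr) (c₁ c₂ : Cmd) : Cmd := .seq (e.code 32) (.branch 32 c₁ c₂)

theorem Exec.ifNonzero (out : ℕ → Bool) (s s' : (ℕ → ℕ) × Layer a b) (e : Expr) (he : e.Fits 32)
    (c₁ c₂ : Cmd) (T : ℕ) (h : Exec out (if e.eval s.1 ≠ 0 then c₁ else c₂) T s s') :
    Exec out (ifNonzero e c₁ c₂) (e.cost + T + 2) s s' := by
  intro m hm
  obtain ⟨m₁, ha₁, -, hv₁, hs₁⟩ := e.code_correct out s.2 32 le_rfl (by omega) he m s.1 hm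
  obtain ⟨m', ha', hs'⟩ := h m₁ ha₁
  refine ⟨m', ha', ?_⟩
  rw [show e.cost + T + 2 = e.cost + (T + 1) + 1 by ring]
  refine hs₁.seq ?_
  intro O D w v k t f ψ
  simp only [← add_assoc, run_branch, hv₁]
  exact hs' O D w v k t f ψ

/-- `for x = 0, …, e - 1`, with the remaining number of rounds in the variable `y`. -/
def forLoop (x y : ℕ) (e : Expr) (c : Cmd) : Cmd :=
  .seq (assign y e) (.seq (assign x (.const 0))
    (.loop y (.seq c (.seq (assign x (.add (.var x) (.const 1)))
      (assign y (.sub (.var y) (.const 1)))))))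

/-- The rule for loops: an invariant `I` that does not depend on the two loop variables. -/
theorem Exec.forLoop (out : ℕ → Bool) (I : ℕ → (ℕ → ℕ) × Layer a b → Prop) (x y : ℕ) (hx : x < 32)
    (hy : y < 32) (hxy : x ≠ y) (e : Expr) (he : e.Fits 32) (c : Cmd) (T N : ℕ)
    (s : (ℕ → ℕ) × Layer a b) (hN : e.eval s.1 = N)
    (hI : ∀ i s u v, I i s → I i (Function.update (Function.update s.1 x u) y v, s.2))
    (h0 : I 0 s)
    (hstep : ∀ i < N, ∀ s, I i s → s.1 x = i → ∃ s', Exec out c T s s' ∧ I (i + 1) s' ∧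
      s'.1 x = i ∧ s'.1 y = s.1 y) :
    ∃ s', Exec out (QCS.forLoop x y e c) (e.cost + 13 + N * (T + 26)) s s' ∧ I N s' ∧
      s'.1 x = N := by
  have hIx : ∀ i s u, I i s → I i (Function.update s.1 x u, s.2) := fun i s u h => by
    have := hI i s u (Function.update s.1 x u y) h
    rwa [Function.update_eq_self] at this
  have hIy : ∀ i s v, I i s → I i (Function.update s.1 y v, s.2) := fun i s v h => by
    have := hI i s (s.1 x) v h
    rwa [Function.update_eq_self] at this
  set body := Cmd.seq c (.seq (QCS.assign x (.add (.var x) (.const 1)))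
      (QCS.assign y (.sub (.var y) (.const 1)))) with hbody
  have hloop : ∀ j i, i + j = N → ∀ s, I i s → s.1 x = i → s.1 y = j →
      ∃ s', Exec out (.loop y body) (1 + j * (T + 26)) s s' ∧ I N s' ∧ s'.1 x = N := by
    intro j
    induction j with
    | zero =>
      intro i hi s hs hsx hsy
      obtain rfl : i = N := by omega
      refine ⟨s, fun m hm => ⟨m, hm, ?_⟩, hs, hsx⟩
      intro O D w v k t f ψ
      have h0 : m y = 0 := (hm y (Or.inl hy)).trans hsy
      rw [zero_mul, add_zero, run_loop]
      simp [h0]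
    | succ j ih =>
      intro i hi s hs hsx hsy
      obtain ⟨s₁, hex, hI₁, hx₁, hy₁⟩ := hstep i (by omega) s hs hsx
      have h2 := Exec.assign out s₁ x (.add (.var x) (.const 1))
        ⟨⟨hx, by omega⟩, by simp [Expr.Fits]⟩
      set s₂ : (ℕ → ℕ) × Layer a b :=
        (Function.update s₁.1 x ((Expr.add (.var x) (.const 1)).eval s₁.1), s₁.2)
      have h3 := Exec.assign out s₂ y (.sub (.var y) (.const 1))
        ⟨⟨hy, by omega⟩, by simp [Expr.Fits]⟩
      set s₃ : (ℕ → ℕ) × Layer a b :=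
        (Function.update s₂.1 y ((Expr.sub (.var y) (.const 1)).eval s₂.1), s₂.2) with hs₃
      have hI₃ : I (i + 1) s₃ := hIy _ _ _ (hIx _ _ _ hI₁)
      have hx₃ : s₃.1 x = i + 1 := by
        simp [s₃, s₂, Function.update_of_ne hxy, Expr.eval, hx₁]
      have hy₃ : s₃.1 y = j := by
        simp [s₃, s₂, Function.update_of_ne hxy.symm, Expr.eval, hy₁, hsy]
      obtain ⟨s₄, hex₄, hI₄, hx₄⟩ := ih (i + 1) (by omega) s₃ hI₃ hx₃ hy₃
      refine ⟨s₄, ?_, hI₄, hx₄⟩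
      intro m hm
      obtain ⟨m₃, ha₃, hst₃⟩ := (hex.seq (h2.seq h3)) m hm
      obtain ⟨m₄, ha₄, hst₄⟩ := hex₄ m₃ ha₃
      refine ⟨m₄, ha₄, ?_⟩
      intro O D w v k t f ψ
      have hne : m y ≠ 0 := by rw [hm y (Or.inl hy), hsy]; omega
      refine (hst₄ O D w v k t f ψ).trans ((hst₃ O D w v _ _ f ψ).trans ?_)
      simp only [Expr.cost]
      refine le_trans ?_ (run_mono O D w v
        (show t + (1 + j * (T + 26)) + (T + (3 + 1 + 3 + 4 + (3 + 1 + 3 + 4) + 1) + 1) + 1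
          ≤ t + (1 + (j + 1) * (T + 26)) by rw [add_mul]; omega) _ ψ)
      rw [run_loop]
      simp only [ne_eq, hne, not_false_eq_true, if_true]
      exact le_rfl
  have h1 := Exec.assign out s y e he
  set s₁ : (ℕ → ℕ) × Layer a b := (Function.update s.1 y (e.eval s.1), s.2)
  have h2 := Exec.assign out s₁ x (.const 0) (by simp [Expr.Fits])
  set s₂ : (ℕ → ℕ) × Layer a b :=
    (Function.update s₁.1 x ((Expr.const 0).eval s₁.1), s₁.2)
  obtain ⟨s₃, h3, hI₃, hx₃⟩ := hloop N 0 (by omega) s₂ (hIx _ _ _ (hIy _ _ _ h0))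
    (by simp [s₂, Expr.eval]) (by simp [s₂, s₁, Function.update_of_ne hxy.symm, hN])
  refine ⟨s₃, (h1.seq (h2.seq h3)).mono ?_, hI₃, hx₃⟩
  simp only [Expr.cost]
  omega

end Machine

/-! ### The program: layers -/

section Program

/-- Number of qubits of a register for the values of the functions. -/
abbrev regLen (d n : ℕ) : ℕ := bigLen d n + 1

/-- Position of the index registers in the block of qubits of a copy: it starts with `d + 2`
registers for `x`, `f_0(x)`, …, `f_d(…)`. -/
abbrev idxStart (d n : ℕ) : ℕ := (d + 2) * regLen d n

/-- Number of qubits of a copy. -/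
abbrev blockLen (d n : ℕ) : ℕ := idxStart d n + (d + 1) * (d + 1)

/-- Position of the matrix in the array, behind the list of qubits of an oracle gate. -/
abbrev matStart (d n : ℕ) : ℕ := (d + 1) + (regLen d n + regLen d n)

/-- The contents of the variables that do not change after the preparation. Of the others, `5` holds
the start of the block of the current copy, `6, …, 11` the counters of three nested loops, `12` the
position of the current row of the matrix, and `13` the number of missing pivots. -/
structure Layout (d n : ℕ) (σ : ℕ → ℕ) : Prop where
  h1 : σ 1 = n
  h2 : σ 2 = n + n
  h3 : σ 3 = regLen d n
  h4 : σ 4 = blockLen d n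
  h16 : σ 16 = idxStart d n
  h17 : σ 17 = matStart d n
  h18 : σ 18 = bigLen d n

theorem Layout.update {d n : ℕ} {σ : ℕ → ℕ} (h : Layout d n σ) {x : ℕ}
    (hx : (5 ≤ x ∧ x ≤ 15) ∨ 32 ≤ x) (v : ℕ) : Layout d n (Function.update σ x v) := by
  obtain ⟨h1, h2, h3, h4, h16, h17, h18⟩ := h
  constructor <;> rw [Function.update_of_ne (by omega)] <;> assumption

theorem Layout.congr {d n : ℕ} {σ σ' : ℕ → ℕ} (h : Layout d n σ)
    (hσ : ∀ x, x < 32 → x ≠ 8 → x ≠ 9 → σ' x = σ x) : Layout d n σ' := by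
  obtain ⟨h1, h2, h3, h4, h16, h17, h18⟩ := h
  constructor <;> rw [hσ _ (by omega) (by omega) (by omega)] <;> assumption

/-- `r * e` as an iterated sum. -/
def Expr.smul : ℕ → Expr → Expr
  | 0, _ => .const 0
  | r + 1, e => .add (Expr.smul r e) e

theorem Expr.eval_smul (σ : ℕ → ℕ) (r : ℕ) (e : Expr) : (e.smul r).eval σ = r * e.eval σ := by
  induction r with
  | zero => simp [smul, eval]
  | succ r ih => simp only [smul, eval, ih]; ring

theorem Expr.fits_smul (r x R : ℕ) (hx : x < 32) (hR : 2 ≤ R) : ((Expr.var x).smul r).Fits R := by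
  induction r with
  | zero => simp only [smul, Fits]; omega
  | succ r ih => exact ⟨ih, hx, by omega⟩

/-- Computes the sizes from the input. -/
def prepare (d : ℕ) : Cmd :=
  .seq (assign 1 (.var 0)) (.seq (assign 2 (.add (.var 1) (.var 1)))
  (.seq (assign 18 ((Expr.var 1).smul (d + 2))) (.seq (assign 3 (.add (.var 18) (.const 1)))
  (.seq (assign 16 ((Expr.var 3).smul (d + 2)))
  (.seq (assign 4 (.add (.var 16) (.const ((d + 1) * (d + 1)))))
  (assign 17 (.add (.const (d + 1)) (.add (.var 3) (.var 3)))))))))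

theorem exec_prepare (d : ℕ) : ∃ T, ∀ (a b n : ℕ) (out : ℕ → Bool) (L : Layer a b),
    ∃ s', Exec out (prepare d) T (fun x => if x = 0 then n else 0, L) s' ∧
      Layout d n s'.1 ∧ (∀ y, 64 ≤ y → s'.1 y = 0) ∧ s'.2 = L := by
  have hs := fun x (hx : x < 32) => Expr.fits_smul (d + 2) x 32 hx (by norm_num)
  have H := fun (a b n : ℕ) (out : ℕ → Bool) (L : Layer a b) =>
    (Exec.assign out (fun x => if x = 0 then n else 0, L) 1 (.var 0) (by simp [Expr.Fits])).seq
    ((Exec.assign out _ 2 (.add (.var 1) (.var 1)) (by simp [Expr.Fits])).seq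
    ((Exec.assign out _ 18 ((Expr.var 1).smul (d + 2)) (hs _ (by norm_num))).seq
    ((Exec.assign out _ 3 (.add (.var 18) (.const 1)) (by simp [Expr.Fits])).seq
    ((Exec.assign out _ 16 ((Expr.var 3).smul (d + 2)) (hs _ (by norm_num))).seq
    ((Exec.assign out _ 4 (.add (.var 16) (.const ((d + 1) * (d + 1)))) (by simp [Expr.Fits])).seq
    (Exec.assign out _ 17 (.add (.const (d + 1)) (.add (.var 3) (.var 3)))
      (by simp [Expr.Fits])))))))
  refine ⟨_, fun a b n out L => ⟨_, H a b n out L, ?_, fun y hy => ?_, rfl⟩⟩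
  · constructor <;> simp [Expr.eval, Expr.eval_smul]
  · simp only
    repeat rw [Function.update_of_ne (by omega)]
    rw [if_neg (by omega)]

/-- A loop that writes the values `g 0, g 1, …` to the array cells from `dst` on. -/
theorem Exec.table {a b : ℕ} (out : ℕ → Bool) (s : (ℕ → ℕ) × Layer a b) {x y : ℕ} (hx : x < 32)
    (hy : y < 32) (hxy : x ≠ y) (dst e len : Expr) (hd : dst.Fits 32) (he : e.Fits 31)
    (hl : len.Fits 32) (D N : ℕ) (g : ℕ → ℕ)
    (hD : ∀ σ : ℕ → ℕ, (∀ u, u < 32 → u ≠ x → u ≠ y → σ u = s.1 u) → dst.eval σ = D)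
    (hE : ∀ i < N, ∀ σ : ℕ → ℕ, (∀ u, u < 32 → u ≠ x → u ≠ y → σ u = s.1 u) → σ x = i →
      (∀ u, 64 ≤ u → u < 64 + D ∨ 64 + D + i ≤ u → σ u = s.1 u) → e.eval σ = g i)
    (hN : len.eval s.1 = N) :
    ∃ s', Exec out (QCS.forLoop x y len (QCS.storeAt (.add dst (.var x)) e))
        (len.cost + 13 + N * (dst.cost + e.cost + 39)) s s' ∧
      s'.2 = s.2 ∧ (∀ u, u < 32 → u ≠ x → u ≠ y → s'.1 u = s.1 u) ∧
      (∀ i, i < N → s'.1 (64 + (D + i)) = g i) ∧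
      (∀ u, 64 ≤ u → u < 64 + D ∨ 64 + D + N ≤ u → s'.1 u = s.1 u) := by
  have key := Exec.forLoop out
    (fun i s' => s'.2 = s.2 ∧ (∀ u, u < 32 → u ≠ x → u ≠ y → s'.1 u = s.1 u) ∧
      (∀ i', i' < i → s'.1 (64 + (D + i')) = g i') ∧
      (∀ u, 64 ≤ u → u < 64 + D ∨ 64 + D + i ≤ u → s'.1 u = s.1 u))
    x y hx hy hxy len hl (QCS.storeAt (.add dst (.var x)) e) (dst.cost + e.cost + 13) N s hN
    ?_ ?_ ?_
  · obtain ⟨s', h, ⟨h1, h2, h3, h4⟩, -⟩ := key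
    exact ⟨s', h, h1, h2, h3, h4⟩
  · rintro i s' p q ⟨h1, h2, h3, h4⟩
    refine ⟨h1, fun u hu hux huy => ?_, fun i' hi' => ?_, fun u hu hu' => ?_⟩ <;> simp only
    · rw [Function.update_of_ne huy, Function.update_of_ne hux, h2 u hu hux huy]
    · rw [Function.update_of_ne (by omega), Function.update_of_ne (by omega), h3 i' hi']
    · rw [Function.update_of_ne (by omega), Function.update_of_ne (by omega), h4 u hu hu']
  · exact ⟨rfl, fun _ _ _ _ => rfl, by simp, fun _ _ _ => rfl⟩
  · rintro i hi s' ⟨h1, h2, h3, h4⟩ hxi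
    have hpos := hd.pos
    refine ⟨_, (Exec.storeAt out s' (.add dst (.var x)) e ⟨hd, hx, by omega⟩ he).mono ?_,
      ⟨h1, fun u hu hux huy => ?_, fun i' hi' => ?_, fun u hu hu' => ?_⟩, ?_, ?_⟩
    · simp only [Expr.cost]; omega
    all_goals simp only [Expr.eval, hD _ h2, hE i hi _ h2 hxi h4, hxi]
    · rw [Function.update_of_ne (by omega), h2 u hu hux huy]
    · rcases Nat.lt_succ_iff_lt_or_eq.1 hi' with h | h
      · rw [Function.update_of_ne (by omega), h3 i' h]
      · rw [h, Function.update_self]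
    · rw [Function.update_of_ne (by omega), h4 u hu (by omega)]
    · rw [Function.update_of_ne (by omega), hxi]
    · rw [Function.update_of_ne (by omega)]

/-- Writes the numbers from `src` on to the array cells from `dst` on. -/
def fill (dst src len : Expr) : Cmd :=
  forLoop 8 9 len (storeAt (.add dst (.var 8)) (.add src (.var 8)))

theorem exec_fill {a b : ℕ} (out : ℕ → Bool) (s : (ℕ → ℕ) × Layer a b) (dst src len : Expr)
    (hd : dst.Fits 32) (hs : src.Fits 31) (hl : len.Fits 32) (D S N : ℕ)
    (hD : ∀ σ : ℕ → ℕ, (∀ x, x < 32 → x ≠ 8 → x ≠ 9 → σ x = s.1 x) → dst.eval σ = D)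
    (hS : ∀ σ : ℕ → ℕ, (∀ x, x < 32 → x ≠ 8 → x ≠ 9 → σ x = s.1 x) → src.eval σ = S)
    (hN : len.eval s.1 = N) :
    ∃ s', Exec out (fill dst src len) (len.cost + 13 + N * (dst.cost + src.cost + 45)) s s' ∧
      s'.2 = s.2 ∧ (∀ x, x < 32 → x ≠ 8 → x ≠ 9 → s'.1 x = s.1 x) ∧
      (∀ i, i < N → s'.1 (64 + (D + i)) = S + i) ∧
      (∀ y, 64 ≤ y → y < 64 + D ∨ 64 + D + N ≤ y → s'.1 y = s.1 y) :=
  Exec.table out s (by norm_num) (by norm_num) (by norm_num) dst (.add src (.var 8)) len hd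
    ⟨hs, by simp [Expr.Fits]⟩ hl D N (fun i => S + i) hD
    (fun i _ σ h2 hx _ => by simp only [Expr.eval, hS σ h2, hx]) hN

/-- The oracle gate of copy `c` that evaluates `f_j` on register `j` into register `j + 1`. -/
def copyGate (d n j c : ℕ) : OracleGate (inLen d n) (outLen d n) where
  qin t := if t.val < d + 1 then c * blockLen d n + idxStart d n + j * (d + 1) + t.val
    else c * blockLen d n + j * regLen d n + (t.val - (d + 1))
  qout t := c * blockLen d n + (j + 1) * regLen d n + t.val

/-- The oracle gates of the first copies. -/
def copyGates (d n j : ℕ) : ℕ → List (OracleGate (inLen d n) (outLen d n))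
  | 0 => []
  | c + 1 => copyGate d n j c :: copyGates d n j c

/-- Adds the oracle gates for `f_j` of all copies to the layer. The variable `5` holds the start
of the block of the current copy. -/
def queryAll (d j : ℕ) : Cmd :=
  .seq (assign 5 (.const 0)) (forLoop 6 7 (.var 2)
    (.seq (fill (.const 0) (.add (.add (.var 5) (.var 16)) (.const (j * (d + 1))))
      (.const (d + 1)))
    (.seq (fill (.const (d + 1)) (.add (.var 5) ((Expr.var 3).smul j)) (.var 18))
    (.seq (fill (.add (.const (d + 1)) (.var 18)) (.add (.var 5) ((Expr.var 3).smul (j + 1)))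
      (.var 3))
    (.seq queryTable (assign 5 (.add (.var 5) (.var 4))))))))

/-- Functions bounded by a polynomial with natural coefficients. -/
def PolyBounded (T : ℕ → ℕ) : Prop := ∃ p : Polynomial ℕ, ∀ n, T n ≤ p.eval n

theorem PolyBounded.const (k : ℕ) : PolyBounded fun _ => k := ⟨Polynomial.C k, by simp⟩

theorem PolyBounded.id : PolyBounded fun n => n := ⟨Polynomial.X, by simp⟩

theorem PolyBounded.add {f g : ℕ → ℕ} (hf : PolyBounded f) (hg : PolyBounded g) :
    PolyBounded fun n => f n + g n := by
  obtain ⟨p, hp⟩ := hf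
  obtain ⟨q, hq⟩ := hg
  exact ⟨p + q, fun n => by rw [Polynomial.eval_add]; exact Nat.add_le_add (hp n) (hq n)⟩

theorem PolyBounded.mul {f g : ℕ → ℕ} (hf : PolyBounded f) (hg : PolyBounded g) :
    PolyBounded fun n => f n * g n := by
  obtain ⟨p, hp⟩ := hf
  obtain ⟨q, hq⟩ := hg
  exact ⟨p * q, fun n => by rw [Polynomial.eval_mul]; exact Nat.mul_le_mul (hp n) (hq n)⟩

theorem exec_queryAll (d j : ℕ) : ∃ T : ℕ → ℕ, PolyBounded T ∧ ∀ (n : ℕ) (out : ℕ → Bool)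
    (s : (ℕ → ℕ) × Layer (inLen d n) (outLen d n)), Layout d n s.1 →
    ∃ s', Exec out (queryAll d j) (T n) s s' ∧ Layout d n s'.1 ∧
      (∀ y, 64 + matStart d n ≤ y → s'.1 y = s.1 y) ∧
      s'.2 = { s.2 with queries := copyGates d n j (n + n) ++ s.2.queries } := by
  refine ⟨fun n => 1 + 4 + (3 + 13 + (n + n) *
    ((1 + 13 + (d + 1) * (1 + (3 + 3 + 3 + 1 + 3) + 45)) +
    ((3 + 13 + (d + 2) * n * (1 + (3 + ((Expr.var 3).smul j).cost + 3) + 45)) +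
    ((3 + 13 + ((d + 2) * n + 1) * ((1 + 3 + 3) + (3 + ((Expr.var 3).smul (j + 1)).cost + 3) + 45))
     + (3 + (3 + 3 + 3 + 4) + 1) + 1) + 1) + 1 + 26)) + 1, ?_, ?_⟩
  · repeat first
      | exact PolyBounded.const _
      | exact PolyBounded.id
      | apply PolyBounded.add
      | apply PolyBounded.mul
  intro n out s hs
  have hA := Exec.assign out s 5 (.const 0) (by simp [Expr.Fits])
  set s₀ : (ℕ → ℕ) × Layer (inLen d n) (outLen d n) :=
    (Function.update s.1 5 ((Expr.const 0).eval s.1), s.2) with hs₀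
  have key := Exec.forLoop out
    (fun c s' => Layout d n s'.1 ∧ s'.1 5 = c * blockLen d n ∧
      (∀ y, 64 + matStart d n ≤ y → s'.1 y = s.1 y) ∧
      s'.2 = { s.2 with queries := copyGates d n j c ++ s.2.queries })
    6 7 (by norm_num) (by norm_num) (by norm_num) (.var 2) (by simp [Expr.Fits])
    (.seq (fill (.const 0) (.add (.add (.var 5) (.var 16)) (.const (j * (d + 1))))
      (.const (d + 1)))
    (.seq (fill (.const (d + 1)) (.add (.var 5) ((Expr.var 3).smul j)) (.var 18))
    (.seq (fill (.add (.const (d + 1)) (.var 18)) (.add (.var 5) ((Expr.var 3).smul (j + 1)))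
      (.var 3))
    (.seq queryTable (assign 5 (.add (.var 5) (.var 4)))))))
    ((1 + 13 + (d + 1) * (1 + (3 + 3 + 3 + 1 + 3) + 45)) +
    ((3 + 13 + (d + 2) * n * (1 + (3 + ((Expr.var 3).smul j).cost + 3) + 45)) +
    ((3 + 13 + ((d + 2) * n + 1) * ((1 + 3 + 3) + (3 + ((Expr.var 3).smul (j + 1)).cost + 3) + 45))
     + (3 + (3 + 3 + 3 + 4) + 1) + 1) + 1) + 1) (n + n) s₀
    (by simp [s₀, Expr.eval, hs.h2]) ?_ ?_ ?_
  · obtain ⟨s', h, ⟨h1, h2, h3, h4⟩, -⟩ := key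
    exact ⟨s', (hA.seq h).mono le_rfl, h1, h3, h4⟩
  · rintro c s' u v ⟨h1, h2, h3, h4⟩
    refine ⟨(h1.update (by omega) _).update (by omega) _, by simpa using h2, fun y hy => ?_, h4⟩
    simp only
    rw [Function.update_of_ne (by omega), Function.update_of_ne (by omega), h3 y hy]
  · refine ⟨hs.update (by omega) _, by simp [s₀, Expr.eval], fun y hy => ?_,
      by simp [s₀, copyGates]⟩
    simp only [s₀]
    rw [Function.update_of_ne (by omega)]
  · rintro c hc s₁ ⟨h1, h2, h3, h4⟩ hx
    have hsm : ∀ r, ((Expr.var 3).smul r).Fits 30 := fun r =>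
      Expr.fits_smul r 3 30 (by norm_num) (by norm_num)
    obtain ⟨s₂, e₂, l₂, v₂, f₂, u₂⟩ := exec_fill out s₁ (.const 0)
      (.add (.add (.var 5) (.var 16)) (.const (j * (d + 1)))) (.const (d + 1))
      (by simp [Expr.Fits]) (by simp [Expr.Fits]) (by simp [Expr.Fits]) 0
      (c * blockLen d n + idxStart d n + j * (d + 1)) (d + 1) (fun σ hσ => rfl)
      (fun σ hσ => by
        simp only [Expr.eval]
        rw [hσ 5 (by omega) (by omega) (by omega), hσ 16 (by omega) (by omega) (by omega), h2,
          h1.h16]) rfl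
    have L₂ : Layout d n s₂.1 := h1.congr v₂
    have c₂ : s₂.1 5 = c * blockLen d n := (v₂ 5 (by omega) (by omega) (by omega)).trans h2
    obtain ⟨s₃, e₃, l₃, v₃, f₃, u₃⟩ := exec_fill out s₂ (.const (d + 1))
      (.add (.var 5) ((Expr.var 3).smul j)) (.var 18)
      (by simp [Expr.Fits]) ⟨by simp [Expr.Fits], hsm j⟩ (by simp [Expr.Fits]) (d + 1)
      (c * blockLen d n + j * regLen d n) (bigLen d n) (fun σ hσ => rfl)
      (fun σ hσ => by
        simp only [Expr.eval, Expr.eval_smul]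
        rw [hσ 5 (by omega) (by omega) (by omega), hσ 3 (by omega) (by omega) (by omega), c₂,
          L₂.h3]) L₂.h18
    have L₃ : Layout d n s₃.1 := L₂.congr v₃
    have c₃ : s₃.1 5 = c * blockLen d n := (v₃ 5 (by omega) (by omega) (by omega)).trans c₂
    obtain ⟨s₄, e₄, l₄, v₄, f₄, u₄⟩ := exec_fill out s₃ (.add (.const (d + 1)) (.var 18))
      (.add (.var 5) ((Expr.var 3).smul (j + 1))) (.var 3)
      (by simp [Expr.Fits]) ⟨by simp [Expr.Fits], hsm (j + 1)⟩ (by simp [Expr.Fits])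
      (d + 1 + bigLen d n)
      (c * blockLen d n + (j + 1) * regLen d n) (regLen d n)
      (fun σ hσ => by
        simp only [Expr.eval]
        rw [hσ 18 (by omega) (by omega) (by omega), L₃.h18])
      (fun σ hσ => by
        simp only [Expr.eval, Expr.eval_smul]
        rw [hσ 5 (by omega) (by omega) (by omega), hσ 3 (by omega) (by omega) (by omega), c₃,
          L₃.h3]) L₃.h3
    have L₄ : Layout d n s₄.1 := L₃.congr v₄
    have c₄ : s₄.1 5 = c * blockLen d n := (v₄ 5 (by omega) (by omega) (by omega)).trans c₃
    have e₅ := Exec.queryTable out s₄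
    set s₅ : (ℕ → ℕ) × Layer (inLen d n) (outLen d n) := (s₄.1, { s₄.2 with queries :=
      ⟨fun j => s₄.1 (64 + j.val), fun j => s₄.1 (64 + inLen d n + j.val)⟩ :: s₄.2.queries })
      with hs₅
    have e₆ := Exec.assign out s₅ 5 (.add (.var 5) (.var 4)) (by simp [Expr.Fits])
    refine ⟨_, (e₂.seq (e₃.seq (e₄.seq (e₅.seq e₆)))).mono ?_, ⟨?_, ?_, fun y hy => ?_, ?_⟩,
      ?_, ?_⟩
    · exact le_of_eq rfl
    · exact L₄.update (by omega) _
    · simp [Expr.eval, s₅, c₄, L₄.h4]; ring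
    · simp only [s₅]
      have e1 : matStart d n = (d + 1) + ((bigLen d n + 1) + (bigLen d n + 1)) := rfl
      have e2 : regLen d n = bigLen d n + 1 := rfl
      rw [Function.update_of_ne (by omega), u₄ y (by omega) (by omega), u₃ y (by omega) (by omega),
        u₂ y (by omega) (by omega), h3 y hy]
    · simp only [s₅, copyGates, List.cons_append]
      rw [l₄, l₃, l₂, h4]
      congr 2
      simp only [copyGate, OracleGate.mk.injEq]
      refine ⟨funext fun t => ?_, funext fun t => ?_⟩
      · have ht : t.val < (d + 1) + bigLen d n := t.2
        split_ifs with htd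
        · rw [u₄ _ (by omega) (by omega), u₃ _ (by omega) (by omega)]
          have := f₂ t.val htd
          rwa [zero_add] at this
        · rw [u₄ _ (by omega) (by omega)]
          have := f₃ (t.val - (d + 1)) (by omega)
          rwa [show d + 1 + (t.val - (d + 1)) = t.val by omega] at this
      · have := f₄ t.val t.2
        rwa [show 64 + (d + 1 + bigLen d n + t.val) = 64 + inLen d n + t.val by
          simp only [inLen]; ring] at this
    · simp only [s₅]
      rw [Function.update_of_ne (by omega), v₄ 6 (by omega) (by omega) (by omega),
        v₃ 6 (by omega) (by omega) (by omega), v₂ 6 (by omega) (by omega) (by omega), hx]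
    · simp only [s₅]
      rw [Function.update_of_ne (by omega), v₄ 7 (by omega) (by omega) (by omega),
        v₃ 7 (by omega) (by omega) (by omega), v₂ 7 (by omega) (by omega) (by omega)]

end Program

/-! ### The oracle layers of the program on basis labels -/

section Labels

variable {d n : ℕ}

theorem mem_copyGates {j C : ℕ} {g : OracleGate (inLen d n) (outLen d n)} :
    g ∈ copyGates d n j C ↔ ∃ c < C, g = copyGate d n j c := by
  induction C with
  | zero => simp [copyGates]
  | succ C ih =>
    rw [copyGates, List.mem_cons, ih]
    constructor
    · rintro (rfl | ⟨c, hc, rfl⟩)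
      exacts [⟨C, by omega, rfl⟩, ⟨c, by omega, rfl⟩]
    · rintro ⟨c, hc, rfl⟩
      rcases Nat.lt_succ_iff_lt_or_eq.1 hc with h | rfl
      exacts [Or.inr ⟨c, h, rfl⟩, Or.inl rfl]

theorem register_le {j : ℕ} (hj : j ≤ d) :
    (j + 1) * regLen d n + regLen d n ≤ idxStart d n := by
  have := Nat.mul_le_mul_right (regLen d n) (show j + 2 ≤ d + 2 by omega)
  rwa [add_mul j 2, show j * regLen d n + 2 * regLen d n
    = (j + 1) * regLen d n + regLen d n by ring] at this

theorem index_le {j : ℕ} (hj : j ≤ d) : j * (d + 1) + (d + 1) ≤ (d + 1) * (d + 1) := by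
  have := Nat.mul_le_mul_right (d + 1) (show j + 1 ≤ d + 1 by omega)
  rwa [add_mul j 1, one_mul] at this

theorem copyGate_wires {j c q : ℕ} (hj : j ≤ d) (h : q ∈ (copyGate d n j c).wires) :
    c * blockLen d n ≤ q ∧ q < (c + 1) * blockLen d n := by
  have e1 := register_le (n := n) hj
  have e2 := index_le hj
  have e3 : blockLen d n = idxStart d n + (d + 1) * (d + 1) := rfl
  have e4 : (j + 1) * regLen d n = j * regLen d n + regLen d n := by ring
  have e5 : (c + 1) * blockLen d n = c * blockLen d n + blockLen d n := by ring
  have e6 : regLen d n = bigLen d n + 1 := rfl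
  simp only [OracleGate.wires, List.mem_append, List.mem_ofFn, copyGate] at h
  rcases h with ⟨t, rfl⟩ | ⟨t, rfl⟩
  · have ht : t.val < (d + 1) + bigLen d n := t.2
    split_ifs <;> omega
  · have ht : t.val < bigLen d n + 1 := t.2
    omega

theorem copyGate_nodup {j : ℕ} (c : ℕ) (hj : j ≤ d) : (copyGate d n j c).wires.Nodup := by
  have e1 := register_le (n := n) hj
  have e2 := index_le hj
  have e4 : (j + 1) * regLen d n = j * regLen d n + regLen d n := by ring
  have e6 : regLen d n = bigLen d n + 1 := rfl
  rw [OracleGate.wires, List.nodup_append]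
  refine ⟨List.nodup_ofFn.2 fun t t' h => ?_, List.nodup_ofFn.2 fun t t' h => ?_, ?_⟩
  · have ht : t.val < (d + 1) + bigLen d n := t.2
    have ht' : t'.val < (d + 1) + bigLen d n := t'.2
    simp only [copyGate] at h
    apply Fin.ext
    split_ifs at h <;> omega
  · simp only [copyGate] at h
    apply Fin.ext
    omega
  · intro p hp q hq
    simp only [List.mem_ofFn, copyGate] at hp hq
    obtain ⟨t, rfl⟩ := hp
    obtain ⟨t', rfl⟩ := hq
    have ht : t.val < (d + 1) + bigLen d n := t.2
    have ht' : t'.val < bigLen d n + 1 := t'.2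
    split_ifs <;> omega

theorem copyGates_valid {j : ℕ} (hj : j ≤ d) (C : ℕ) :
    ((copyGates d n j C).flatMap OracleGate.wires).Nodup ∧
      ∀ q ∈ (copyGates d n j C).flatMap OracleGate.wires, q < C * blockLen d n := by
  induction C with
  | zero => simp [copyGates]
  | succ C ih =>
    simp only [copyGates, List.flatMap_cons, List.nodup_append, List.mem_append]
    refine ⟨⟨copyGate_nodup C hj, ih.1, fun p hp q hq => ?_⟩, fun q hq => ?_⟩
    · have := ih.2 q hq
      have := copyGate_wires hj hp
      omega
    · rcases hq with hq | hq
      · exact (copyGate_wires hj hq).2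
      · have := ih.2 q hq
        rw [add_mul]; omega

/-- The label in which register `r` of copy `c` holds `V c r` if `J r` and is empty otherwise;
the index registers hold `0, …, d`. -/
def registerLabel (w : ℕ) (V : ℕ → ℕ → Bits (bigLen d n)) (J : ℕ → Bool) : Bits w := fun q =>
  decide (q.val < (n + n) * blockLen d n) &&
  if q.val % blockLen d n < idxStart d n then
    J (q.val % blockLen d n / regLen d n) &&
      getBit (V (q.val / blockLen d n) (q.val % blockLen d n / regLen d n))
        (q.val % blockLen d n % regLen d n)
  else ((q.val % blockLen d n - idxStart d n) / (d + 1)).testBit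
    ((q.val % blockLen d n - idxStart d n) % (d + 1))

theorem div_mod_of_lt {W c o : ℕ} (h : o < W) : (c * W + o) / W = c ∧ (c * W + o) % W = o := by
  have hW : 0 < W := by omega
  constructor
  · rw [mul_comm, Nat.mul_add_div hW, Nat.div_eq_of_lt h, add_zero]
  · rw [mul_comm, Nat.mul_add_mod, Nat.mod_eq_of_lt h]

theorem block_lt {c o : ℕ} (hc : c < n + n) (ho : o < blockLen d n) :
    c * blockLen d n + o < (n + n) * blockLen d n := by
  have := Nat.mul_le_mul_right (blockLen d n) (show c + 1 ≤ n + n by omega)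
  rw [add_mul, one_mul] at this
  omega

theorem getBit_registerLabel {w : ℕ} (hw : (n + n) * blockLen d n ≤ w)
    (V : ℕ → ℕ → Bits (bigLen d n)) (J : ℕ → Bool) {c r t : ℕ} (hc : c < n + n) (hr : r ≤ d + 1)
    (ht : t < regLen d n) :
    getBit (registerLabel w V J) (c * blockLen d n + r * regLen d n + t)
      = (J r && getBit (V c r) t) := by
  have e1 : r * regLen d n + t < idxStart d n := by
    have := Nat.mul_le_mul_right (regLen d n) (show r + 1 ≤ d + 2 by omega)
    rw [add_mul, one_mul] at this
    have e : idxStart d n = (d + 2) * regLen d n := rfl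
    omega
  have e2 : r * regLen d n + t < blockLen d n := Nat.lt_add_right _ e1
  rw [add_assoc]
  have e3 := block_lt hc e2
  obtain ⟨e4, e5⟩ := div_mod_of_lt (c := c) e2
  obtain ⟨e6, e7⟩ := div_mod_of_lt (c := r) ht
  rw [getBit_of_lt _ (e3.trans_le hw)]
  simp only [registerLabel, e4, e5, e6, e7, e3, if_pos e1, decide_true, Bool.true_and]

theorem getBit_registerLabel_index {w : ℕ} (hw : (n + n) * blockLen d n ≤ w)
    (V : ℕ → ℕ → Bits (bigLen d n)) (J : ℕ → Bool) {c j t : ℕ} (hc : c < n + n) (hj : j ≤ d)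
    (ht : t < d + 1) :
    getBit (registerLabel w V J) (c * blockLen d n + idxStart d n + j * (d + 1) + t)
      = j.testBit t := by
  have e1 := index_le hj
  have e2 : idxStart d n + (j * (d + 1) + t) < blockLen d n := by
    have e : blockLen d n = idxStart d n + (d + 1) * (d + 1) := rfl
    omega
  rw [add_assoc, add_assoc]
  have e3 := block_lt hc e2
  obtain ⟨e4, e5⟩ := div_mod_of_lt (c := c) e2
  obtain ⟨e6, e7⟩ := div_mod_of_lt (c := j) ht
  rw [getBit_of_lt _ (e3.trans_le hw)]
  simp only [registerLabel, e4, e5, e3, decide_true, Bool.true_and,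
    Nat.add_sub_cancel_left, e6, e7]
  rw [if_neg (by omega)]

theorem idxOf_eq {z : Bits (inLen d n)} {j : ℕ} (hj : j ≤ d)
    (h : ∀ t : Fin (d + 1), z (Fin.castAdd (bigLen d n) t) = j.testBit t) : idxOf z = j := by
  refine Nat.eq_of_testBit_eq fun t => ?_
  simp only [idxOf, Nat.testBit_ofBits, h]
  split_ifs with ht
  · rfl
  · refine (Nat.testBit_lt_two_pow ?_).symm
    calc j < d + 1 := by omega
      _ ≤ t := by omega
      _ < 2 ^ t := Nat.lt_two_pow_self

/-- The oracle gates for `f_j` compute register `j + 1` from register `j`, or erase it. -/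
theorem flipAll_registerLabel {w : ℕ} (hw : (n + n) * blockLen d n ≤ w)
    (O : Bits (inLen d n) → Bits (outLen d n)) (V : ℕ → ℕ → Bits (bigLen d n)) (J : ℕ → Bool)
    {j : ℕ} (hj : j ≤ d) (hJ : J j = true)
    (hO : ∀ c z, idxOf z = j → argOf z = V c j → O z = encodeAnswer (some (V c (j + 1)))) :
    flipAll O (copyGates d n j (n + n)) (registerLabel w V J)
      = registerLabel w V fun r => xor (J r) (decide (r = j + 1)) := by
  have hin : ∀ c < n + n,
      O (fun k => getBit (registerLabel w V J) ((copyGate d n j c).qin k))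
        = encodeAnswer (some (V c (j + 1))) := by
    intro c hc
    refine hO c _ (idxOf_eq hj fun t => ?_) (funext fun t => ?_)
    · simp only [copyGate, Fin.val_castAdd, t.2, if_true]
      exact getBit_registerLabel_index hw V J hc hj t.2
    · simp only [argOf, copyGate, Fin.val_natAdd]
      rw [if_neg (by omega), Nat.add_sub_cancel_left, getBit_registerLabel hw V J hc (by omega)
        (Nat.lt_succ_of_lt t.2), hJ, Bool.true_and, getBit_val]
  have hiff : ∀ i : Fin w, (∃ g ∈ copyGates d n j (n + n), ∃ t : Fin (outLen d n),
      g.qout t = i.val ∧ O (fun k => getBit (registerLabel w V J) (g.qin k)) t = true) ↔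
      i.val < (n + n) * blockLen d n ∧ i.val % blockLen d n < idxStart d n ∧
        i.val % blockLen d n / regLen d n = j + 1 ∧
        getBit (V (i.val / blockLen d n) (j + 1)) (i.val % blockLen d n % regLen d n) = true := by
    intro i
    constructor
    · rintro ⟨g, hg, t, ht, hOt⟩
      obtain ⟨c, hc, rfl⟩ := mem_copyGates.1 hg
      rw [hin c hc] at hOt
      have htr : t.val < regLen d n := t.2
      have e0 := register_le (n := n) hj
      have e1 : (j + 1) * regLen d n + t.val < idxStart d n := by omega
      have e2 : (j + 1) * regLen d n + t.val < blockLen d n := Nat.lt_add_right _ e1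
      obtain ⟨e4, e5⟩ := div_mod_of_lt (c := c) e2
      obtain ⟨e6, e7⟩ := div_mod_of_lt (c := j + 1) htr
      simp only [copyGate, add_assoc (c * blockLen d n)] at ht
      rw [← ht, e4, e5, e6, e7]
      refine ⟨block_lt hc e2, e1, rfl, ?_⟩
      simp only [encodeAnswer] at hOt
      exact hOt
    · rintro ⟨h1, h2, h3, h4⟩
      have hW : 0 < blockLen d n := Nat.add_pos_right _ (by positivity)
      have hM : 0 < regLen d n := Nat.succ_pos _
      have hc : i.val / blockLen d n < n + n := Nat.div_lt_of_lt_mul (by rwa [mul_comm])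
      have ht := Nat.mod_lt (i.val % blockLen d n) hM
      refine ⟨_, mem_copyGates.2 ⟨_, hc, rfl⟩, ⟨i.val % blockLen d n % regLen d n, ht⟩, ?_, ?_⟩
      · simp only [copyGate]
        rw [← h3, add_assoc, mul_comm _ (regLen d n), Nat.div_add_mod, mul_comm, Nat.div_add_mod]
      · rw [hin _ hc]
        exact h4
  funext i
  simp only [flipAll, hiff i]
  simp only [registerLabel]
  by_cases h1 : i.val < (n + n) * blockLen d n <;>
  by_cases h2 : i.val % blockLen d n < idxStart d n <;>
  by_cases h3 : i.val % blockLen d n / regLen d n = j + 1 <;> simp [h1, h2, h3]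
  cases J (j + 1) <;> simp

/-- The value of register `r`, if register `0` holds `x`. -/
def registerValue (f : Bits n → Bits n) (π : Fin d → Equiv.Perm (Bits (bigLen d n)))
    (x : Bits n) (r : ℕ) : Bits (bigLen d n) :=
  if r ≤ d then level (compositions π) r (embed _ x) else embed _ (f x)

theorem shuffleOracle_registerValue (f : Bits n → Bits n)
    (π : Fin d → Equiv.Perm (Bits (bigLen d n))) (x : Bits n) {j : ℕ} (hj : j ≤ d)
    (z : Bits (inLen d n)) (hz : idxOf z = j) (hz' : argOf z = registerValue f π x j) :
    shuffleOracle f π z = encodeAnswer (some (registerValue f π x (j + 1))) := by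
  have hb : basePoint (compositions π) z = embed _ x := by
    rw [basePoint, hz, hz', registerValue, if_pos hj, Equiv.symm_apply_apply]
  rw [shuffleOracle_eq, compOracle, hb, hz, answerAt, registerValue]
  rcases lt_or_eq_of_le hj with h | rfl
  · rw [if_pos h, if_pos (by omega)]
  · rw [if_neg (lt_irrefl _), if_pos rfl, extend_embed, if_neg (by omega)]
    rfl

/-- The label after register `0` of each copy `c` has been set to `X c` and the registers in `J`
have been computed. -/
abbrev copyLabel (w : ℕ) (f : Bits n → Bits n) (π : Fin d → Equiv.Perm (Bits (bigLen d n)))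
    (X : ℕ → Bits n) (J : ℕ → Bool) : Bits w :=
  registerLabel w (fun c => registerValue f π (X c)) J

/-- The functions evaluated by the oracle layers: all of them in order, then all but the last
in reverse order. -/
def schedule (d : ℕ) : List ℕ := List.range (d + 1) ++ (List.range d).reverse

theorem le_of_mem_schedule {d j : ℕ} (h : j ∈ schedule d) : j ≤ d := by
  simp only [schedule, List.mem_append, List.mem_range, List.mem_reverse] at h
  omega

theorem length_schedule (d : ℕ) : (schedule d).length = 2 * d + 1 := by
  simp only [schedule, List.length_append, List.length_range, List.length_reverse]
  omega

/-- The oracle layers of the schedule compute `f` and erase the intermediate values. -/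
theorem foldl_schedule {w : ℕ} (hw : (n + n) * blockLen d n ≤ w) (f : Bits n → Bits n)
    (π : Fin d → Equiv.Perm (Bits (bigLen d n))) (X : ℕ → Bits n) :
    (schedule d).foldl (fun l j => flipAll (shuffleOracle f π) (copyGates d n j (n + n)) l)
      (copyLabel w f π X fun r => decide (r = 0))
      = copyLabel w f π X fun r => decide (r = 0 ∨ r = d + 1) := by
  have hstep : ∀ {j : ℕ} (hj : j ≤ d) (J J' : ℕ → Bool), J j = true →
      (∀ r, J' r = xor (J r) (decide (r = j + 1))) →
      flipAll (shuffleOracle f π) (copyGates d n j (n + n)) (copyLabel w f π X J)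
        = copyLabel w f π X J' := by
    intro j hj J J' hJ hJ'
    rw [show J' = _ from funext hJ']
    exact flipAll_registerLabel hw _ _ J hj hJ
      fun c z => shuffleOracle_registerValue f π (X c) hj z
  have h1 : ∀ k ≤ d + 1, (List.range k).foldl
      (fun l j => flipAll (shuffleOracle f π) (copyGates d n j (n + n)) l)
      (copyLabel w f π X fun r => decide (r = 0)) = copyLabel w f π X fun r => decide (r ≤ k) := by
    intro k
    induction k with
    | zero => intro _; simp
    | succ k ih =>
      intro hk
      rw [List.range_succ, List.foldl_append, ih (by omega)]
      refine hstep (by omega) _ _ (by simp) fun r => ?_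
      by_cases h : r = k + 1
      · simp [h]
      · simp only [h, decide_false, Bool.xor_false]
        exact decide_eq_decide.2 (by omega)
  have h2 : ∀ k ≤ d, (List.range k).reverse.foldl
      (fun l j => flipAll (shuffleOracle f π) (copyGates d n j (n + n)) l)
      (copyLabel w f π X fun r => decide (r ≤ k ∨ r = d + 1))
        = copyLabel w f π X fun r => decide (r = 0 ∨ r = d + 1) := by
    intro k
    induction k with
    | zero => intro _; simp
    | succ k ih =>
      intro hk
      rw [List.range_succ, List.reverse_append, List.reverse_singleton, List.singleton_append,
        List.foldl_cons, ← ih (by omega)]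
      congr 1
      refine hstep (by omega) _ _ (by simp) fun r => ?_
      by_cases h : r = k + 1
      · simp [h, show k ≠ d by omega]
      · simp only [h, decide_false, Bool.xor_false]
        exact decide_eq_decide.2 (by omega)
  rw [schedule, List.foldl_append, h1 _ le_rfl, ← h2 d le_rfl]
  congr 2
  funext r
  exact decide_eq_decide.2 (by omega)

end Labels

/-! ### Interference -/

section Interference

variable {w : ℕ}

/-- The Hadamard gate. -/
def hadamard : Matrix.unitaryGroup Bool ℂ :=
  ⟨Matrix.of fun u v => if u && v then -((Real.sqrt 2 : ℝ) : ℂ)⁻¹ else ((Real.sqrt 2 : ℝ) : ℂ)⁻¹, by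
    have h : ((Real.sqrt 2 : ℝ) : ℂ)⁻¹ * ((Real.sqrt 2 : ℝ) : ℂ)⁻¹ = 1 / 2 := by
      rw [← mul_inv, ← Complex.ofReal_mul, Real.mul_self_sqrt (by norm_num)]
      norm_num
    rw [Matrix.mem_unitaryGroup_iff]
    ext u v
    cases u <;> cases v <;>
      simp [Matrix.mul_apply, Matrix.star_eq_conjTranspose, Matrix.conjTranspose_apply, h]
    all_goals norm_num⟩

/-- The gate that exchanges the two basis states. -/
def notGate : Matrix.unitaryGroup Bool ℂ :=
  ⟨Matrix.of fun u v => if u = v then 0 else 1, by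
    rw [Matrix.mem_unitaryGroup_iff]
    ext u v
    cases u <;> cases v <;>
      simp [Matrix.mul_apply, Matrix.star_eq_conjTranspose, Matrix.conjTranspose_apply]⟩

theorem norm_hadamard (u v : Bool) : ‖hadamard.1 u v‖ ^ 2 = 1 / 2 := by
  cases u <;> cases v <;> simp [hadamard]

/-- The matrix entries of one-qubit gates on distinct wires are products. -/
theorem applyGates_one (U : ℕ → Matrix.unitaryGroup Bool ℂ) (ws : List ℕ) (hn : ws.Nodup)
    (hw : ∀ q ∈ ws, q < w) (ψ : State w) (b : Bits w) :
    applyGates (ws.map fun q => Gate.one (U q) q) ψ b =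
      ∑ l, (∏ i : Fin w, if i.val ∈ ws then (U i).1 (b i) (l i)
        else if b i = l i then 1 else 0) * ψ l := by
  induction ws using List.reverseRecOn generalizing b with
  | nil =>
    rw [Finset.sum_eq_single b]
    · simp [applyGates]
    · intro l _ hl
      obtain ⟨i, hi⟩ := Function.ne_iff.1 hl.symm
      rw [Finset.prod_eq_zero (Finset.mem_univ i), zero_mul]
      simp [hi]
    · simp
  | append_singleton ws q ih =>
    rw [List.nodup_append] at hn
    have hq : q < w := hw q (by simp)
    have hqw : q ∉ ws := fun h => hn.2.2 q h q (by simp) rfl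
    have e : applyGates ((ws ++ [q]).map fun q => Gate.one (U q) q) ψ b =
        ∑ c : Bool, (U q).1 (getBit b q) c *
          applyGates (ws.map fun q => Gate.one (U q) q) ψ (setBit b q c) := by
      simp [applyGates, Gate.apply]
    rw [e]
    simp only [ih hn.1 (fun p hp => hw p (by simp [hp])), Finset.mul_sum]
    rw [Finset.sum_comm]
    refine Finset.sum_congr rfl fun l _ => ?_
    rw [Finset.sum_eq_single (l ⟨q, hq⟩)]
    · rw [← mul_assoc, ← Finset.mul_prod_erase _ _ (Finset.mem_univ (⟨q, hq⟩ : Fin w)),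
        ← Finset.mul_prod_erase _ _ (Finset.mem_univ (⟨q, hq⟩ : Fin w))]
      congr 1
      simp only [hqw, if_false, setBit, if_true, one_mul, List.mem_append, List.mem_singleton,
        or_true, getBit_of_lt b hq]
      congr 1
      refine Finset.prod_congr rfl fun i hi => ?_
      have hiq : i.val ≠ q := fun h => (Finset.mem_erase.1 hi).1 (Fin.ext h)
      simp [hiq]
    · intro c _ hc
      rw [Finset.prod_eq_zero (Finset.mem_univ (⟨q, hq⟩ : Fin w))]
      · simp
      · simp [hqw, setBit, hc]
    · simp

/-- The matrix entry on wire `i` of a layer with Hadamard gates on the wires in `A` and flips of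
the other wires according to `F`. -/
def wireEntry (A : Fin w → Bool) (F : Bits w) (i : Fin w) (u v : Bool) : ℂ :=
  if A i then hadamard.1 u v else if u = xor v (F i) then 1 else 0

/-- The layer with Hadamard gates on the wires in `A` and flips of the other wires according
to `F`. -/
def spread (A : Fin w → Bool) (F : Bits w) (ψ : State w) : State w :=
  fun b => ∑ l, (∏ i, wireEntry A F i (b i) (l i)) * ψ l

theorem spread_zeroState (A : Fin w → Bool) (F b : Bits w) :
    spread A F (zeroState w) b = ∏ i, wireEntry A F i (b i) false := by
  rw [spread, Finset.sum_eq_single (fun _ => false)]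
  · simp [zeroState]
  · intro l _ hl
    simp [zeroState, hl]
  · simp

theorem wireEntry_ne_zero {A : Fin w → Bool} {F : Bits w} {i : Fin w} {u v : Bool}
    (h : wireEntry A F i u v ≠ 0) (hi : A i = false) : u = xor v (F i) := by
  by_contra hne
  simp [wireEntry, hi, hne] at h

theorem spread_zeroState_ne_zero {A : Fin w → Bool} {F b : Bits w}
    (h : spread A F (zeroState w) b ≠ 0) (i : Fin w) (hi : A i = false) : b i = F i := by
  rw [spread_zeroState, Finset.prod_ne_zero_iff] at h
  simpa using wireEntry_ne_zero (h i (Finset.mem_univ i)) hi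

theorem xorBits_xorBits {m : ℕ} (x y : Bits m) : xorBits (xorBits x y) y = x := by
  funext i
  simp [xorBits]

theorem spread_zeroState_xorBits {A : Fin w → Bool} {F s : Bits w}
    (hs : ∀ i, A i = false → s i = false) (b : Bits w) :
    spread A F (zeroState w) (xorBits b s) = spread A F (zeroState w) b := by
  rw [spread_zeroState, spread_zeroState]
  refine Finset.prod_congr rfl fun i _ => ?_
  cases hA : A i with
  | false => simp [xorBits, hs i hA]
  | true => simp [wireEntry, hA, hadamard]

/-- A state invariant under the shift by `s` has, after Hadamard gates, no amplitude at the labels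
that are not orthogonal to `s`. -/
theorem spread_eq_zero {A : Fin w → Bool} {F s : Bits w} (hs : ∀ i, A i = false → s i = false)
    {φ : State w} (hφ : ∀ l, φ (xorBits l s) = φ l) {b : Bits w}
    (hb : ∏ i, (if s i && b i then (-1 : ℤ) else 1) = -1) : spread A F φ b = 0 := by
  have hinv : Function.Involutive fun l : Bits w => xorBits l s := fun l => xorBits_xorBits l s
  have hk : ∀ l : Bits w, ∏ i, wireEntry A F i (b i) (xorBits l s i)
      = - ∏ i, wireEntry A F i (b i) (l i) := by
    intro l
    have h1 : ∏ i, wireEntry A F i (b i) (xorBits l s i) =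
        ∏ i, ((if s i && b i then (-1 : ℤ) else 1 : ℤ) : ℂ) * wireEntry A F i (b i) (l i) := by
      refine Finset.prod_congr rfl fun i _ => ?_
      cases hA : A i with
      | false => simp [xorBits, hs i hA]
      | true =>
        simp only [wireEntry, hA, if_true, hadamard, Matrix.of_apply, xorBits]
        cases s i <;> cases b i <;> cases l i <;> simp
    rw [h1, Finset.prod_mul_distrib, ← Int.cast_prod, hb]
    simp
  have h2 : spread A F φ b = - spread A F φ b := by
    conv_lhs => rw [spread]
    rw [← Fintype.sum_bijective _ hinv.bijective _ _ (fun _ => rfl)]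
    simp only [hk, hφ, neg_mul, Finset.sum_neg_distrib, spread]
  exact self_eq_neg.1 h2

/-- If the labels in the support of a state are determined by their bits outside of `A`, then,
after Hadamard gates on `A`, all outcomes on `A` are at most as probable as under the uniform
distribution. -/
theorem normSqr_project_spread_le {A : Fin w → Bool} {F : Bits w} {φ : State w}
    (hφ : ∀ l l', φ l ≠ 0 → φ l' ≠ 0 → (∀ i, A i = false → l i = l' i) → l = l')
    {M : List ℕ} (hM : ∀ i : Fin w, i.val ∈ M ↔ A i = true) (z : Bits w) :
    normSqr (project M z (spread A F φ))
      ≤ (1 / 2) ^ (Finset.univ.filter fun i => A i = true).card * normSqr φ := by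
  classical
  set κ : Bits w → Bits w → ℂ := fun b l => ∏ i, wireEntry A F i (b i) (l i) with hκ
  have hκ0 : ∀ {b l : Bits w}, κ b l ≠ 0 → ∀ i, A i = false → b i = xor (l i) (F i) :=
    fun h i hi => wireEntry_ne_zero (Finset.prod_ne_zero_iff.1 h i (Finset.mem_univ i)) hi
  have hκn : ∀ b l, ‖κ b l‖ ^ 2 ≤ (1 / 2) ^ (Finset.univ.filter fun i => A i = true).card := by
    intro b l
    rw [hκ]
    simp only
    rw [norm_prod, ← Finset.prod_pow, ← Finset.prod_const, Finset.prod_filter]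
    refine Finset.prod_le_prod (fun _ _ => by positivity) fun i _ => ?_
    split_ifs with h
    · simp only [wireEntry, h, if_true]
      exact (norm_hadamard _ _).le
    · rw [wireEntry, if_neg h]
      split_ifs <;> simp
  -- at most one label contributes to the amplitude of `b`
  have h1 : ∀ b, ‖spread A F φ b‖ ^ 2 ≤ ∑ l, ‖κ b l‖ ^ 2 * ‖φ l‖ ^ 2 := by
    intro b
    by_cases hb : ∃ l, κ b l * φ l ≠ 0
    · obtain ⟨l, hl⟩ := hb
      have hl' := mul_ne_zero_iff.1 hl
      have : spread A F φ b = κ b l * φ l := by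
        refine Finset.sum_eq_single l (fun l' _ hne => ?_) (by simp)
        by_contra h0
        have h0' := mul_ne_zero_iff.1 h0
        refine hne (hφ l' l h0'.2 hl'.2 fun i hi => ?_)
        have := (hκ0 h0'.1 i hi).symm.trans (hκ0 hl'.1 i hi)
        simpa using this
      rw [this, norm_mul, mul_pow]
      exact Finset.single_le_sum (f := fun l => ‖κ b l‖ ^ 2 * ‖φ l‖ ^ 2)
        (fun _ _ => by positivity) (Finset.mem_univ l)
    · push Not at hb
      have : spread A F φ b = 0 := Finset.sum_eq_zero fun l _ => hb l
      rw [this]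
      simp only [norm_zero, ne_eq, OfNat.ofNat_ne_zero, not_false_eq_true, zero_pow]
      positivity
  -- each label contributes to the amplitude of at most one `b` with the given outcome
  have h2 : ∀ l, (∑ b, if ∀ i : Fin w, i.val ∈ M → b i = z i then ‖κ b l‖ ^ 2 else 0)
      ≤ (1 / 2) ^ (Finset.univ.filter fun i => A i = true).card := by
    intro l
    set b₀ : Bits w := fun i => if A i then z i else xor (l i) (F i)
    rw [Finset.sum_eq_single b₀]
    · split_ifs
      exacts [hκn _ _, by positivity]
    · intro b _ hb
      split_ifs with hz
      · by_contra h0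
        refine hb (funext fun i => ?_)
        simp only [b₀]
        split_ifs with hi
        · exact hz i ((hM i).2 hi)
        · exact hκ0 (fun h => h0 (by simp [h])) i (by simpa using hi)
      · rfl
    · simp
  calc normSqr (project M z (spread A F φ))
      ≤ ∑ b, ∑ l, (if ∀ i : Fin w, i.val ∈ M → b i = z i then ‖κ b l‖ ^ 2 else 0)
          * ‖φ l‖ ^ 2 := by
        refine Finset.sum_le_sum fun b _ => ?_
        simp only [project]
        split_ifs
        · exact h1 b
        · simp
    _ = ∑ l, (∑ b, if ∀ i : Fin w, i.val ∈ M → b i = z i then ‖κ b l‖ ^ 2 else 0)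
          * ‖φ l‖ ^ 2 := by
        rw [Finset.sum_comm]
        simp only [Finset.sum_mul]
    _ ≤ ∑ l, (1 / 2) ^ (Finset.univ.filter fun i => A i = true).card * ‖φ l‖ ^ 2 :=
        Finset.sum_le_sum fun l _ => mul_le_mul_of_nonneg_right (h2 l) (by positivity)
    _ = _ := by rw [normSqr, Finset.mul_sum]

end Interference

/-! ### The program: gates and measurements -/

section Program

/-- The positions of the ones among the index registers of a copy. -/
def onePositions (d : ℕ) : List ℕ :=
  (List.range ((d + 1) * (d + 1))).filter fun o => (o / (d + 1)).testBit (o % (d + 1))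

/-- The qubits of copy `c` that hold the argument of `f`. -/
def argWires (d n c : ℕ) : List ℕ := (List.range n).reverse.map fun i => c * blockLen d n + i

/-- The qubits of the first copies that hold the arguments of `f`. -/
def measuredWires (d n : ℕ) : ℕ → List ℕ
  | 0 => []
  | c + 1 => argWires d n c ++ measuredWires d n c

/-- The qubits of the first copies on which gates act. -/
def gateWires (d n : ℕ) : ℕ → List ℕ
  | 0 => []
  | c + 1 => ((onePositions d).map fun o => c * blockLen d n + idxStart d n + o)
      ++ (argWires d n c ++ gateWires d n c)

/-- Hadamard gates on the arguments, flips of the index registers. -/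
def wireGate (d n q : ℕ) : Matrix.unitaryGroup Bool ℂ :=
  if q % blockLen d n < n then hadamard else notGate

/-- The gates of the first and of the last layer. -/
def spreadGates (d n C : ℕ) : List Gate :=
  (gateWires d n C).map fun q => Gate.one (wireGate d n q) q

/-- Adds gates that write the indices to the index registers of the current copy. -/
def flipCmd : List ℕ → Cmd
  | [] => .skip
  | o :: os => .seq (flipCmd os) (gateOn notGate (.add (.add (.var 5) (.var 16)) (.const o)))

theorem exec_flipCmd {a b : ℕ} (out : ℕ → Bool) (os : List ℕ) (s : (ℕ → ℕ) × Layer a b) :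
    Exec out (flipCmd os) (1 + 16 * os.length) s (s.1, { s.2 with gates :=
      (os.map fun o => Gate.one notGate (s.1 5 + s.1 16 + o)) ++ s.2.gates }) := by
  induction os with
  | nil => exact Exec.skip out s
  | cons o os ih =>
    refine (ih.seq (Exec.gateOn out _ notGate (.add (.add (.var 5) (.var 16)) (.const o))
      (by simp [Expr.Fits]))).mono ?_
    simp only [Expr.cost, List.length_cons]
    omega

/-- Adds Hadamard gates on, and possibly measurements of, the argument of the current copy. -/
def argCmd (m : Bool) : Cmd :=
  forLoop 8 9 (.var 1) (.seq (gateOn hadamard (.add (.var 5) (.var 8)))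
    (if m then measureOn (.add (.var 5) (.var 8)) else .skip))

theorem exec_argCmd {a b d n : ℕ} (out : ℕ → Bool) (m : Bool) (s : (ℕ → ℕ) × Layer a b)
    (hs : s.1 1 = n) (c : ℕ) (hc : s.1 5 = c * blockLen d n) :
    ∃ s', Exec out (argCmd m) (3 + 13 + n * (23 + 26)) s s' ∧
      (∀ x, x ≠ 8 → x ≠ 9 → s'.1 x = s.1 x) ∧
      s'.2 = { s.2 with
        gates := ((argWires d n c).map fun q => Gate.one hadamard q) ++ s.2.gates
        measured := (if m then argWires d n c else []) ++ s.2.measured } := by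
  have key := Exec.forLoop out
    (fun i s' => (∀ x, x ≠ 8 → x ≠ 9 → s'.1 x = s.1 x) ∧
      s'.2 = { s.2 with
        gates := (((List.range i).reverse.map fun i => c * blockLen d n + i).map
          fun q => Gate.one hadamard q) ++ s.2.gates
        measured := (if m then (List.range i).reverse.map fun i => c * blockLen d n + i else [])
          ++ s.2.measured })
    8 9 (by norm_num) (by norm_num) (by norm_num) (.var 1) (by simp [Expr.Fits])
    (.seq (gateOn hadamard (.add (.var 5) (.var 8)))
      (if m then measureOn (.add (.var 5) (.var 8)) else .skip)) 23 n s hs ?_ ?_ ?_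
  · obtain ⟨s', h, ⟨h1, h2⟩, -⟩ := key
    exact ⟨s', h, h1, h2⟩
  · rintro i s' u v ⟨h1, h2⟩
    refine ⟨fun x hx8 hx9 => ?_, h2⟩
    simp only
    rw [Function.update_of_ne hx9, Function.update_of_ne hx8, h1 x hx8 hx9]
  · exact ⟨fun _ _ _ => rfl, by simp⟩
  · rintro i hi s₁ ⟨h1, h2⟩ hx
    have hv : (Expr.add (.var 5) (.var 8)).eval s₁.1 = c * blockLen d n + i := by
      simp only [Expr.eval, hx]
      rw [h1 5 (by norm_num) (by norm_num), hc]
    have e₁ := Exec.gateOn out s₁ hadamard (.add (.var 5) (.var 8)) (by simp [Expr.Fits])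
    set s₂ : (ℕ → ℕ) × Layer a b := (s₁.1, { s₁.2 with
      gates := Gate.one hadamard ((Expr.add (.var 5) (.var 8)).eval s₁.1) :: s₁.2.gates })
    cases m with
    | false =>
      refine ⟨_, (e₁.seq (Exec.skip out s₂)).mono (by simp [Expr.cost]), ⟨h1, ?_⟩, hx, rfl⟩
      simp only [s₂, hv, h2]
      simp [List.range_succ]
    | true =>
      refine ⟨_, (e₁.seq (Exec.measureOn out s₂ (.add (.var 5) (.var 8))
        (by simp [Expr.Fits]))).mono (by simp [Expr.cost]), ⟨h1, ?_⟩, hx, rfl⟩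
      simp only [s₂, hv, h2]
      simp [List.range_succ]

theorem map_wireGate_argWires {d n c : ℕ} :
    ((argWires d n c).map fun q => Gate.one (wireGate d n q) q)
      = (argWires d n c).map fun q => Gate.one hadamard q := by
  refine List.map_congr_left fun q hq => ?_
  simp only [argWires, List.mem_map, List.mem_reverse, List.mem_range] at hq
  obtain ⟨i, hi, rfl⟩ := hq
  have h1 := le_bigLen d n
  have h2 : regLen d n ≤ idxStart d n := Nat.le_mul_of_pos_left _ (by omega)
  have h3 : regLen d n = bigLen d n + 1 := rfl
  rw [wireGate, (div_mod_of_lt (Nat.lt_add_right _ (by omega))).2, if_pos hi]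

theorem lt_of_mem_onePositions {d o : ℕ} (h : o ∈ onePositions d) : o < (d + 1) * (d + 1) := by
  simp only [onePositions, List.mem_filter, List.mem_range] at h
  exact h.1

theorem idxStart_add_mod {d n c o : ℕ} (ho : o < (d + 1) * (d + 1)) :
    (c * blockLen d n + idxStart d n + o) % blockLen d n = idxStart d n + o := by
  have h : idxStart d n + o < blockLen d n := Nat.add_lt_add_left ho _
  rw [add_assoc, (div_mod_of_lt h).2]

theorem map_wireGate_onePositions {d n c : ℕ} :
    (((onePositions d).map fun o => c * blockLen d n + idxStart d n + o).map
        fun q => Gate.one (wireGate d n q) q)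
      = (onePositions d).map fun o => Gate.one notGate (c * blockLen d n + idxStart d n + o) := by
  rw [List.map_map]
  refine List.map_congr_left fun o ho => ?_
  have h1 := le_bigLen d n
  have h2 : regLen d n ≤ idxStart d n := Nat.le_mul_of_pos_left _ (by omega)
  have h3 : regLen d n = bigLen d n + 1 := rfl
  simp only [Function.comp_apply]
  rw [wireGate, idxStart_add_mod (lt_of_mem_onePositions ho), if_neg (by omega)]

/-- Adds the gates of `spreadGates` to the layer and, if `m` is set, measurements of the
arguments. -/
def spreadCmd (d : ℕ) (m : Bool) : Cmd :=
  .seq (assign 5 (.const 0)) (forLoop 6 7 (.var 2)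
    (.seq (argCmd m) (.seq (flipCmd (onePositions d)) (assign 5 (.add (.var 5) (.var 4))))))

theorem exec_spreadCmd (d : ℕ) (m : Bool) : ∃ T : ℕ → ℕ, PolyBounded T ∧
    ∀ (a b n : ℕ) (out : ℕ → Bool) (s : (ℕ → ℕ) × Layer a b), Layout d n s.1 →
    ∃ s', Exec out (spreadCmd d m) (T n) s s' ∧ Layout d n s'.1 ∧
      (∀ y, 64 ≤ y → s'.1 y = s.1 y) ∧
      s'.2 = { s.2 with
        gates := spreadGates d n (n + n) ++ s.2.gates
        measured := (if m then measuredWires d n (n + n) else []) ++ s.2.measured } := by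
  refine ⟨fun n => 1 + 4 + (3 + 13 + (n + n) * (((3 + 13 + n * (23 + 26)) +
    ((1 + 16 * (onePositions d).length) + (3 + 3 + 3 + 4) + 1) + 1) + 26)) + 1, ?_, ?_⟩
  · repeat first
      | exact PolyBounded.const _
      | exact PolyBounded.id
      | apply PolyBounded.add
      | apply PolyBounded.mul
  intro a b n out s hs
  have hA := Exec.assign out s 5 (.const 0) (by simp [Expr.Fits])
  set s₀ : (ℕ → ℕ) × Layer a b :=
    (Function.update s.1 5 ((Expr.const 0).eval s.1), s.2) with hs₀
  have key := Exec.forLoop out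
    (fun c s' => Layout d n s'.1 ∧ s'.1 5 = c * blockLen d n ∧
      (∀ y, 64 ≤ y → s'.1 y = s.1 y) ∧
      s'.2 = { s.2 with
        gates := spreadGates d n c ++ s.2.gates
        measured := (if m then measuredWires d n c else []) ++ s.2.measured })
    6 7 (by norm_num) (by norm_num) (by norm_num) (.var 2) (by simp [Expr.Fits])
    (.seq (argCmd m) (.seq (flipCmd (onePositions d)) (assign 5 (.add (.var 5) (.var 4)))))
    ((3 + 13 + n * (23 + 26)) + ((1 + 16 * (onePositions d).length) + (3 + 3 + 3 + 4) + 1) + 1)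
    (n + n) s₀ (by simp [s₀, Expr.eval, hs.h2]) ?_ ?_ ?_
  · obtain ⟨s', h, ⟨h1, h2, h3, h4⟩, -⟩ := key
    exact ⟨s', (hA.seq h).mono le_rfl, h1, h3, h4⟩
  · rintro c s' u v ⟨h1, h2, h3, h4⟩
    refine ⟨(h1.update (by omega) _).update (by omega) _, by simpa using h2, fun y hy => ?_, h4⟩
    simp only
    rw [Function.update_of_ne (by omega), Function.update_of_ne (by omega), h3 y hy]
  · refine ⟨hs.update (by omega) _, by simp [s₀, Expr.eval], fun y hy => ?_,
      by simp [s₀, spreadGates, gateWires, measuredWires]⟩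
    simp only [s₀]
    rw [Function.update_of_ne (by omega)]
  · rintro c hc s₁ ⟨h1, h2, h3, h4⟩ hx
    obtain ⟨s₂, e₂, u₂, l₂⟩ := exec_argCmd out m s₁ h1.h1 c h2
    have L₂ : Layout d n s₂.1 := h1.congr fun x _ h8 h9 => u₂ x h8 h9
    have c₂ : s₂.1 5 = c * blockLen d n := (u₂ 5 (by omega) (by omega)).trans h2
    have e₃ := exec_flipCmd out (onePositions d) s₂
    set s₃ : (ℕ → ℕ) × Layer a b := (s₂.1, { s₂.2 with gates := ((onePositions d).map
      fun o => Gate.one notGate (s₂.1 5 + s₂.1 16 + o)) ++ s₂.2.gates }) with hs₃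
    have e₄ := Exec.assign out s₃ 5 (.add (.var 5) (.var 4)) (by simp [Expr.Fits])
    refine ⟨_, (e₂.seq (e₃.seq e₄)).mono le_rfl, ⟨L₂.update (by omega) _, ?_, fun y hy => ?_, ?_⟩,
      ?_, ?_⟩
    · simp [Expr.eval, s₃, c₂, L₂.h4]; ring
    · simp only [s₃]
      rw [Function.update_of_ne (by omega), u₂ y (by omega) (by omega), h3 y hy]
    · simp only [s₃, l₂, h4, c₂, L₂.h16, spreadGates, gateWires, measuredWires, List.map_append,
        map_wireGate_argWires, map_wireGate_onePositions, List.append_assoc]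
      cases m <;> simp
    · simp only [s₃]
      rw [Function.update_of_ne (by omega), u₂ 6 (by omega) (by omega), hx]
    · simp only [s₃]
      rw [Function.update_of_ne (by omega), u₂ 7 (by omega) (by omega)]

end Program

/-! ### Gaussian elimination over the field with two elements -/

section Elimination

variable {n : ℕ}

/-- A bit as an element of the field with two elements. -/
def bitZ (u : Bool) : ZMod 2 := if u then 1 else 0

theorem bitZ_xor (u v : Bool) : bitZ (xor u v) = bitZ u + bitZ v := by
  cases u <;> cases v <;> decide

theorem bitZ_eq_zero {u : Bool} : bitZ u = 0 ↔ u = false := by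
  cases u <;> simp [bitZ]

/-- The inner product of `s` with the first `n` bits of `z`. -/
def dotZ (s : Bits n) (z : ℕ → Bool) : ZMod 2 := ∑ i : Fin n, bitZ (z i) * bitZ (s i)

theorem dotZ_xor (s : Bits n) (z z' : ℕ → Bool) :
    dotZ s (fun j => xor (z j) (z' j)) = dotZ s z + dotZ s z' := by
  simp only [dotZ, bitZ_xor, add_mul, Finset.sum_add_distrib]

theorem dotZ_eq_zero (s : Bits n) {z : ℕ → Bool} (h : ∀ j < n, z j = false) : dotZ s z = 0 :=
  Finset.sum_eq_zero fun i _ => by rw [h i i.2]; simp [bitZ]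

/-- Row echelon form with pivots on the diagonal; rows without a pivot vanish. -/
def Echelon (n : ℕ) (V : ℕ → ℕ → Bool) : Prop :=
  (∀ i < n, ∀ j < i, V i j = false) ∧ ∀ i < n, V i i = false → ∀ j < n, V i j = false

/-- Some pivot is missing if and only if the rows do not span. -/
theorem Echelon.exists_pivot_iff {V : ℕ → ℕ → Bool} (hV : Echelon n V) :
    (∃ i < n, V i i = false) ↔
      ∃ s : Bits n, s ≠ (fun _ => false) ∧ ∀ i < n, dotZ s (V i) = 0 := by
  set M : Matrix (Fin n) (Fin n) (ZMod 2) := Matrix.of fun i j => bitZ (V i j) with hM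
  have hdet : M.det = ∏ i : Fin n, bitZ (V i i) :=
    Matrix.det_of_isUpperTriangular (M := M) fun i j hij => by
      simp only [hM, Matrix.of_apply, hV.1 i i.2 j hij, bitZ]
      rfl
  have h1 : (∃ i < n, V i i = false) ↔ M.det = 0 := by
    rw [hdet, Finset.prod_eq_zero_iff]
    constructor
    · rintro ⟨i, hi, h⟩
      exact ⟨⟨i, hi⟩, Finset.mem_univ _, bitZ_eq_zero.2 h⟩
    · rintro ⟨i, -, h⟩
      exact ⟨i, i.2, bitZ_eq_zero.1 h⟩
  rw [h1, ← Matrix.exists_mulVec_eq_zero_iff]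
  constructor
  · rintro ⟨v, hv, hMv⟩
    have hb : ∀ i, bitZ (decide (v i ≠ 0)) = v i := by
      intro i
      generalize v i = x
      revert x
      decide
    refine ⟨fun i => decide (v i ≠ 0), fun h => hv (funext fun i => ?_), fun i hi => ?_⟩
    · have := congrFun h i
      simpa using this
    · have := congrFun hMv ⟨i, hi⟩
      simp only [Matrix.mulVec, dotProduct, hM, Matrix.of_apply, Pi.zero_apply] at this
      simpa only [dotZ, hb] using this
  · rintro ⟨s, hs, h⟩
    refine ⟨fun i => bitZ (s i), fun h0 => hs (funext fun i => bitZ_eq_zero.1 (congrFun h0 i)),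
      funext fun i => h i i.2⟩

/-- One step of the reduction of the vector `z` by the rows of `V`: if bit `i` of `z` is set,
add row `i` to `z`, after putting `z` into this row if it has no pivot. -/
def pivotStep (i : ℕ) (V : ℕ → ℕ → Bool) (z : ℕ → Bool) : (ℕ → ℕ → Bool) × (ℕ → Bool) :=
  if z i then
    if V i i then (V, fun j => xor (z j) (V i j)) else (Function.update V i z, fun _ => false)
  else (V, z)

theorem Echelon.pivotStep {V : ℕ → ℕ → Bool} {z : ℕ → Bool} {i : ℕ} (hV : Echelon n V)
    (hi : i < n) (hz : ∀ j < i, z j = false) : Echelon n (pivotStep i V z).1 := by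
  unfold QCS.pivotStep
  split_ifs with h1 h2
  · exact hV
  · refine ⟨fun k hk j hj => ?_, fun k hk hkk j hj => ?_⟩
    · by_cases hki : k = i
      · subst hki; simpa using hz j hj
      · simpa [hki] using hV.1 k hk j hj
    · by_cases hki : k = i
      · subst hki; simp [h1] at hkk
      · simp only [Function.update_of_ne hki] at hkk ⊢
        exact hV.2 k hk hkk j hj
  · exact hV

theorem Echelon.pivotStep_zero {V : ℕ → ℕ → Bool} {z : ℕ → Bool} {i : ℕ} (hV : Echelon n V)
    (hi : i < n) (hz : ∀ j < i, z j = false) :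
    ∀ j < i + 1, (QCS.pivotStep i V z).2 j = false := by
  intro j hj
  unfold QCS.pivotStep
  rcases Nat.lt_succ_iff_lt_or_eq.1 hj with h | h
  · split_ifs with h1 h2
    · simp [hz j h, hV.1 i hi j h]
    · rfl
    · exact hz j h
  · subst h
    split_ifs with h1 h2
    · simp [h1, h2]
    · rfl
    · simpa using h1

/-- The step does not change the orthogonal complement of the rows and the vector. -/
theorem Echelon.pivotStep_orthogonal {V : ℕ → ℕ → Bool} {z : ℕ → Bool} {i : ℕ}
    (hV : Echelon n V) (hi : i < n) (s : Bits n) :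
    ((∀ k < n, dotZ s ((QCS.pivotStep i V z).1 k) = 0) ∧ dotZ s (QCS.pivotStep i V z).2 = 0) ↔
      (∀ k < n, dotZ s (V k) = 0) ∧ dotZ s z = 0 := by
  unfold QCS.pivotStep
  split_ifs with h1 h2
  · simp only [dotZ_xor]
    constructor
    · rintro ⟨h3, h4⟩
      exact ⟨h3, by simpa [h3 i hi] using h4⟩
    · rintro ⟨h3, h4⟩
      exact ⟨h3, by simp [h3 i hi, h4]⟩
  · have h0 : dotZ s (V i) = 0 := dotZ_eq_zero s (hV.2 i hi (by simpa using h2))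
    simp only
    rw [and_iff_left (dotZ_eq_zero s fun _ _ => rfl)]
    constructor
    · intro h
      refine ⟨fun k hk => ?_, by simpa using h i hi⟩
      by_cases hki : k = i
      · rw [hki, h0]
      · simpa [hki] using h k hk
    · rintro ⟨h3, h4⟩ k hk
      by_cases hki : k = i
      · subst hki; simpa using h4
      · simpa [hki] using h3 k hk
  · rfl

end Elimination

section Program

variable {a b d n : ℕ}

/-- The array holds the vector `z` and, behind the list of qubits, the matrix `V`. -/
structure Holds (d n : ℕ) (V : ℕ → ℕ → Bool) (z : ℕ → Bool) (σ : ℕ → ℕ) : Prop where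
  vec : ∀ j < n, σ (64 + j) = (z j).toNat
  mat : ∀ i < n, ∀ j < n, σ (64 + (matStart d n + i * n + j)) = (V i j).toNat

theorem Holds.congr {V : ℕ → ℕ → Bool} {z : ℕ → Bool} {σ σ' : ℕ → ℕ} (h : Holds d n V z σ)
    (hσ : ∀ y, 64 ≤ y → σ' y = σ y) : Holds d n V z σ' :=
  ⟨fun j hj => by rw [hσ _ (by omega), h.vec j hj],
    fun i hi j hj => by rw [hσ _ (by omega), h.mat i hi j hj]⟩

theorem le_matStart : n ≤ matStart d n := by
  have h1 := le_bigLen d n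
  have h2 : matStart d n = (d + 1) + ((bigLen d n + 1) + (bigLen d n + 1)) := rfl
  omega

/-- Copies the vector into row `i` of the matrix. -/
def copyRow : Cmd := forLoop 10 11 (.var 1) (storeAt (.add (.var 12) (.var 10)) (.cell (.var 10)))

/-- Adds row `i` of the matrix to the vector. -/
def addRow : Cmd := forLoop 10 11 (.var 1) (storeAt (.add (.const 0) (.var 10))
  (.add (.sub (.cell (.var 10)) (.cell (.add (.var 12) (.var 10))))
    (.sub (.cell (.add (.var 12) (.var 10))) (.cell (.var 10)))))

/-- The code of `pivotStep`. The variable `8` holds `i`, and `12` the position of row `i`. -/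
def pivotCmd : Cmd := ifNonzero (.cell (.var 8))
  (.seq (ifNonzero (.cell (.add (.var 12) (.var 8))) .skip copyRow) addRow) .skip

theorem rows_disjoint {i k j l : ℕ} (hj : j < n) (hl : l < n) (h : i * n + j = k * n + l) :
    i = k ∧ j = l := by
  have h1 := div_mod_of_lt (c := i) hj
  have h2 := div_mod_of_lt (c := k) hl
  rw [h] at h1
  exact ⟨h1.1.symm.trans h2.1, h1.2.symm.trans h2.2⟩

theorem exec_copyRow (out : ℕ → Bool) (s : (ℕ → ℕ) × Layer a b) (hs : s.1 1 = n)
    {V : ℕ → ℕ → Bool} {z : ℕ → Bool} (h : Holds d n V z s.1) {i : ℕ}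
    (hi' : s.1 12 = matStart d n + i * n) :
    ∃ s', Exec out copyRow (16 + n * 51) s s' ∧ s'.2 = s.2 ∧
      (∀ u, u < 32 → u ≠ 10 → u ≠ 11 → s'.1 u = s.1 u) ∧
      Holds d n (Function.update V i z) z s'.1 := by
  have hm : n ≤ matStart d n := le_matStart
  obtain ⟨s', e, l, v, f, u⟩ := Exec.table out s (x := 10) (y := 11) (by norm_num) (by norm_num)
    (by norm_num) (.var 12) (.cell (.var 10)) (.var 1) (by simp [Expr.Fits]) (by simp [Expr.Fits])
    (by simp [Expr.Fits]) (matStart d n + i * n) n (fun j => (z j).toNat)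
    (fun σ hσ => (hσ 12 (by omega) (by omega) (by omega)).trans hi')
    (fun j hj σ _ hx hu => by
      simp only [Expr.eval, hx]
      rw [hu _ (by omega) (Or.inl (by omega)), h.vec j hj]) hs
  refine ⟨s', e.mono ?_, l, v, fun j hj => ?_, fun k hk j hj => ?_⟩
  · simp only [Expr.cost]; omega
  · rw [u _ (by omega) (Or.inl (by omega)), h.vec j hj]
  · by_cases hki : k = i
    · subst hki
      rw [f j hj, Function.update_self]
    · rw [Function.update_of_ne hki, ← h.mat k hk j hj]
      refine u _ (by omega) ?_
      by_contra hcon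
      have h1 : k * n + j = i * n + (k * n + j - i * n) := by omega
      exact hki (rows_disjoint hj (by omega) h1).1

theorem exec_addRow (out : ℕ → Bool) (s : (ℕ → ℕ) × Layer a b) (hs : s.1 1 = n)
    {V : ℕ → ℕ → Bool} {z : ℕ → Bool} (h : Holds d n V z s.1) {i : ℕ} (hi : i < n)
    (hi' : s.1 12 = matStart d n + i * n) :
    ∃ s', Exec out addRow (16 + n * 97) s s' ∧ s'.2 = s.2 ∧
      (∀ u, u < 32 → u ≠ 10 → u ≠ 11 → s'.1 u = s.1 u) ∧
      Holds d n V (fun j => xor (z j) (V i j)) s'.1 := by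
  have hm : n ≤ matStart d n := le_matStart
  obtain ⟨s', e, l, v, f, u⟩ := Exec.table out s (x := 10) (y := 11) (by norm_num) (by norm_num)
    (by norm_num) (.const 0)
    (.add (.sub (.cell (.var 10)) (.cell (.add (.var 12) (.var 10))))
      (.sub (.cell (.add (.var 12) (.var 10))) (.cell (.var 10)))) (.var 1)
    (by simp [Expr.Fits]) (by simp [Expr.Fits])
    (by simp [Expr.Fits]) 0 n (fun j => (xor (z j) (V i j)).toNat)
    (fun σ hσ => rfl)
    (fun j hj σ hσ hx hu => by
      simp only [Expr.eval, hx]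
      rw [hσ 12 (by omega) (by omega) (by omega), hi', hu _ (by omega) (Or.inr (by omega)),
        hu _ (by omega) (Or.inr (by omega)), h.vec j hj, h.mat i hi j hj]
      cases z j <;> cases V i j <;> rfl) hs
  refine ⟨s', e.mono ?_, l, v, fun j hj => ?_, fun k hk j hj => ?_⟩
  · simp only [Expr.cost]; omega
  · have := f j hj
    rwa [zero_add] at this
  · rw [u _ (by omega) (Or.inr (by omega)), h.mat k hk j hj]

theorem exec_pivotCmd (out : ℕ → Bool) (s : (ℕ → ℕ) × Layer a b) (hs : s.1 1 = n)
    {V : ℕ → ℕ → Bool} {z : ℕ → Bool} (h : Holds d n V z s.1) {i : ℕ} (hi : i < n)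
    (hi8 : s.1 8 = i) (hi' : s.1 12 = matStart d n + i * n) :
    ∃ s', Exec out pivotCmd (61 + n * 148) s s' ∧ s'.2 = s.2 ∧
      (∀ u, u < 32 → u ≠ 10 → u ≠ 11 → s'.1 u = s.1 u) ∧
      Holds d n (pivotStep i V z).1 (pivotStep i V z).2 s'.1 := by
  have hz : (Expr.cell (.var 8)).eval s.1 = (z i).toNat := by
    simp only [Expr.eval, hi8]
    exact h.vec i hi
  have hp : (Expr.cell (.add (.var 12) (.var 8))).eval s.1 = (V i i).toNat := by
    simp only [Expr.eval, hi8, hi']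
    exact h.mat i hi i hi
  by_cases h1 : z i = true
  · have main : ∃ s', Exec out (Cmd.seq (ifNonzero (.cell (.add (.var 12) (.var 8))) .skip copyRow)
        addRow) (50 + n * 148) s s' ∧ s'.2 = s.2 ∧
        (∀ u, u < 32 → u ≠ 10 → u ≠ 11 → s'.1 u = s.1 u) ∧
        Holds d n (pivotStep i V z).1 (pivotStep i V z).2 s'.1 := by
      by_cases h2 : V i i = true
      · obtain ⟨s₂, e₂, l₂, v₂, r₂⟩ := exec_addRow out s hs h hi hi'
        refine ⟨s₂, Exec.mono (Exec.seq (Exec.ifNonzero out s s _ (by simp [Expr.Fits]) _ _ 1 ?_)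
          e₂) ?_, l₂, v₂, ?_⟩
        · rw [hp, h2]; exact Exec.skip out s
        · simp only [Expr.cost]; omega
        · rw [pivotStep, if_pos h1, if_pos h2]; exact r₂
      · obtain ⟨s₁, e₁, l₁, v₁, r₁⟩ := exec_copyRow out s hs h hi'
        obtain ⟨s₂, e₂, l₂, v₂, r₂⟩ := exec_addRow out s₁
          ((v₁ 1 (by omega) (by omega) (by omega)).trans hs) r₁ hi
          ((v₁ 12 (by omega) (by omega) (by omega)).trans hi')
        refine ⟨s₂, Exec.mono (Exec.seq (Exec.ifNonzero out s s₁ _ (by simp [Expr.Fits]) _ _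
          (16 + n * 51) ?_) e₂) ?_, l₂.trans l₁, fun u hu h10 h11 =>
            (v₂ u hu h10 h11).trans (v₁ u hu h10 h11), ?_⟩
        · rw [hp, if_neg (by simpa using h2)]; exact e₁
        · simp only [Expr.cost]; omega
        · rw [pivotStep, if_pos h1, if_neg h2]
          simpa using r₂
    obtain ⟨s', e, l, v, r⟩ := main
    refine ⟨s', Exec.mono (Exec.ifNonzero out s s' _ (by simp [Expr.Fits]) _ _ (50 + n * 148) ?_)
      ?_, l, v, r⟩
    · rw [hz, h1]; exact e
    · simp only [Expr.cost]; omega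
  · refine ⟨s, Exec.mono (Exec.ifNonzero out s s _ (by simp [Expr.Fits]) _ _ 1 ?_) ?_, rfl,
      fun _ _ _ _ => rfl, ?_⟩
    · rw [hz, if_neg (by simpa using h1)]; exact Exec.skip out s
    · simp only [Expr.cost]; omega
    · rw [pivotStep, if_neg h1]; exact h

end Program

/-! ### The program: evaluation of the samples -/

section Program

variable {a b d n : ℕ}

/-- Reduces the vector by all rows of the matrix. -/
def reduceCmd : Cmd := .seq (assign 12 (.var 17)) (forLoop 8 9 (.var 1)
  (.seq pivotCmd (assign 12 (.add (.var 12) (.var 1)))))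

theorem exec_reduceCmd (out : ℕ → Bool) (s : (ℕ → ℕ) × Layer a b) (hs : Layout d n s.1)
    {V : ℕ → ℕ → Bool} {z : ℕ → Bool} (h : Holds d n V z s.1) (hV : Echelon n V) :
    ∃ s', Exec out reduceCmd (24 + n * (101 + n * 148)) s s' ∧ s'.2 = s.2 ∧
      (∀ u, u < 32 → u < 8 ∨ 12 < u → s'.1 u = s.1 u) ∧
      ∃ V' z', Holds d n V' z' s'.1 ∧ Echelon n V' ∧ ∀ t : Bits n,
        (∀ k < n, dotZ t (V' k) = 0) ↔ (∀ k < n, dotZ t (V k) = 0) ∧ dotZ t z = 0 := by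
  have hA := Exec.assign out s 12 (.var 17) (by simp [Expr.Fits])
  set s₀ : (ℕ → ℕ) × Layer a b :=
    (Function.update s.1 12 ((Expr.var 17).eval s.1), s.2) with hs₀
  have key := Exec.forLoop out
    (fun i s' => s'.2 = s.2 ∧ (∀ u, u < 32 → u < 8 ∨ 12 < u → s'.1 u = s.1 u) ∧
      s'.1 12 = matStart d n + i * n ∧
      ∃ V' z', Holds d n V' z' s'.1 ∧ Echelon n V' ∧ (∀ j < i, z' j = false) ∧ ∀ t : Bits n,
        ((∀ k < n, dotZ t (V' k) = 0) ∧ dotZ t z' = 0) ↔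
          (∀ k < n, dotZ t (V k) = 0) ∧ dotZ t z = 0)
    8 9 (by norm_num) (by norm_num) (by norm_num) (.var 1) (by simp [Expr.Fits])
    (.seq pivotCmd (assign 12 (.add (.var 12) (.var 1)))) (75 + n * 148) n s₀
    (by simp [s₀, Expr.eval, hs.h1]) ?_ ?_ ?_
  · obtain ⟨s', e, ⟨h1, h2, -, V', z', r, hE, hz, ho⟩, -⟩ := key
    refine ⟨s', (hA.seq e).mono ?_, h1, h2, V', z', r, hE, fun t => ?_⟩
    · simp only [Expr.cost]
      rw [show 75 + n * 148 + 26 = 101 + n * 148 by ring]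
      omega
    · rw [← ho t, and_iff_left (dotZ_eq_zero t hz)]
  · rintro i s' p q ⟨h1, h2, h3, V', z', r, h4⟩
    refine ⟨h1, fun u hu hu' => ?_, by simpa using h3, V', z', r.congr fun y hy => ?_, h4⟩ <;>
      simp only
    · rw [Function.update_of_ne (by omega), Function.update_of_ne (by omega), h2 u hu hu']
    · rw [Function.update_of_ne (by omega), Function.update_of_ne (by omega)]
  · refine ⟨rfl, fun u hu hu' => ?_, by simp [s₀, Expr.eval, hs.h17], V, z,
      h.congr fun y hy => ?_, hV, fun j hj => absurd hj (Nat.not_lt_zero j), fun t => Iff.rfl⟩ <;>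
      simp only [s₀]
    · rw [Function.update_of_ne (by omega)]
    · rw [Function.update_of_ne (by omega)]
  · rintro i hi s₁ ⟨h1, h2, h3, V', z', r, hE, hz, ho⟩ hx
    have hs₁ : s₁.1 1 = n := (h2 1 (by omega) (Or.inl (by omega))).trans hs.h1
    obtain ⟨s₂, e₂, l₂, v₂, r₂⟩ := exec_pivotCmd out s₁ hs₁ r hi hx h3
    have e₃ := Exec.assign out s₂ 12 (.add (.var 12) (.var 1)) (by simp [Expr.Fits])
    refine ⟨_, (e₂.seq e₃).mono ?_, ⟨l₂.trans h1, fun u hu hu' => ?_, ?_, _, _,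
      r₂.congr fun y hy => ?_, hE.pivotStep hi hz, hE.pivotStep_zero hi hz, fun t => ?_⟩, ?_, ?_⟩
    · simp only [Expr.cost]; omega
    · simp only
      rw [Function.update_of_ne (by omega), v₂ u hu (by omega) (by omega), h2 u hu hu']
    · simp only [Function.update_self, Expr.eval]
      rw [v₂ 12 (by omega) (by omega) (by omega), v₂ 1 (by omega) (by omega) (by omega), h3, hs₁]
      ring
    · simp only
      rw [Function.update_of_ne (by omega)]
    · rw [← ho t]
      exact hE.pivotStep_orthogonal hi t
    · simp only
      rw [Function.update_of_ne (by omega), v₂ 8 (by omega) (by omega) (by omega), hx]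
    · simp only
      rw [Function.update_of_ne (by omega), v₂ 9 (by omega) (by omega) (by omega)]

/-- Reads the outcome of the measurement of the argument of the current copy. -/
def readCmd : Cmd := forLoop 8 9 (.var 1) (readTo (.var 8) (.add (.var 5) (.var 8)))

theorem exec_readCmd (out : ℕ → Bool) (s : (ℕ → ℕ) × Layer a b) (hs : s.1 1 = n)
    {p : ℕ} (hp : s.1 5 = p) :
    ∃ s', Exec out readCmd (16 + n * 47) s s' ∧ s'.2 = s.2 ∧
      (∀ u, u < 32 → u ≠ 8 → u ≠ 9 → s'.1 u = s.1 u) ∧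
      (∀ j < n, s'.1 (64 + j) = (out (p + j)).toNat) ∧
      ∀ y, 64 + n ≤ y → s'.1 y = s.1 y := by
  have key := Exec.forLoop out
    (fun i s' => i ≤ n ∧ s'.2 = s.2 ∧ (∀ u, u < 32 → u ≠ 8 → u ≠ 9 → s'.1 u = s.1 u) ∧
      (∀ j < i, s'.1 (64 + j) = (out (p + j)).toNat) ∧ ∀ y, 64 + n ≤ y → s'.1 y = s.1 y)
    8 9 (by norm_num) (by norm_num) (by norm_num) (.var 1) (by simp [Expr.Fits])
    (readTo (.var 8) (.add (.var 5) (.var 8))) 21 n s hs ?_ ?_ ?_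
  · obtain ⟨s', h, ⟨-, h1⟩, -⟩ := key
    exact ⟨s', h.mono (by simp [Expr.cost]), h1⟩
  · rintro i s' u v ⟨h0, h1, h2, h3, h4⟩
    refine ⟨h0, h1, fun u hu h8 h9 => ?_, fun j hj => ?_, fun y hy => ?_⟩ <;> simp only
    · rw [Function.update_of_ne h9, Function.update_of_ne h8, h2 u hu h8 h9]
    · rw [Function.update_of_ne (by omega), Function.update_of_ne (by omega), h3 j hj]
    · rw [Function.update_of_ne (by omega), Function.update_of_ne (by omega), h4 y hy]
  · exact ⟨Nat.zero_le n, rfl, fun _ _ _ _ => rfl, by simp, fun _ _ => rfl⟩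
  · rintro i hi s₁ ⟨h0, h1, h2, h3, h4⟩ hx
    have e₁ := Exec.readTo out s₁ (.var 8) (.add (.var 5) (.var 8)) (by simp [Expr.Fits])
      (by simp [Expr.Fits])
    have h5 : s₁.1 5 = p := (h2 5 (by omega) (by omega) (by omega)).trans hp
    refine ⟨_, e₁.mono (by simp [Expr.cost]), ⟨hi, h1, fun u hu h8 h9 => ?_, fun j hj => ?_,
      fun y hy => ?_⟩, ?_, ?_⟩ <;> simp only [Expr.eval, hx, h5]
    · rw [Function.update_of_ne (by omega), h2 u hu h8 h9]
    · rcases Nat.lt_succ_iff_lt_or_eq.1 hj with h | h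
      · rw [Function.update_of_ne (by omega), h3 j h]
      · rw [h, Function.update_self]
    · rw [Function.update_of_ne (by omega), h4 y hy]
    · rw [Function.update_of_ne (by omega), hx]
    · rw [Function.update_of_ne (by omega)]

/-- Counts the missing pivots. -/
def countCmd : Cmd := .seq (assign 13 (.const 0)) (.seq (assign 12 (.var 17))
  (.seq (forLoop 8 9 (.var 1)
    (.seq (assign 13 (.add (.var 13) (.sub (.const 1) (.cell (.add (.var 12) (.var 8))))))
      (assign 12 (.add (.var 12) (.var 1)))))
  (assign 0 (.var 13))))

theorem exec_countCmd (out : ℕ → Bool) (s : (ℕ → ℕ) × Layer a b) (hs : Layout d n s.1)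
    {V : ℕ → ℕ → Bool}
    (h : ∀ i < n, ∀ j < n, s.1 (64 + (matStart d n + i * n + j)) = (V i j).toNat) :
    ∃ s', Exec out countCmd (38 + n * 69) s s' ∧
      (s'.1 0 ≠ 0 ↔ ∃ i < n, V i i = false) := by
  have eA := Exec.assign out s 13 (.const 0) (by simp [Expr.Fits])
  set sA : (ℕ → ℕ) × Layer a b :=
    (Function.update s.1 13 ((Expr.const 0).eval s.1), s.2) with hsA
  have eB := Exec.assign out sA 12 (.var 17) (by simp [Expr.Fits])
  set sB : (ℕ → ℕ) × Layer a b :=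
    (Function.update sA.1 12 ((Expr.var 17).eval sA.1), sA.2) with hsB
  have key := Exec.forLoop out
    (fun i s' => s'.1 1 = n ∧ s'.1 12 = matStart d n + i * n ∧
      (∀ i < n, ∀ j < n, s'.1 (64 + (matStart d n + i * n + j)) = (V i j).toNat) ∧
      (s'.1 13 ≠ 0 ↔ ∃ k < i, V k k = false))
    8 9 (by norm_num) (by norm_num) (by norm_num) (.var 1) (by simp [Expr.Fits])
    (.seq (assign 13 (.add (.var 13) (.sub (.const 1) (.cell (.add (.var 12) (.var 8))))))
      (assign 12 (.add (.var 12) (.var 1)))) 43 n sB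
    (by simp [sB, sA, Expr.eval, hs.h1]) ?_ ?_ ?_
  · obtain ⟨s₁, e₁, ⟨h1, h2, h3, h4⟩, -⟩ := key
    have e₂ := Exec.assign out s₁ 0 (.var 13) (by simp [Expr.Fits])
    refine ⟨_, (eA.seq (eB.seq (e₁.seq e₂))).mono ?_, ?_⟩
    · simp only [Expr.cost]; omega
    · simpa [Expr.eval] using h4
  · rintro i s' u v ⟨h1, h2, h3, h4⟩
    refine ⟨by simpa using h1, by simpa using h2, fun k hk j hj => ?_, by simpa using h4⟩
    simp only
    rw [Function.update_of_ne (by omega), Function.update_of_ne (by omega), h3 k hk j hj]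
  · refine ⟨by simp [sB, sA, hs.h1], by simp [sB, sA, Expr.eval, hs.h17], fun k hk j hj => ?_,
      by simp [sB, sA, Expr.eval]⟩
    simp only [sB, sA]
    rw [Function.update_of_ne (by omega), Function.update_of_ne (by omega), h k hk j hj]
  · rintro i hi s₁ ⟨h1, h2, h3, h4⟩ hx
    have e₂ := Exec.assign out s₁ 13
      (.add (.var 13) (.sub (.const 1) (.cell (.add (.var 12) (.var 8))))) (by simp [Expr.Fits])
    have hval : (Expr.add (.var 13) (.sub (.const 1) (.cell (.add (.var 12) (.var 8))))).eval s₁.1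
        = s₁.1 13 + (1 - (V i i).toNat) := by
      simp only [Expr.eval, hx, h2]
      rw [h3 i hi i hi]
    rw [hval] at e₂
    set s₂ : (ℕ → ℕ) × Layer a b :=
      (Function.update s₁.1 13 (s₁.1 13 + (1 - (V i i).toNat)), s₁.2) with hs₂
    have e₃ := Exec.assign out s₂ 12 (.add (.var 12) (.var 1)) (by simp [Expr.Fits])
    refine ⟨_, (e₂.seq e₃).mono ?_, ⟨?_, ?_, fun k hk j hj => ?_, ?_⟩, ?_, ?_⟩
    · simp only [Expr.cost]; omega
    · simpa [s₂] using h1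
    · simp only [Function.update_self, Expr.eval, s₂]
      rw [Function.update_of_ne (by omega), Function.update_of_ne (by omega), h1, h2]
      ring
    · simp only [s₂]
      rw [Function.update_of_ne (by omega), Function.update_of_ne (by omega), h3 k hk j hj]
    · simp only [s₂]
      rw [Function.update_of_ne (by omega), Function.update_self]
      have h5 : s₁.1 13 + (1 - (V i i).toNat) ≠ 0 ↔ s₁.1 13 ≠ 0 ∨ V i i = false := by
        cases V i i <;> simp
      rw [h5, h4]
      constructor
      · rintro (⟨k, hk, hV⟩ | hV)
        exacts [⟨k, by omega, hV⟩, ⟨i, by omega, hV⟩]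
      · rintro ⟨k, hk, hV⟩
        rcases Nat.lt_succ_iff_lt_or_eq.1 hk with h | rfl
        exacts [Or.inl ⟨k, h, hV⟩, Or.inr hV]
    · simpa [s₂] using hx
    · simp [s₂]

/-- Decides whether some nonzero string is orthogonal to all samples. -/
def evaluateCmd : Cmd := .seq (.seq (assign 5 (.const 0)) (forLoop 6 7 (.var 2)
  (.seq readCmd (.seq reduceCmd (assign 5 (.add (.var 5) (.var 4))))))) countCmd

/-- Some nonzero string is orthogonal to the samples of all copies. -/
def Deficient (d n : ℕ) (out : ℕ → Bool) : Prop := ∃ t : Bits n, t ≠ (fun _ => false) ∧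
  ∀ c < n + n, dotZ t (fun j => out (c * blockLen d n + j)) = 0

theorem exec_evaluateCmd (d : ℕ) : ∃ T : ℕ → ℕ, PolyBounded T ∧
    ∀ (a b n : ℕ) (out : ℕ → Bool) (s : (ℕ → ℕ) × Layer a b), Layout d n s.1 →
    (∀ y, 64 + matStart d n ≤ y → s.1 y = 0) →
    ∃ s', Exec out evaluateCmd (T n) s s' ∧ (s'.1 0 ≠ 0 ↔ Deficient d n out) := by
  refine ⟨fun n => 1 + 4 + (3 + 13 + (n + n) * ((16 + n * 47) + ((24 + n * (101 + n * 148))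
    + (3 + 3 + 3 + 4) + 1) + 1 + 26)) + 1 + (38 + n * 69) + 1, ?_, ?_⟩
  · repeat first
      | exact PolyBounded.const _
      | exact PolyBounded.id
      | apply PolyBounded.add
      | apply PolyBounded.mul
  intro a b n out s hs h0
  have hm : n ≤ matStart d n := le_matStart
  have hA := Exec.assign out s 5 (.const 0) (by simp [Expr.Fits])
  set s₀ : (ℕ → ℕ) × Layer a b :=
    (Function.update s.1 5 ((Expr.const 0).eval s.1), s.2) with hs₀
  have key := Exec.forLoop out
    (fun c s' => Layout d n s'.1 ∧ s'.1 5 = c * blockLen d n ∧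
      ∃ V, (∀ i < n, ∀ j < n, s'.1 (64 + (matStart d n + i * n + j)) = (V i j).toNat) ∧
        Echelon n V ∧ ∀ t : Bits n, (∀ k < n, dotZ t (V k) = 0) ↔
          ∀ c' < c, dotZ t (fun j => out (c' * blockLen d n + j)) = 0)
    6 7 (by norm_num) (by norm_num) (by norm_num) (.var 2) (by simp [Expr.Fits])
    (.seq readCmd (.seq reduceCmd (assign 5 (.add (.var 5) (.var 4)))))
    ((16 + n * 47) + ((24 + n * (101 + n * 148)) + (3 + 3 + 3 + 4) + 1) + 1)
    (n + n) s₀ (by simp [s₀, Expr.eval, hs.h2]) ?_ ?_ ?_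
  · obtain ⟨s₁, e₁, ⟨h1, -, V, hV, hE, ho⟩, -⟩ := key
    obtain ⟨s₂, e₂, h2⟩ := exec_countCmd out s₁ h1 hV
    refine ⟨s₂, ((hA.seq e₁).seq e₂).mono le_rfl, ?_⟩
    rw [h2, hE.exists_pivot_iff]
    exact exists_congr fun t => and_congr_right fun _ => ho t
  · rintro c s' u v ⟨h1, h2, V, hV, h3⟩
    refine ⟨(h1.update (by omega) _).update (by omega) _, by simpa using h2, V,
      fun i hi j hj => ?_, h3⟩
    simp only
    rw [Function.update_of_ne (by omega), Function.update_of_ne (by omega), hV i hi j hj]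
  · refine ⟨hs.update (by omega) _, by simp [s₀, Expr.eval], fun _ _ => false,
      fun i hi j hj => ?_, ⟨fun _ _ _ _ => rfl, fun _ _ _ _ _ => rfl⟩, fun t => ?_⟩
    · simp only [s₀]
      rw [Function.update_of_ne (by omega), h0 _ (by omega)]
      rfl
    · exact ⟨fun _ c' hc' => absurd hc' (Nat.not_lt_zero c'),
        fun _ k _ => dotZ_eq_zero t fun _ _ => rfl⟩
  · rintro c hc s₁ ⟨h1, h2, V, hV, hE, ho⟩ hx
    obtain ⟨s₂, e₂, l₂, v₂, f₂, u₂⟩ := exec_readCmd out s₁ h1.h1 h2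
    have L₂ : Layout d n s₂.1 := h1.congr v₂
    have r₂ : Holds d n V (fun j => out (c * blockLen d n + j)) s₂.1 :=
      ⟨f₂, fun i hi j hj => by rw [u₂ _ (by omega), hV i hi j hj]⟩
    obtain ⟨s₃, e₃, l₃, v₃, V', z', r₃, hE', ho'⟩ := exec_reduceCmd out s₂ L₂ r₂ hE
    have L₃ : Layout d n s₃.1 := by
      obtain ⟨g1, g2, g3, g4, g16, g17, g18⟩ := L₂
      constructor <;> rw [v₃ _ (by omega) (by omega)] <;> assumption
    have e₄ := Exec.assign out s₃ 5 (.add (.var 5) (.var 4)) (by simp [Expr.Fits])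
    refine ⟨_, (e₂.seq (e₃.seq e₄)).mono le_rfl, ⟨L₃.update (by omega) _, ?_, V',
      fun i hi j hj => ?_, hE', fun t => ?_⟩, ?_, ?_⟩
    · simp only [Function.update_self, Expr.eval]
      rw [L₃.h4, v₃ 5 (by omega) (by omega), v₂ 5 (by omega) (by omega) (by omega), h2]
      ring
    · simp only
      rw [Function.update_of_ne (by omega), r₃.mat i hi j hj]
    · rw [ho' t, ho t]
      constructor
      · rintro ⟨g1, g2⟩ c' hc'
        rcases Nat.lt_succ_iff_lt_or_eq.1 hc' with h | rfl
        exacts [g1 c' h, g2]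
      · intro g
        exact ⟨fun c' hc' => g c' (by omega), g c (by omega)⟩
    · simp only
      rw [Function.update_of_ne (by omega), v₃ 6 (by omega) (by omega),
        v₂ 6 (by omega) (by omega) (by omega), hx]
    · simp only
      rw [Function.update_of_ne (by omega), v₃ 7 (by omega) (by omega),
        v₂ 7 (by omega) (by omega) (by omega)]

end Program

/-! ### The measured samples -/

section Samples

variable {d n : ℕ}

theorem lt_blockLen : n < blockLen d n := by
  have h1 := le_bigLen d n
  have h2 : regLen d n ≤ idxStart d n := Nat.le_mul_of_pos_left _ (by omega)
  have h3 : regLen d n = bigLen d n + 1 := rfl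
  exact Nat.lt_add_right _ (by omega)

theorem lt_idxStart : n < idxStart d n := by
  have h1 := le_bigLen d n
  have h2 : regLen d n ≤ idxStart d n := Nat.le_mul_of_pos_left _ (by omega)
  have h3 : regLen d n = bigLen d n + 1 := rfl
  omega

theorem mem_argWires {c q : ℕ} : q ∈ argWires d n c ↔ ∃ i < n, q = c * blockLen d n + i := by
  simp only [argWires, List.mem_map, List.mem_reverse, List.mem_range, eq_comm]

theorem mem_measuredWires {C q : ℕ} :
    q ∈ measuredWires d n C ↔ q < C * blockLen d n ∧ q % blockLen d n < n := by
  have hn : n < blockLen d n := lt_blockLen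
  induction C with
  | zero => simp [measuredWires]
  | succ C ih =>
    simp only [measuredWires, List.mem_append, ih, mem_argWires, Nat.add_one_mul C]
    constructor
    · rintro (⟨i, hi, rfl⟩ | ⟨h1, h2⟩)
      · rw [(div_mod_of_lt (hi.trans hn)).2]
        omega
      · omega
    · rintro ⟨h1, h2⟩
      by_cases h : q < C * blockLen d n
      · exact Or.inr ⟨h, h2⟩
      · obtain ⟨o, rfl⟩ := Nat.exists_eq_add_of_le (not_lt.1 h)
        have ho : o < blockLen d n := by omega
        rw [(div_mod_of_lt ho).2] at h2
        exact Or.inl ⟨o, h2, rfl⟩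

theorem mem_gateWires {C q : ℕ} : q ∈ gateWires d n C ↔ q < C * blockLen d n ∧
    (q % blockLen d n < n ∨ idxStart d n ≤ q % blockLen d n ∧
      ((q % blockLen d n - idxStart d n) / (d + 1)).testBit
        ((q % blockLen d n - idxStart d n) % (d + 1)) = true) := by
  have hn : n < blockLen d n := lt_blockLen
  have hW : blockLen d n = idxStart d n + (d + 1) * (d + 1) := rfl
  induction C with
  | zero => simp [gateWires]
  | succ C ih =>
    simp only [gateWires, List.mem_append, ih, mem_argWires, Nat.add_one_mul C, List.mem_map]
    constructor
    · rintro (⟨o, ho, rfl⟩ | ⟨i, hi, rfl⟩ | ⟨h1, h2⟩)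
      · have := lt_of_mem_onePositions ho
        rw [idxStart_add_mod this, Nat.add_sub_cancel_left]
        refine ⟨by omega, Or.inr ⟨by omega, ?_⟩⟩
        simpa [onePositions] using (List.mem_filter.1 ho).2
      · rw [(div_mod_of_lt (hi.trans hn)).2]
        exact ⟨by omega, Or.inl hi⟩
      · exact ⟨by omega, h2⟩
    · rintro ⟨h1, h2⟩
      by_cases h : q < C * blockLen d n
      · exact Or.inr (Or.inr ⟨h, h2⟩)
      · obtain ⟨o, rfl⟩ := Nat.exists_eq_add_of_le (not_lt.1 h)
        have ho : o < blockLen d n := by omega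
        rw [(div_mod_of_lt ho).2] at h2
        rcases h2 with h2 | ⟨h2, h3⟩
        · exact Or.inr (Or.inl ⟨o, h2, rfl⟩)
        · refine Or.inl ⟨o - idxStart d n, ?_, by omega⟩
          rw [onePositions, List.mem_filter, List.mem_range]
          exact ⟨by omega, h3⟩

theorem nodup_gateWires (C : ℕ) : (gateWires d n C).Nodup := by
  have hn : n < blockLen d n := lt_blockLen
  have hn' : n < idxStart d n := lt_idxStart
  induction C with
  | zero => simp [gateWires]
  | succ C ih =>
    rw [gateWires, List.nodup_append, List.nodup_append]
    refine ⟨?_, ⟨?_, ih, ?_⟩, ?_⟩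
    · exact ((List.nodup_range).filter _).map fun x y h => by simpa using h
    · exact ((List.nodup_reverse.2 List.nodup_range)).map fun x y h => by simpa using h
    · intro p hp q hq
      obtain ⟨i, hi, rfl⟩ := mem_argWires.1 hp
      have := (mem_gateWires.1 hq).1
      omega
    · intro p hp q hq
      simp only [List.mem_map] at hp
      obtain ⟨o, ho, rfl⟩ := hp
      rcases List.mem_append.1 hq with hq | hq
      · obtain ⟨i, hi, rfl⟩ := mem_argWires.1 hq
        omega
      · have := (mem_gateWires.1 hq).1
        omega

theorem flatMap_spreadGates (C : ℕ) : (spreadGates d n C).flatMap Gate.wires = gateWires d n C := by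
  simp [spreadGates, List.flatMap_map, Gate.wires]

/-- The qubits that hold the arguments of `f`. -/
def argMask (d n w : ℕ) : Fin w → Bool := fun q =>
  decide (q.val < (n + n) * blockLen d n ∧ q.val % blockLen d n < n)

/-- The label in which only the index registers are set. -/
def indexLabel (d n w : ℕ) : Bits w :=
  registerLabel (d := d) (n := n) w (fun _ _ _ => false) fun _ => false

theorem applyGates_spreadGates {w : ℕ} (hw : (n + n) * blockLen d n ≤ w) (ψ : State w) :
    applyGates (spreadGates d n (n + n)) ψ = spread (argMask d n w) (indexLabel d n w) ψ := by
  have hn' : n < idxStart d n := lt_idxStart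
  funext b
  rw [spreadGates, applyGates_one _ _ (nodup_gateWires _)
    fun q hq => (mem_gateWires.1 hq).1.trans_le hw, spread]
  refine Finset.sum_congr rfl fun l _ => ?_
  congr 1
  refine Finset.prod_congr rfl fun i _ => ?_
  simp only [mem_gateWires, wireEntry, argMask, indexLabel, registerLabel, wireGate]
  by_cases h1 : i.val < (n + n) * blockLen d n
  · by_cases h2 : i.val % blockLen d n < n
    · simp [h1, h2]
    · by_cases h3 : i.val % blockLen d n < idxStart d n
      · simp [h1, h2, h3, show ¬ idxStart d n ≤ i.val % blockLen d n by omega]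
      · simp only [h1, h2, h3, show idxStart d n ≤ i.val % blockLen d n by omega, true_and,
          false_or, if_false, decide_false, decide_true, Bool.true_and, and_false,
          Bool.false_eq_true]
        generalize ((i.val % blockLen d n - idxStart d n) / (d + 1)).testBit
          ((i.val % blockLen d n - idxStart d n) % (d + 1)) = t
        cases t <;> cases b i <;> cases l i <;> simp [notGate]
  · simp [h1]

/-- The labels in superposition after the gates of the first layer. -/
theorem exists_copyLabel {w : ℕ} (f : Bits n → Bits n)
    (π : Fin d → Equiv.Perm (Bits (bigLen d n))) (b : Bits w)
    (hb : ∀ i, argMask d n w i = false → b i = indexLabel d n w i) :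
    ∃ X, b = copyLabel w f π X fun r => decide (r = 0) := by
  refine ⟨fun c i => getBit b (c * blockLen d n + i), funext fun q => ?_⟩
  have hM : regLen d n = bigLen d n + 1 := rfl
  have hle := le_bigLen d n
  simp only [copyLabel, registerLabel]
  by_cases hA : argMask d n w q = false
  · rw [hb q hA, indexLabel, registerLabel]
    by_cases hq : q.val < (n + n) * blockLen d n
    · congr 1
      split_ifs with h1
      · rw [Bool.false_and]
        by_cases h2 : q.val % blockLen d n / regLen d n = 0
        · have h3 : q.val % blockLen d n < regLen d n :=
            (Nat.div_eq_zero_iff_lt (Nat.succ_pos _)).1 h2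
          have h4 : ¬ q.val % blockLen d n < n := by simpa [argMask, hq] using hA
          rw [h2, registerValue, if_pos (Nat.zero_le d), level, Nat.mod_eq_of_lt h3]
          simp [getBit, embed, h4]
        · simp [h2]
      · rfl
    · simp [hq]
  · have hA' : q.val < (n + n) * blockLen d n ∧ q.val % blockLen d n < n := by
      simpa [argMask] using hA
    have h1 : q.val % blockLen d n < regLen d n := by omega
    have h2 : q.val % blockLen d n < idxStart d n := hA'.2.trans lt_idxStart
    rw [if_pos h2, Nat.div_eq_of_lt h1, Nat.mod_eq_of_lt h1, registerValue,
      if_pos (Nat.zero_le d), level]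
    have h3 : q.val % blockLen d n < bigLen d n := by omega
    simp only [hA'.1, decide_true, Bool.true_and, getBit_of_lt _ h3, Equiv.Perm.coe_one, id_eq,
      embed, hA'.2, dif_pos]
    rw [mul_comm, Nat.div_add_mod, getBit_val]

end Samples

/-! ### The state before the last layer and its measurement -/

section Samples

variable {d n w : ℕ}

theorem foldl_foldr {α β : Type} {F : β → α → α} {js : List β}
    (hF : ∀ j ∈ js, ∀ l, F j (F j l) = l) (l : α) :
    js.foldl (fun l j => F j l) (js.foldr (fun j l => F j l) l) = l := by
  induction js with
  | nil => rfl
  | cons j js ih =>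
    rw [List.foldr_cons, List.foldl_cons, hF j (by simp)]
    exact ih fun k hk => hF k (by simp [hk])

theorem foldr_foldl {α β : Type} {F : β → α → α} {js : List β}
    (hF : ∀ j ∈ js, ∀ l, F j (F j l) = l) (l : α) :
    js.foldr (fun j l => F j l) (js.foldl (fun l j => F j l) l) = l := by
  induction js generalizing l with
  | nil => rfl
  | cons j js ih =>
    rw [List.foldr_cons, List.foldl_cons, ih fun k hk => hF k (by simp [hk])]
    exact hF j (by simp) l

/-- The label whose image under the oracle layers is `l`. -/
def preimageLabel (O : Bits (inLen d n) → Bits (outLen d n)) (l : Bits w) : Bits w :=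
  (schedule d).foldr (fun j l => flipAll O (copyGates d n j (n + n)) l) l

theorem flipAll_copyGates_involutive (O : Bits (inLen d n) → Bits (outLen d n)) :
    ∀ j ∈ schedule d, ∀ l : Bits w, flipAll O (copyGates d n j (n + n))
      (flipAll O (copyGates d n j (n + n)) l) = l := fun _ hj =>
  flipAll_flipAll O (separated_of_nodup (copyGates_valid (le_of_mem_schedule hj) _).1)

theorem preimageLabel_eq_iff (hw : (n + n) * blockLen d n ≤ w) (f : Bits n → Bits n)
    (π : Fin d → Equiv.Perm (Bits (bigLen d n))) (X : ℕ → Bits n) (l : Bits w) :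
    preimageLabel (shuffleOracle f π) l = copyLabel w f π X (fun r => decide (r = 0)) ↔
      l = copyLabel w f π X fun r => decide (r = 0 ∨ r = d + 1) := by
  have hinv := flipAll_copyGates_involutive (w := w) (shuffleOracle f π)
  rw [← foldl_schedule hw]
  constructor
  · intro h
    rw [← h]
    exact (foldl_foldr hinv l).symm
  · intro h
    rw [h]
    exact foldr_foldl hinv _

/-- The state before the last layer. -/
def computedState (d n w : ℕ) (O : Bits (inLen d n) → Bits (outLen d n)) : State w := fun l =>
  spread (argMask d n w) (indexLabel d n w) (zeroState w) (preimageLabel O l)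

/-- The oracle layers leave superpositions of labels with the arguments and their values. -/
theorem computedState_ne_zero (hw : (n + n) * blockLen d n ≤ w) {f : Bits n → Bits n}
    {π : Fin d → Equiv.Perm (Bits (bigLen d n))} {l : Bits w}
    (h : computedState d n w (shuffleOracle f π) l ≠ 0) :
    ∃ X, l = copyLabel w f π X fun r => decide (r = 0 ∨ r = d + 1) := by
  obtain ⟨X, hX⟩ := exists_copyLabel f π _ (spread_zeroState_ne_zero h)
  exact ⟨X, (preimageLabel_eq_iff hw f π X l).1 hX⟩

/-- The string `s` on the argument of copy `c`. -/
def shiftLabel (d n w c : ℕ) (s : Bits n) : Bits w := fun q =>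
  decide (q.val / blockLen d n = c) && getBit s (q.val % blockLen d n)

theorem lt_of_div_eq {q c : ℕ} (hc : c < n + n) (h : q / blockLen d n = c) :
    q < (n + n) * blockLen d n := by
  have hn : n < blockLen d n := lt_blockLen
  exact (Nat.div_lt_iff_lt_mul (by omega)).1 (by omega)

theorem xorBits_copyLabel (f : Bits n → Bits n)
    (π : Fin d → Equiv.Perm (Bits (bigLen d n))) (X : ℕ → Bits n) {s : Bits n}
    (hs : ∀ x, f (xorBits x s) = f x) {c : ℕ} (hc : c < n + n) {J : ℕ → Bool} (h0 : J 0 = true)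
    (hJ : ∀ r, 1 ≤ r → r ≤ d → J r = false) :
    xorBits (copyLabel w f π X J) (shiftLabel d n w c s)
      = copyLabel w f π (Function.update X c (xorBits (X c) s)) J := by
  have hM : regLen d n = bigLen d n + 1 := rfl
  have hle := le_bigLen d n
  have hid : n < idxStart d n := lt_idxStart
  funext q
  simp only [xorBits, copyLabel, registerLabel, shiftLabel]
  by_cases hq : q.val / blockLen d n = c
  · have hqC := lt_of_div_eq hc hq
    simp only [hq, Function.update_self, hqC, decide_true, Bool.true_and]
    split_ifs with h1
    · by_cases h2 : q.val % blockLen d n < regLen d n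
      · rw [Nat.div_eq_of_lt h2, Nat.mod_eq_of_lt h2, h0]
        simp only [registerValue, Nat.zero_le, if_true, level, Equiv.Perm.coe_one, id_eq,
          Bool.true_and, getBit, embed, xorBits]
        by_cases h3 : q.val % blockLen d n < n
        · simp [h3, h3.trans_le hle]
        · simp [h3]
      · have h3 : ¬ q.val % blockLen d n < n := by omega
        have h4 : 1 ≤ q.val % blockLen d n / regLen d n :=
          (Nat.one_le_div_iff (by omega)).2 (by omega)
        simp only [getBit, h3, dif_neg, not_false_eq_true, Bool.xor_false]
        by_cases h5 : q.val % blockLen d n / regLen d n ≤ d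
        · simp only [hJ _ h4 h5, Bool.false_and]
        · simp only [registerValue, h5, if_false]
          rw [hs]
    · have h3 : ¬ q.val % blockLen d n < n := by omega
      simp [getBit, h3]
  · simp [hq]

theorem argMask_shiftLabel {c : ℕ} (hc : c < n + n) (s : Bits n) (i : Fin w)
    (hi : argMask d n w i = false) : shiftLabel d n w c s i = false := by
  simp only [argMask, decide_eq_false_iff_not, not_and] at hi
  simp only [shiftLabel]
  by_cases hq : i.val / blockLen d n = c
  · simp [getBit, hi (lt_of_div_eq hc hq)]
  · simp [hq]

theorem computedState_xorBits (hw : (n + n) * blockLen d n ≤ w) {f : Bits n → Bits n}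
    {π : Fin d → Equiv.Perm (Bits (bigLen d n))} {s : Bits n} (hs : ∀ x, f (xorBits x s) = f x)
    {c : ℕ} (hc : c < n + n) (l : Bits w) :
    computedState d n w (shuffleOracle f π) (xorBits l (shiftLabel d n w c s))
      = computedState d n w (shuffleOracle f π) l := by
  have key : ∀ l : Bits w, computedState d n w (shuffleOracle f π) l ≠ 0 →
      computedState d n w (shuffleOracle f π) (xorBits l (shiftLabel d n w c s))
        = computedState d n w (shuffleOracle f π) l := by
    intro l hl
    obtain ⟨X, rfl⟩ := computedState_ne_zero hw hl
    simp only [computedState]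
    rw [xorBits_copyLabel f π X hs hc (by simp) (by intro r h1 h2; simp; omega),
      (preimageLabel_eq_iff hw f π _ _).2 rfl, (preimageLabel_eq_iff hw f π _ _).2 rfl,
      ← xorBits_copyLabel f π X hs hc (by simp) (by intro r h1 h2; simp; omega),
      spread_zeroState_xorBits (argMask_shiftLabel hc s)]
  by_cases hl : computedState d n w (shuffleOracle f π) l = 0
  · by_cases hl' : computedState d n w (shuffleOracle f π) (xorBits l (shiftLabel d n w c s)) = 0
    · rw [hl, hl']
    · have := key _ hl'
      rw [xorBits_xorBits] at this
      exact this.symm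
  · exact key l hl

theorem prod_sign_eq {ι : Type} (S : Finset ι) (p : ι → Bool) :
    ∏ i ∈ S, (if p i then (-1 : ℤ) else 1) = if ∑ i ∈ S, bitZ (p i) = 0 then 1 else -1 := by
  classical
  induction S using Finset.induction_on with
  | empty => simp
  | insert i S hi ih =>
    rw [Finset.prod_insert hi, Finset.sum_insert hi, ih]
    generalize ∑ i ∈ S, bitZ (p i) = x
    cases p i <;> revert x <;> decide

theorem prod_sign_shiftLabel (hw : (n + n) * blockLen d n ≤ w) {s : Bits n} {c : ℕ}
    (hc : c < n + n) {b : Bits w} (hb : dotZ s (fun j => getBit b (c * blockLen d n + j)) ≠ 0) :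
    ∏ i, (if shiftLabel d n w c s i && b i then (-1 : ℤ) else 1) = -1 := by
  have hn : n < blockLen d n := lt_blockLen
  have hlt : ∀ j : Fin n, c * blockLen d n + j.val < w := fun j =>
    (block_lt hc (j.2.trans hn)).trans_le hw
  rw [← Fintype.prod_of_injective (fun j : Fin n => (⟨c * blockLen d n + j.val, hlt j⟩ : Fin w))
    (fun j j' h => Fin.ext (by simpa using h))
    (fun j => if s j && getBit b (c * blockLen d n + j) then (-1 : ℤ) else 1)]
  · rw [prod_sign_eq, if_neg]
    convert hb using 2
    rw [dotZ]
    refine Finset.sum_congr rfl fun j _ => ?_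
    generalize getBit b (c * blockLen d n + j) = v
    cases s j <;> cases v <;> decide
  · intro i hi
    rw [if_neg]
    simp only [Bool.and_eq_true, shiftLabel, decide_eq_true_eq, not_and]
    rintro ⟨h1, h2⟩
    exfalso
    apply hi
    have h3 : i.val % blockLen d n < n := by
      by_contra h
      simp [getBit, h] at h2
    refine ⟨⟨_, h3⟩, Fin.ext ?_⟩
    simp only
    rw [← h1, mul_comm, Nat.div_add_mod]
  · intro j
    obtain ⟨h1, h2⟩ := div_mod_of_lt (c := c) (j.2.trans hn)
    simp only [shiftLabel, h1, h2, decide_true, Bool.true_and, getBit_val, getBit_of_lt b (hlt j)]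

/-- For a function with shift `s`, all samples are orthogonal to `s`. -/
theorem spread_computedState_eq_zero (hw : (n + n) * blockLen d n ≤ w) {f : Bits n → Bits n}
    {π : Fin d → Equiv.Perm (Bits (bigLen d n))} {s : Bits n} (hs : ∀ x, f (xorBits x s) = f x)
    {c : ℕ} (hc : c < n + n) {b : Bits w}
    (hb : dotZ s (fun j => getBit b (c * blockLen d n + j)) ≠ 0) :
    spread (argMask d n w) (indexLabel d n w) (computedState d n w (shuffleOracle f π)) b = 0 :=
  spread_eq_zero (argMask_shiftLabel hc s) (computedState_xorBits hw hs hc)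
    (prod_sign_shiftLabel hw hc hb)

theorem mem_measuredWires_iff (i : Fin w) :
    i.val ∈ measuredWires d n (n + n) ↔ argMask d n w i = true := by
  rw [mem_measuredWires, argMask, decide_eq_true_iff]

theorem card_argMask (hw : (n + n) * blockLen d n ≤ w) :
    (n + n) * n ≤ (Finset.univ.filter fun i => argMask d n w i = true).card := by
  have hn : n < blockLen d n := lt_blockLen
  have h := Finset.card_le_card_of_injOn
    (s := (Finset.univ : Finset (Fin (n + n) × Fin n)))
    (t := Finset.univ.filter fun i => argMask d n w i = true)
    (fun p => ⟨p.1.val * blockLen d n + p.2.val,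
      (block_lt p.1.2 (p.2.2.trans hn)).trans_le hw⟩) ?_ ?_
  · simpa using h
  · rintro ⟨c, j⟩ -
    obtain ⟨h1, h2⟩ := div_mod_of_lt (c := c) (j.2.trans hn)
    simp only [Finset.coe_filter, Set.mem_ofPred_eq, Finset.mem_univ, true_and, argMask,
      decide_eq_true_eq]
    exact ⟨block_lt c.2 (j.2.trans hn), by rw [h2]; exact j.2⟩
  · rintro ⟨c, j⟩ - ⟨c', j'⟩ - h
    obtain ⟨h1, h2⟩ := div_mod_of_lt (c := c) (j.2.trans hn)
    obtain ⟨h1', h2'⟩ := div_mod_of_lt (c := c') (j'.2.trans hn)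
    have h' : c.val * blockLen d n + j.val = c'.val * blockLen d n + j'.val := congrArg Fin.val h
    rw [h'] at h1 h2
    exact Prod.ext (Fin.ext (h1.symm.trans h1')) (Fin.ext (h2.symm.trans h2'))

/-- For a one-to-one function, every outcome of the measurement is at most as probable as under
the uniform distribution. -/
theorem normSqr_project_computedState_le (hw : (n + n) * blockLen d n ≤ w) {f : Bits n → Bits n}
    (hf : Function.Injective f) (π : Fin d → Equiv.Perm (Bits (bigLen d n))) (z : Bits w) :
    normSqr (project (measuredWires d n (n + n)) z
      (spread (argMask d n w) (indexLabel d n w) (computedState d n w (shuffleOracle f π))))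
      ≤ (1 / 2) ^ ((n + n) * n) * normSqr (computedState d n w (shuffleOracle f π)) := by
  refine (normSqr_project_spread_le ?_ mem_measuredWires_iff z).trans ?_
  · intro l l' hl hl' h
    obtain ⟨X, rfl⟩ := computedState_ne_zero hw hl
    obtain ⟨X', rfl⟩ := computedState_ne_zero hw hl'
    have hX : ∀ c < n + n, X c = X' c := by
      intro c hc
      refine hf (embed_injective (le_bigLen d n) (funext fun t => ?_))
      have hM : regLen d n = bigLen d n + 1 := rfl
      have hle := le_bigLen d n
      have ht : t.val < regLen d n := by omega
      have e0 := register_le (n := n) (le_refl d)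
      have e1 : (d + 1) * regLen d n + t.val < blockLen d n := Nat.lt_add_right _ (by omega)
      have e2 : c * blockLen d n + (d + 1) * regLen d n + t.val < w := by
        rw [add_assoc]; exact (block_lt hc e1).trans_le hw
      have e3 := h ⟨_, e2⟩ (by
        have e4 : n ≤ (d + 1) * regLen d n := by
          have := Nat.le_mul_of_pos_left (regLen d n) (show 0 < d + 1 by omega)
          omega
        simp only [argMask, add_assoc, (div_mod_of_lt (c := c) e1).2]
        simp only [decide_eq_false_iff_not, not_and]
        omega)
      rw [← getBit_of_lt (copyLabel w f π X _) e2, ← getBit_of_lt (copyLabel w f π X' _) e2,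
        getBit_registerLabel hw _ _ hc le_rfl ht,
        getBit_registerLabel hw _ _ hc le_rfl ht] at e3
      simpa [registerValue, getBit_val] using e3
    funext q
    simp only [copyLabel, registerLabel]
    by_cases hq : q.val < (n + n) * blockLen d n
    · rw [hX _ (Nat.div_lt_of_lt_mul (by rwa [mul_comm]))]
    · simp [hq]
  · refine mul_le_mul_of_nonneg_right ?_ (normSqr_nonneg _)
    exact pow_le_pow_of_le_one (by norm_num) (by norm_num) (card_argMask hw)

/-- Half of all strings are orthogonal to a given nonzero one. -/
theorem card_dotZ_eq_zero {t : Bits n} (ht : t ≠ fun _ => false) :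
    2 * (Finset.univ.filter fun x : Bits n => dotZ t (getBit x) = 0).card = 2 ^ n := by
  classical
  obtain ⟨i, hi⟩ := Function.ne_iff.1 ht
  set e : Bits n := fun j => decide (j = i) with he
  have h1 : ∀ x : Bits n, dotZ t (getBit (xorBits x e)) = dotZ t (getBit x) + 1 := by
    intro x
    have h2 : (getBit (xorBits x e)) = fun j => xor (getBit x j) (getBit e j) := by
      funext j
      simp only [getBit, xorBits]
      split_ifs <;> rfl
    rw [h2, dotZ_xor]
    congr 1
    rw [dotZ, Finset.sum_eq_single i]
    · have hti : t i = true := by simpa using hi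
      simp [getBit_val, he, hti, bitZ]
    · intro j _ hj
      simp [getBit_val, he, hj, bitZ]
    · simp
  have h2 : (Finset.univ.filter fun x : Bits n => dotZ t (getBit x) = 0).card
      = (Finset.univ.filter fun x : Bits n => ¬ dotZ t (getBit x) = 0).card := by
    refine Finset.card_bij' (fun x _ => xorBits x e) (fun x _ => xorBits x e) ?_ ?_ ?_ ?_
    · intro x hx
      simp only [Finset.mem_filter, Finset.mem_univ, true_and] at hx ⊢
      rw [h1, hx]; decide
    · intro x hx
      simp only [Finset.mem_filter, Finset.mem_univ, true_and] at hx ⊢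
      rw [h1]
      revert hx
      generalize dotZ t (getBit x) = y
      revert y; decide
    · intro x _; exact xorBits_xorBits x e
    · intro x _; exact xorBits_xorBits x e
  have h3 := Finset.card_filter_add_card_filter_not (s := (Finset.univ : Finset (Bits n)))
    (fun x : Bits n => dotZ t (getBit x) = 0)
  have h4 : (Finset.univ : Finset (Bits n)).card = 2 ^ n := by simp
  omega

open Classical in
/-- Few outcomes of the measurement do not span: each nonzero string is orthogonal to a fraction
`2^{-2n}` of them. -/
theorem card_deficient_le :
    ((Finset.univ.filter fun z : Bits w => (∀ i : Fin w, i.val ∉ measuredWires d n (n + n) →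
      z i = false) ∧ Deficient d n (getBit z)).card : ℝ) * (1 / 2) ^ ((n + n) * n)
        ≤ 1 / 2 ^ n := by
  have hn : n < blockLen d n := lt_blockLen
  set Z : Finset (Bits w) := Finset.univ.filter fun z : Bits w =>
    (∀ i : Fin w, i.val ∉ measuredWires d n (n + n) → z i = false) ∧ Deficient d n (getBit z)
  set κ : Bits w → Fin (n + n) → Bits n := fun z c j => getBit z (c * blockLen d n + j)
  have hκ : ∀ (z : Bits w) (c : Fin (n + n)) (t : Bits n), dotZ t (getBit (κ z c))
      = dotZ t fun j => getBit z (c * blockLen d n + j) := by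
    intro z c t
    refine Finset.sum_congr rfl fun j _ => ?_
    rw [getBit_val]
  have h1 : Z.card ≤ ((Finset.univ.filter fun t : Bits n => t ≠ fun _ => false).biUnion
      fun t => Fintype.piFinset fun _ : Fin (n + n) =>
        Finset.univ.filter fun x : Bits n => dotZ t (getBit x) = 0).card := by
    refine Finset.card_le_card_of_injOn κ ?_ ?_
    · intro z hz
      obtain ⟨-, t, ht, ho⟩ := (Finset.mem_filter.1 hz).2
      simp only [Finset.coe_biUnion, Set.mem_iUnion, Finset.mem_coe, Fintype.mem_piFinset,
        Finset.mem_filter, Finset.mem_univ, true_and]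
      exact ⟨t, ht, fun c => (hκ z c t).trans (ho c c.2)⟩
    · intro z hz z' hz' h
      have hz1 := (Finset.mem_filter.1 hz).2.1
      have hz1' := (Finset.mem_filter.1 hz').2.1
      funext q
      by_cases hq : q.val ∈ measuredWires d n (n + n)
      · obtain ⟨h2, h3⟩ := mem_measuredWires.1 hq
        have h4 : q.val / blockLen d n < n + n := Nat.div_lt_of_lt_mul (by rwa [mul_comm])
        have h5 := congrFun (congrFun h ⟨_, h4⟩) ⟨_, h3⟩
        simp only [κ] at h5
        rwa [mul_comm, Nat.div_add_mod, getBit_val, getBit_val] at h5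
      · rw [hz1 q hq, hz1' q hq]
  have h2 : (Z.card : ℝ) ≤ 2 ^ n * (2 ^ n / 2) ^ (n + n) := by
    refine (Nat.cast_le.2 (h1.trans Finset.card_biUnion_le)).trans ?_
    rw [Nat.cast_sum]
    calc _ ≤ ∑ t ∈ (Finset.univ.filter fun t : Bits n => t ≠ fun _ => false),
          ((2 : ℝ) ^ n / 2) ^ (n + n) := by
          refine Finset.sum_le_sum fun t ht => ?_
          have h3 := card_dotZ_eq_zero (Finset.mem_filter.1 ht).2
          have h4 : ((Finset.univ.filter fun x : Bits n => dotZ t (getBit x) = 0).card : ℝ)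
              = 2 ^ n / 2 := by
            rw [eq_div_iff (by norm_num), mul_comm]
            exact_mod_cast h3
          rw [Fintype.card_piFinset, Finset.prod_const, Nat.cast_pow, h4]
          simp
      _ ≤ _ := by
          rw [Finset.sum_const, nsmul_eq_mul]
          refine mul_le_mul_of_nonneg_right ?_ (by positivity)
          have : (Finset.univ.filter fun t : Bits n => t ≠ fun _ => false).card
              ≤ Fintype.card (Bits n) := Finset.card_le_univ _
          have h5 : Fintype.card (Bits n) = 2 ^ n := by simp
          rw [h5] at this
          exact_mod_cast this
  calc (Z.card : ℝ) * (1 / 2) ^ ((n + n) * n)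
      ≤ 2 ^ n * (2 ^ n / 2) ^ (n + n) * (1 / 2) ^ ((n + n) * n) :=
        mul_le_mul_of_nonneg_right h2 (by positivity)
    _ = 1 / 2 ^ n := by
        rw [mul_comm (n + n) n, pow_mul, mul_assoc, ← mul_pow]
        rw [show (2 : ℝ) ^ n / 2 * (1 / 2) ^ n = 1 / 2 by
          rw [one_div, inv_pow]; field_simp]
        rw [pow_add, one_div, inv_pow]
        field_simp

end Samples

/-! ### The program and its success probability -/

section Program

variable {d n w : ℕ}

/-- The memory that the layers of the program leave intact. -/
def Prepared (d n : ℕ) (m : ℕ → ℕ) : Prop :=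
  ∃ σ, Agree m σ ∧ Layout d n σ ∧ ∀ y, 64 + matStart d n ≤ y → σ y = 0

/-- The layers with the oracle gates for the listed functions, followed by `K`. -/
def runLayers (d : ℕ) : List ℕ → Cmd → Cmd
  | [], K => K
  | j :: js, K => .seq (queryAll d j) (.seq .fire (runLayers d js K))

/-- Simon's algorithm on `2 n` copies, where `f` is evaluated through the shuffling. -/
def simonProgram (d : ℕ) : Cmd := .seq (prepare d) (.seq (spreadCmd d false)
  (runLayers d (schedule d) (.seq (spreadCmd d true) (.seq .fire evaluateCmd))))

/-- The effect of one layer without measurement; any lower bound `R` for the rest of the run is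
a lower bound for the run. -/
theorem exists_run_layer (d j : ℕ) (hj : j ≤ d) : ∃ T : ℕ → ℕ, PolyBounded T ∧
    ∀ (n w D f t : ℕ) (O : Bits (inLen d n) → Bits (outLen d n)) (v : Bool) (R : ℝ) (K : Cmd)
      (m : ℕ → ℕ) (out : ℕ → Bool) (G : List Gate) (ψ : State w),
      (n + n) * blockLen d n ≤ w → f < D → Prepared d n m → (G.flatMap Gate.wires).Nodup →
      (∀ q ∈ G.flatMap Gate.wires, q < w) →
      (∀ m' out', Prepared d n m' → R ≤ run O D w v t ⟨[K], m', Layer.empty _ _, f + 1, out'⟩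
        fun l => applyGates G ψ (flipAll O (copyGates d n j (n + n)) l)) →
      R ≤ run O D w v (t + T n)
        ⟨[.seq (queryAll d j) (.seq .fire K)], m, ⟨G, [], []⟩, f, out⟩ ψ := by
  obtain ⟨T, hT, hex⟩ := exec_queryAll d j
  refine ⟨fun n => T n + 3, hT.add (PolyBounded.const 3), ?_⟩
  intro n w D f t O v R K m out G ψ hw hf ⟨σ, hmσ, hL, h0⟩ hG hGw hR
  obtain ⟨s', e, hL', h0', hs'⟩ := hex n out (σ, ⟨G, [], []⟩) hL
  obtain ⟨m', hm', hst⟩ := e m hmσ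
  have hQ := copyGates_valid (n := n) hj (n + n)
  have hlayer : s'.2 = ⟨G, copyGates d n j (n + n), []⟩ := by rw [hs']; simp
  have h1 := hst O D w v [.seq .fire K] (t + 2) f ψ
  rw [hlayer] at h1
  refine le_trans ?_ (h1.trans (le_of_eq ?_))
  · rw [show t + 2 = t + 1 + 1 by ring, run_seq, run_fire, if_pos]
    · refine le_trans ?_ (Finset.single_le_sum (fun z _ => ?_)
        (Finset.mem_univ (fun _ => false : Bits w)))
      · rw [if_pos fun _ _ => rfl]
        have h2 : project [] (fun _ => false) (Layer.apply O ⟨G, copyGates d n j (n + n), []⟩ ψ)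
            = fun l => applyGates G ψ (flipAll O (copyGates d n j (n + n)) l) := by
          rw [Layer.apply_eq O _ hQ.1]
          funext l
          simp [project]
        rw [h2]
        exact hR _ _ ⟨s'.1, hm', hL', fun y hy => (h0' y hy).trans (h0 y hy)⟩
      · split_ifs
        exacts [run_nonneg _ _ _ _ _ _ _, le_rfl]
    · exact ⟨⟨hG, hGw, hQ.1, fun q hq => (hQ.2 q hq).trans_le hw, by simp⟩, Or.inl hf⟩
  · change _ = run O D w v (t + (T n + 3)) _ ψ
    rw [show t + (T n + 3) = t + 2 + T n + 1 by ring, run_seq]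

theorem exists_run_layers (d : ℕ) (js : List ℕ) (hjs : ∀ j ∈ js, j ≤ d) :
    ∃ T : ℕ → ℕ, PolyBounded T ∧
    ∀ (n w D f t : ℕ) (O : Bits (inLen d n) → Bits (outLen d n)) (v : Bool) (R : ℝ) (K : Cmd)
      (m : ℕ → ℕ) (out : ℕ → Bool) (ψ : State w),
      (n + n) * blockLen d n ≤ w → f + js.length ≤ D → Prepared d n m →
      (∀ m' out', Prepared d n m' →
        R ≤ run O D w v t ⟨[K], m', Layer.empty _ _, f + js.length, out'⟩
        fun l => ψ (js.foldr (fun j l => flipAll O (copyGates d n j (n + n)) l) l)) →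
      R ≤ run O D w v (t + T n) ⟨[runLayers d js K], m, Layer.empty _ _, f, out⟩ ψ := by
  induction js with
  | nil =>
    refine ⟨fun _ => 0, PolyBounded.const 0, ?_⟩
    intro n w D f t O v R K m out ψ hw hf hm hR
    exact hR m out hm
  | cons j js ih =>
    obtain ⟨T, hT, h⟩ := ih fun k hk => hjs k (by simp [hk])
    obtain ⟨T', hT', h'⟩ := exists_run_layer d j (hjs j (by simp))
    refine ⟨fun n => T n + T' n, hT.add hT', ?_⟩
    intro n w D f t O v R K m out ψ hw hf hm hR
    rw [List.length_cons] at hf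
    rw [← add_assoc]
    refine h' n w D f (t + T n) O v R (runLayers d js K) m out [] ψ hw (by omega) hm (by simp)
      (by simp) fun m' out' hm' => ?_
    refine h n w D (f + 1) t O v R K m' out' _ hw (by omega) hm' fun m'' out'' hm'' => ?_
    have := hR m'' out'' hm''
    rw [List.length_cons, show f + (js.length + 1) = f + 1 + js.length by ring] at this
    exact this

open Classical in
/-- The probability of the output `v` in terms of the last measurement: the output is `true`
if and only if the samples are deficient. -/
theorem exists_run_last (d : ℕ) : ∃ T : ℕ → ℕ, PolyBounded T ∧
    ∀ (n w D : ℕ) (O : Bits (inLen d n) → Bits (outLen d n)) (v : Bool)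
      (m : ℕ → ℕ) (out : ℕ → Bool) (ψ : State w),
      (n + n) * blockLen d n ≤ w → Prepared d n m →
      (∑ z : Bits w, if (∀ i : Fin w, i.val ∉ measuredWires d n (n + n) → z i = false) ∧
        decide (Deficient d n (getBit z)) = v then normSqr (project (measuredWires d n (n + n)) z
          (spread (argMask d n w) (indexLabel d n w) ψ)) else 0) ≤
      run O D w v (T n) ⟨[.seq (spreadCmd d true) (.seq .fire evaluateCmd)], m,
        Layer.empty _ _, D, out⟩ ψ := by
  obtain ⟨T, hT, hex⟩ := exec_spreadCmd d true
  obtain ⟨T', hT', hex'⟩ := exec_evaluateCmd d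
  refine ⟨fun n => T' n + T n + 4, (hT'.add hT).add (PolyBounded.const 4), ?_⟩
  intro n w D O v m out ψ hw ⟨σ, hmσ, hL, h0⟩
  obtain ⟨s', e, hL', h0', hs'⟩ := hex _ _ n out (σ, Layer.empty (inLen d n) (outLen d n)) hL
  obtain ⟨m', hm', hst⟩ := e m hmσ
  have hlayer : s'.2 = ⟨spreadGates d n (n + n), [], measuredWires d n (n + n)⟩ := by
    rw [hs']; simp [Layer.empty]
  have h1 := hst O D w v [.seq .fire evaluateCmd] (T' n + 3) D ψ
  rw [hlayer] at h1
  refine le_trans ?_ (h1.trans (le_of_eq ?_))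
  · rw [show T' n + 3 = T' n + 1 + 1 + 1 by ring, run_seq, run_fire, if_pos]
    · refine Finset.sum_le_sum fun z _ => ?_
      by_cases hz : ∀ i : Fin w, i.val ∉ measuredWires d n (n + n) → z i = false
      · rw [if_pos hz]
        by_cases hv : decide (Deficient d n (getBit z)) = v
        · rw [if_pos ⟨hz, hv⟩]
          have h2 : Layer.apply O ⟨spreadGates d n (n + n), [], measuredWires d n (n + n)⟩ ψ
              = spread (argMask d n w) (indexLabel d n w) ψ := applyGates_spreadGates hw ψ
          rw [h2]
          obtain ⟨s'', e', hs''⟩ := hex' _ _ n (getBit z)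
            (s'.1, Layer.empty (inLen d n) (outLen d n)) hL'
            fun y hy => by rw [h0' y (by omega)]; exact h0 y hy
          obtain ⟨m'', hm'', hst'⟩ := e' m' hm'
          rw [add_comm (T' n) 1]
          refine le_trans (le_of_eq ?_) (hst' O D w v [] 1 (D + 1) _)
          have h3 : decide (m'' 0 ≠ 0) = v := by
            rw [← hv, decide_eq_decide, hm'' 0 (Or.inl (by norm_num))]
            exact hs''
          exact (if_pos h3).symm
        · rw [if_neg fun h => hv h.2]
          exact run_nonneg _ _ _ _ _ _ _
      · rw [if_neg fun h => hz h.1, if_neg hz]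
    · refine ⟨⟨?_, ?_, by simp, by simp, fun q hq => ?_⟩, Or.inr ⟨rfl, rfl⟩⟩
      · rw [flatMap_spreadGates]; exact nodup_gateWires _
      · rw [flatMap_spreadGates]
        exact fun q hq => (mem_gateWires.1 hq).1.trans_le hw
      · exact (mem_measuredWires.1 hq).1.trans_le hw
  · change _ = run O D w v (T' n + T n + 4) _ ψ
    rw [show T' n + T n + 4 = T' n + 3 + T n + 1 by ring, run_seq]

open Classical in
/-- With polynomially many qubits and steps, the output of the program is at least as often `v` as
the deficiency of ideal samples is decided to be `v`. -/
theorem exists_le_outProb (d : ℕ) : ∃ p : Polynomial ℕ,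
    ∀ (n : ℕ) (O : Bits (inLen d n) → Bits (outLen d n)) (v : Bool),
      (n + n) * blockLen d n ≤ p.eval n ∧
      (∑ z : Bits (p.eval n),
        if (∀ i : Fin (p.eval n), i.val ∉ measuredWires d n (n + n) → z i = false) ∧
          decide (Deficient d n (getBit z)) = v then
          normSqr (project (measuredWires d n (n + n)) z (spread (argMask d n (p.eval n))
            (indexLabel d n (p.eval n)) (computedState d n (p.eval n) O))) else 0) ≤
      outProb O (2 * d + 1) (p.eval n) (simonProgram d) n v := by
  obtain ⟨j, js, hs⟩ : ∃ j js, schedule d = j :: js := by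
    rcases h : schedule d with _ | ⟨j, js⟩
    · have := length_schedule d
      rw [h] at this
      simp at this
    · exact ⟨j, js, rfl⟩
  have hlen : js.length = 2 * d := by
    have := length_schedule d
    rw [hs, List.length_cons] at this
    omega
  have hle : ∀ k ∈ schedule d, k ≤ d := fun k hk => le_of_mem_schedule hk
  obtain ⟨T₁, hex₁⟩ := exec_prepare d
  obtain ⟨T₂, hT₂, hex₂⟩ := exec_spreadCmd d false
  obtain ⟨T₃, hT₃, hrun₃⟩ := exists_run_layer d j (hle j (by simp [hs]))
  obtain ⟨T₄, hT₄, hrun₄⟩ := exists_run_layers d js fun k hk => hle k (by simp [hs, hk])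
  obtain ⟨T₅, hT₅, hrun₅⟩ := exists_run_last d
  have htotal : PolyBounded fun n => (T₅ n + T₄ n + T₃ n + T₂ n + T₁ + 2)
      + (n + n) * ((d + 2) * ((d + 2) * n + 1) + (d + 1) * (d + 1)) := by
    repeat first
      | assumption
      | exact PolyBounded.const _
      | exact PolyBounded.id
      | apply PolyBounded.add
      | apply PolyBounded.mul
  obtain ⟨p, hp⟩ := htotal
  refine ⟨p, fun n O v => ?_⟩
  have hw : (n + n) * blockLen d n ≤ p.eval n := (Nat.le_add_left _ _).trans (hp n)
  have ht : T₅ n + T₄ n + T₃ n + T₂ n + T₁ + 2 ≤ p.eval n := (Nat.le_add_right _ _).trans (hp n)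
  refine ⟨hw, ?_⟩
  generalize p.eval n = w at hw ht
  rw [outProb]
  refine le_trans ?_ (run_mono O (2 * d + 1) w v ht _ _)
  set m₀ : ℕ → ℕ := fun x => if x = 0 then n else 0 with hm₀
  obtain ⟨s₁, e₁, L₁, z₁, l₁⟩ := hex₁ _ _ n (fun _ => false)
    (Layer.empty (inLen d n) (outLen d n))
  obtain ⟨m₁, a₁, st₁⟩ := e₁ m₀ fun _ _ => rfl
  obtain ⟨s₂, e₂, L₂, z₂, l₂⟩ := hex₂ _ _ n (fun _ => false) s₁ L₁
  obtain ⟨m₂, a₂, st₂⟩ := e₂ m₁ a₁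
  have hm₂ : Prepared d n m₂ := ⟨s₂.1, a₂, L₂, fun y hy => by
    rw [z₂ y (by omega), z₁ y (by omega)]⟩
  have hlayer : s₂.2 = ⟨spreadGates d n (n + n), [], []⟩ := by
    rw [l₂, l₁]; simp [Layer.empty]
  set K : Cmd := .seq (spreadCmd d true) (.seq .fire evaluateCmd) with hK
  have r₁ := st₁ O (2 * d + 1) w v [.seq (spreadCmd d false) (runLayers d (schedule d) K)]
    (T₅ n + T₄ n + T₃ n + T₂ n + 1) 0 (zeroState w)
  have r₂ := st₂ O (2 * d + 1) w v [runLayers d (schedule d) K] (T₅ n + T₄ n + T₃ n) 0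
    (zeroState w)
  have e1 : run O (2 * d + 1) w v (T₅ n + T₄ n + T₃ n + T₂ n + T₁ + 2)
      (start (inLen d n) (outLen d n) (simonProgram d) n) (zeroState w)
      = run O (2 * d + 1) w v (T₅ n + T₄ n + T₃ n + T₂ n + 1 + T₁) ⟨[prepare d,
        .seq (spreadCmd d false) (runLayers d (schedule d) K)], m₀,
        Layer.empty (inLen d n) (outLen d n), 0, fun _ => false⟩ (zeroState w) := by
    rw [show T₅ n + T₄ n + T₃ n + T₂ n + T₁ + 2 = T₅ n + T₄ n + T₃ n + T₂ n + 1 + T₁ + 1 by ring]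
    rfl
  rw [e1]
  refine le_trans ?_ r₁
  rw [run_seq]
  refine le_trans ?_ r₂
  simp only [hlayer, hs, runLayers]
  refine hrun₃ n w (2 * d + 1) 0 (T₅ n + T₄ n) O v _ (runLayers d js K) m₂ _ _ _ hw (by omega) hm₂
    (by rw [flatMap_spreadGates]; exact nodup_gateWires _)
    (by
      rw [flatMap_spreadGates]
      exact fun q hq => (mem_gateWires.1 hq).1.trans_le hw) fun m₃ out₃ hm₃ => ?_
  refine hrun₄ n w (2 * d + 1) (0 + 1) (T₅ n) O v _ K m₃ out₃ _ hw (by omega) hm₃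
    fun m₄ out₄ hm₄ => ?_
  have r₅ := hrun₅ n w (2 * d + 1) O v m₄ out₄ (computedState d n w O) hw hm₄
  rw [show 0 + 1 + js.length = 2 * d + 1 by omega]
  have e2 : (fun l => applyGates (spreadGates d n (n + n)) (zeroState w)
      (flipAll O (copyGates d n j (n + n))
        (js.foldr (fun j l => flipAll O (copyGates d n j (n + n)) l) l)))
      = computedState d n w O := by
    funext l
    rw [computedState, preimageLabel, hs, List.foldr_cons, applyGates_spreadGates hw]
  rw [e2]
  exact r₅

theorem normSqr_computedState (hw : (n + n) * blockLen d n ≤ w)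
    (O : Bits (inLen d n) → Bits (outLen d n)) : normSqr (computedState d n w O) = 1 := by
  have hinv := flipAll_copyGates_involutive (w := w) O
  have hbij : Function.Bijective (preimageLabel O : Bits w → Bits w) :=
    Function.bijective_iff_has_inverse.2 ⟨fun l => (schedule d).foldl
      (fun l j => flipAll O (copyGates d n j (n + n)) l) l, foldl_foldr hinv, foldr_foldl hinv⟩
  have h1 : normSqr (computedState d n w O)
      = normSqr (spread (argMask d n w) (indexLabel d n w) (zeroState w)) :=
    Fintype.sum_bijective _ hbij _ _ fun _ => rfl
  rw [h1, ← applyGates_spreadGates hw, normSqr_applyGates, normSqr_zeroState]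
  · rw [flatMap_spreadGates]; exact nodup_gateWires _
  · rw [flatMap_spreadGates]
    exact fun q hq => (mem_gateWires.1 hq).1.trans_le hw

theorem normSqr_spread_computedState (hw : (n + n) * blockLen d n ≤ w)
    (O : Bits (inLen d n) → Bits (outLen d n)) :
    normSqr (spread (argMask d n w) (indexLabel d n w) (computedState d n w O)) = 1 := by
  rw [← applyGates_spreadGates hw, normSqr_applyGates, normSqr_computedState hw]
  · rw [flatMap_spreadGates]; exact nodup_gateWires _
  · rw [flatMap_spreadGates]
    exact fun q hq => (mem_gateWires.1 hq).1.trans_le hw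

open Classical in
theorem le_sum_of_isSimon (hw : (n + n) * blockLen d n ≤ w) {f : Bits n → Bits n}
    (hf : IsSimon f) (π : Fin d → Equiv.Perm (Bits (bigLen d n))) :
    1 ≤ ∑ z : Bits w, if (∀ i : Fin w, i.val ∉ measuredWires d n (n + n) → z i = false) ∧
      decide (Deficient d n (getBit z)) = true then normSqr (project (measuredWires d n (n + n)) z
        (spread (argMask d n w) (indexLabel d n w)
          (computedState d n w (shuffleOracle f π)))) else 0 := by
  obtain ⟨s, hs0, hs⟩ := hf
  have hn : n < blockLen d n := lt_blockLen
  rw [← normSqr_spread_computedState hw (shuffleOracle f π),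
    ← sum_normSqr_project (measuredWires d n (n + n))]
  refine Finset.sum_le_sum fun z _ => ?_
  by_cases hz : ∀ i : Fin w, i.val ∉ measuredWires d n (n + n) → z i = false
  · rw [if_pos hz]
    by_cases hd : Deficient d n (getBit z)
    · rw [if_pos ⟨hz, decide_eq_true hd⟩]
    · rw [if_neg fun h => hd (of_decide_eq_true h.2)]
      have hd' : ∃ c < n + n, dotZ s (fun j => getBit z (c * blockLen d n + j)) ≠ 0 := by
        by_contra hcon
        push Not at hcon
        exact hd ⟨s, hs0, hcon⟩
      obtain ⟨c, hc, hsc⟩ := hd'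
      refine le_of_eq (Finset.sum_eq_zero fun b _ => ?_)
      simp only [project]
      split_ifs with hb
      · have hfs : ∀ x, f (xorBits x s) = f x := fun x =>
          (hs _ _).2 (Or.inr (xorBits_xorBits x s).symm)
        have hbz : dotZ s (fun j => getBit b (c * blockLen d n + j))
            = dotZ s (fun j => getBit z (c * blockLen d n + j)) := by
          refine Finset.sum_congr rfl fun j _ => ?_
          have h1 := block_lt hc (j.2.trans hn)
          have h2 := (div_mod_of_lt (c := c) (j.2.trans hn)).2
          simp only
          rw [getBit_of_lt b (h1.trans_le hw), getBit_of_lt z (h1.trans_le hw),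
            hb _ (mem_measuredWires.2 ⟨h1, by rw [h2]; exact j.2⟩)]
        rw [spread_computedState_eq_zero hw hfs hc (hbz ▸ hsc)]
        simp
      · simp
  · rw [if_neg hz, if_neg fun h => hz h.1]

open Classical in
theorem le_sum_of_injective (hw : (n + n) * blockLen d n ≤ w) {f : Bits n → Bits n}
    (hf : Function.Injective f) (π : Fin d → Equiv.Perm (Bits (bigLen d n))) :
    1 - 1 / 2 ^ n ≤ ∑ z : Bits w,
      if (∀ i : Fin w, i.val ∉ measuredWires d n (n + n) → z i = false) ∧
      decide (Deficient d n (getBit z)) = false then normSqr (project (measuredWires d n (n + n)) z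
        (spread (argMask d n w) (indexLabel d n w)
          (computedState d n w (shuffleOracle f π)))) else 0 := by
  set P : Bits w → ℝ := fun z => normSqr (project (measuredWires d n (n + n)) z
    (spread (argMask d n w) (indexLabel d n w) (computedState d n w (shuffleOracle f π)))) with hP
  have h1 : (∑ z : Bits w, if ∀ i : Fin w, i.val ∉ measuredWires d n (n + n) → z i = false
      then P z else 0) = 1 := by
    rw [← normSqr_spread_computedState hw (shuffleOracle f π)]
    exact sum_normSqr_project _ _
  have h2 : (∑ z : Bits w, if (∀ i : Fin w, i.val ∉ measuredWires d n (n + n) → z i = false) ∧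
      Deficient d n (getBit z) then P z else 0) ≤ 1 / 2 ^ n := by
    rw [← Finset.sum_filter]
    refine le_trans ?_ (card_deficient_le (d := d) (n := n) (w := w))
    rw [← nsmul_eq_mul]
    refine Finset.sum_le_card_nsmul _ _ _ fun z _ => ?_
    have := normSqr_project_computedState_le hw hf π z
    rwa [normSqr_computedState hw, mul_one] at this
  have h3 : (∑ z : Bits w, if ∀ i : Fin w, i.val ∉ measuredWires d n (n + n) → z i = false
      then P z else 0) =
      (∑ z : Bits w, if (∀ i : Fin w, i.val ∉ measuredWires d n (n + n) → z i = false) ∧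
        Deficient d n (getBit z) then P z else 0) +
      ∑ z : Bits w, if (∀ i : Fin w, i.val ∉ measuredWires d n (n + n) → z i = false) ∧
        decide (Deficient d n (getBit z)) = false then P z else 0 := by
    rw [← Finset.sum_add_distrib]
    refine Finset.sum_congr rfl fun z _ => ?_
    by_cases hd : Deficient d n (getBit z) <;> simp [hd]
  linarith

theorem le_avg {α : Type} {S : Finset α} (hS : S.Nonempty) {g : α → ℝ} {c : ℝ}
    (h : ∀ x ∈ S, c ≤ g x) : c ≤ avg S g := by
  rw [avg, le_div_iff₀ (by exact_mod_cast hS.card_pos), mul_comm, ← nsmul_eq_mul]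
  exact Finset.card_nsmul_le_sum _ _ _ h

theorem simonFns_nonempty (hn : 1 ≤ n) : (simonFns n).Nonempty := by
  classical
  refine ⟨fun x i => if i.val = 0 then false else x i, ?_⟩
  rw [simonFns, Finset.mem_filter]
  refine ⟨Finset.mem_univ _, fun i => decide (i.val = 0), fun h => ?_, fun x y => ?_⟩
  · simpa using congrFun h ⟨0, hn⟩
  · constructor
    · intro h
      have h' : ∀ i : Fin n, i.val ≠ 0 → x i = y i := fun i hi => by
        simpa [hi] using congrFun h i
      by_cases h0 : x ⟨0, hn⟩ = y ⟨0, hn⟩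
      · refine Or.inl (funext fun i => ?_)
        by_cases hi : i.val = 0
        · rw [show i = ⟨0, hn⟩ from Fin.ext hi, h0]
        · exact (h' i hi).symm
      · refine Or.inr (funext fun i => ?_)
        by_cases hi : i.val = 0
        · rw [show i = ⟨0, hn⟩ from Fin.ext hi]
          simp only [xorBits, decide_true, Bool.xor_true]
          revert h0
          cases x ⟨0, hn⟩ <;> cases y ⟨0, hn⟩ <;> simp
        · simp [xorBits, hi, h' i hi]
    · rintro (rfl | rfl)
      · rfl
      · funext i
        by_cases hi : i.val = 0 <;> simp [xorBits, hi]

theorem oneToOneFns_nonempty (n : ℕ) : (oneToOneFns n).Nonempty := by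
  classical
  exact ⟨id, by simp [oneToOneFns, Function.injective_id]⟩

theorem upper_bound (d : ℕ) : ∃ (P : Cmd) (p : Polynomial ℕ), ∀ n : ℕ, 1 ≤ n →
    1 - 1 / 2 ^ (n + 1) ≤ successProb d n (2 * d + 1) (p.eval n) P := by
  classical
  obtain ⟨p, hp⟩ := exists_le_outProb d
  refine ⟨simonProgram d, p, fun n hn => ?_⟩
  have h1 : 1 ≤ avg (simonFns n) (fun f =>
      avg (Finset.univ : Finset (Fin d → Equiv.Perm (Bits (bigLen d n)))) (fun π =>
        outProb (shuffleOracle f π) (2 * d + 1) (p.eval n) (simonProgram d) n true)) := by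
    refine le_avg (simonFns_nonempty hn) fun f hf => le_avg Finset.univ_nonempty fun π _ => ?_
    obtain ⟨hw, h⟩ := hp n (shuffleOracle f π) true
    exact (le_sum_of_isSimon hw (Finset.mem_filter.1 hf).2 π).trans h
  have h2 : 1 - 1 / 2 ^ n ≤ avg (oneToOneFns n) (fun f =>
      avg (Finset.univ : Finset (Fin d → Equiv.Perm (Bits (bigLen d n)))) (fun π =>
        outProb (shuffleOracle f π) (2 * d + 1) (p.eval n) (simonProgram d) n false)) := by
    refine le_avg (oneToOneFns_nonempty n) fun f hf => le_avg Finset.univ_nonempty fun π _ => ?_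
    obtain ⟨hw, h⟩ := hp n (shuffleOracle f π) false
    exact (le_sum_of_injective hw (Finset.mem_filter.1 hf).2 π).trans h
  rw [successProb]
  have h3 : (1 : ℝ) / 2 ^ (n + 1) = 1 / 2 * (1 / 2 ^ n) := by rw [pow_succ]; ring
  rw [h3]
  linarith

end Program

end QCS

end

theorem mainTheorem2 (d : ℕ) :
    (∃ (P : QCS.Cmd) (p : Polynomial ℕ), ∀ n : ℕ, 1 ≤ n →
      1 - 1 / 2 ^ (n + 1) ≤ QCS.successProb d n (2 * d + 1) (p.eval n) P) ∧
    (∀ (P : ℕ → QCS.Cmd) (p : Polynomial ℕ), ∃ q : Polynomial ℕ, ∀ n : ℕ,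
      QCS.successProb d n d (p.eval n) (P n) ≤ 1 / 2 + Real.sqrt (((q.eval n : ℕ) : ℝ) / 2 ^ n)) := by
  exact ⟨QCS.upper_bound d, QCS.lower_bound d⟩
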